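/- Let $\alpha\in(0,1)$, $T>0$, and let $p\ge 1$ be an integer. Consider $$u'(t)+a(t)u(t)+\mathcal B u(t)=f(t),\quad 0<t<T,\qquad u(0)=u_0,\qquad \mathcal B u(t)=\int_0^t (t-s)^{\alpha-1}b(s)u(s)\,ds,$$ with $a,b,f:[0,T]\to\mathbb R$ continuous and $\mu_*\le a(t)\le\mu^*$, $|b(t)|\le\mu^*$ on $[0,T]$ for constants $\mu_*,\mu^*>0$. With $m=\min\{p,2\}$, assume that $a$ and $b$ are $m$ times differentiable on $(0,T)$ and that, for a constant $M_0$, $|a^{(j)}(t)|,|b^{(j)}(t)|\le M_0t^{\alpha-j}$ for $1\le j\le m$, $0<t<T$ (this holds for instance if $a,b\in C^m[0,T]$). Assume that the solution $u$ (continuous on $[0,T]$) is $p+1$ times differentiable on $(0,T)$ and satisfies $$|u^{(j)}(t)|\le M\,t^{\sigma-j},\qquad 1\le j\le p+1,\ 0<t<T,\qquad\text{where } 1\le\sigma\le\alpha+1 .$$ Let $0=t_0<t_1<\dots<t_N=T$, $I_n=(t_{n-1},t_n)$, $k_n=t_n-t_{n-1}$, $k=\max_{1\le n\le N}k_n$.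 For a fixed $\gamma\ge1$ and constants $c_\gamma,C_\gamma>0$ assume $$k_n\le C_\gamma k\,t_n^{1-1/\gamma},\quad t_n\le C_\gamma t_{n-1}\quad(2\le n\le N),\qquad c_\gamma k^\gamma\le k_1\le C_\gamma k^\gamma,\qquad k_{n-1}\le k_n\quad(2\le n\le N),$$ and that $k$ is so small that $4T^\alpha\bigl(\mu^*/(\alpha\mu_*)\bigr)^2k^\alpha<1$. Let $U$ be a discontinuous Galerkin (DG) approximation of degree $p$: $U|_{I_n}$ is a polynomial of degree at most $p$ for $1\le n\le N$, and, with $U^n_\pm$ the one-sided limits at $t_n$ and $U^0_-:=u_0$, $$U^{n-1}_+X(t_{n-1})+\int_{t_{n-1}}^{t_n}\bigl[U'+aU+\mathcal BU\bigr]X\,dt=U^{n-1}_-X(t_{n-1})+\int_{t_{n-1}}^{t_n}fX\,dt$$ for $1\le n\le N$ and all polynomials $X$ of degree at most $p$. Then there is a constant $C$, depending only on $\alpha,p,T,a,b,M_0,\mu_*,\mu^*,\sigma,M,\gamma,c_\gamma,C_\gamma$ (and not on $f$, $u_0$, $u$, the mesh, or $U$), such that for every $1\le n\le N$: 1. if $p=1$,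 then $|U^n_--u(t_n)|\le C\,k\cdot k^{\min\{\gamma\sigma,2\}}$; 2. if $p\ge2$, then $|U^n_--u(t_n)|\le C\max\{1,\log n\}\,k^{\alpha+1}\cdot k^{\min\{\gamma\sigma,p+1\}}$; 3. if $\gamma>(p+1)/\sigma$, then $|U^n_--u(t_n)|\le C\,k^{p+1+\min\{p,\alpha+1\}}$. -/

import Mathlib

open Set

noncomputable section

namespace DGVolterra

/-! ### The Volterra integro-differential equation -/

/-- The Volterra operator `𝓑 v (t) = ∫₀ᵗ (t - s) ^ (α - 1) b(s) v(s) ds`. -/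
def volterra (α : ℝ) (b v : ℝ → ℝ) (t : ℝ) : ℝ :=
  ∫ s in (0 : ℝ)..t, (t - s) ^ (α - 1) * b s * v s

/-- `u` solves `u' + a u + 𝓑 u = f` on `(0, T)`, is continuous on `[0, T]`, and `u 0 = u₀`. -/
structure IsSolution (α T : ℝ) (a b f : ℝ → ℝ) (u₀ : ℝ) (u : ℝ → ℝ) : Prop where
  continuousOn : ContinuousOn u (Icc 0 T)
  initial : u 0 = u₀
  equation : ∀ t ∈ Ioo 0 T, HasDerivAt u (f t - a t * u t - volterra α b u t) t

/-- `v` is `m` times differentiable on `(0, T)`, and `|v⁽ʲ⁾(t)| ≤ M t ^ (σ - j)` for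
`1 ≤ j ≤ m` and `0 < t < T`. -/
structure HasWeightedRegularity (m : ℕ) (σ T M : ℝ) (v : ℝ → ℝ) : Prop where
  differentiable : ∀ j < m, ∀ t ∈ Ioo 0 T, DifferentiableAt ℝ (iteratedDeriv j v) t
  bound : ∀ j : ℕ, 1 ≤ j → j ≤ m → ∀ t ∈ Ioo 0 T,
    |iteratedDeriv j v t| ≤ M * t ^ (σ - (j : ℝ))

/-! ### Meshes.  Only the nodes `t 0, …, t N` of a sequence `t : ℕ → ℝ` matter. -/

/-- `0 = t₀ < t₁ < ⋯ < t_N = T`. -/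
structure IsMesh (T : ℝ) (N : ℕ) (t : ℕ → ℝ) : Prop where
  first : t 0 = 0
  last : t N = T
  lt : ∀ n < N, t n < t (n + 1)

/-- The step `k_n = t_n - t_{n-1}`, used for `n ≥ 1` only. -/
def step (t : ℕ → ℝ) (n : ℕ) : ℝ := t n - t (n - 1)

/-- The maximum step size `k = max_{1 ≤ n ≤ N} k_n` (for `N ≥ 1`). -/
def maxStep (N : ℕ) (t : ℕ → ℝ) : ℝ := ⨆ i : Fin N, step t (i + 1)

/-- The grading conditions with grading parameter `γ` and constants `c`, `C`. -/
structure IsGraded (γ c C : ℝ) (N : ℕ) (t : ℕ → ℝ) : Prop where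
  step_le : ∀ n, 2 ≤ n → n ≤ N → step t n ≤ C * maxStep N t * t n ^ (1 - 1 / γ)
  node_le : ∀ n, 2 ≤ n → n ≤ N → t n ≤ C * t (n - 1)
  le_first : c * maxStep N t ^ γ ≤ step t 1
  first_le : step t 1 ≤ C * maxStep N t ^ γ

/-! ### The discontinuous Galerkin method -/

/-- Membership in the finite element space `𝓦_p`: on each `I_n = (t_{n-1}, t_n)`, `1 ≤ n ≤ N`,
`v` is a polynomial of degree at most `p`.  The values of `v` at the nodes are irrelevant. -/
def IsPiecewisePoly (p N : ℕ) (t : ℕ → ℝ) (v : ℝ → ℝ) : Prop :=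
  ∀ n, 1 ≤ n → n ≤ N → ∃ P : Polynomial ℝ, P.natDegree ≤ p ∧
    ∀ x ∈ Ioo (t (n - 1)) (t n), v x = P.eval x

/-- The left-hand limit `U_-^n = U(t_n^-)` for `n ≥ 1`, with the convention `U_-^0 = u₀`. -/
def nodeLeft (u₀ : ℝ) (t : ℕ → ℝ) (U : ℝ → ℝ) (n : ℕ) : ℝ :=
  if n = 0 then u₀ else Function.leftLim U (t n)

/-- The right-hand limit `U_+^n = U(t_n^+)`. -/
def nodeRight (t : ℕ → ℝ) (U : ℝ → ℝ) (n : ℕ) : ℝ := Function.rightLim U (t n)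

/-- `U ∈ 𝓦_p` is a DG approximation: on each `I_n`, for all test polynomials `X` of degree at
most `p`,
`U_+^{n-1} X(t_{n-1}) + ∫_{I_n} (U' + a U + 𝓑 U) X = U_-^{n-1} X(t_{n-1}) + ∫_{I_n} f X`. -/
structure IsDGSolution (α : ℝ) (p : ℕ) (a b f : ℝ → ℝ) (u₀ : ℝ) (N : ℕ) (t : ℕ → ℝ)
    (U : ℝ → ℝ) : Prop where
  mem : IsPiecewisePoly p N t U
  scheme : ∀ n, 1 ≤ n → n ≤ N → ∀ X : Polynomial ℝ, X.natDegree ≤ p →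
    nodeRight t U (n - 1) * X.eval (t (n - 1))
        + ∫ s in t (n - 1)..t n, (deriv U s + a s * U s + volterra α b U s) * X.eval s
      = nodeLeft u₀ t U (n - 1) * X.eval (t (n - 1)) + ∫ s in t (n - 1)..t n, f s * X.eval s

end DGVolterra

end

/-! The nodal error is measured by duality. For τ = t_n let z solve the adjoint equation z'(t) = a z
+ b ∫_t^τ (s - t)^(α-1) z(s) ds backwards from z(τ) = 1 (`exists_dual`). If the residual of U - u is
multiplied by z, integrated by parts on each interval, and the Volterra operator is moved onto z by
Fubini, everything cancels except the error at t_n (`nodeErr_eq_sum`). The scheme allows a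
polynomial X of degree at most p to be subtracted from z on each interval. Let X agree with z at the
left endpoint and share its moments of order below p. Then the jump terms vanish and so does every
polynomial part of the derivative residual, which leaves |error at t_n| ≤ (Σ_j sup_{I_j} |z - X|) ·
(R + C ‖U - u‖_{L¹}) (`abs_nodeErr_le`), where R / k_j bounds the distance from u' to polynomials of
degree p - 1 on I_j.

The second factor has the order of R, and R can be taken as a multiple of k^min(γσ, p+1) by the
weighted derivative bounds and the grading (`exists_polyApprox_deriv`). The L¹ norm is controlled by
an energy argument (`exists_integral_err_le`): the equation is tested with the difference θ between
U and a projection of u, and a ≥ μ_* gives coercivity. Adjointness turns the Volterra form into ∫ θ²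
(t_n - s)^α, whose weight is no longer singular, so a discrete Gronwall inequality applies; the
smallness of k lets its diagonal term be absorbed.

The first factor expresses the regularity of z. The variation of z' is bounded by that of the
increasing function t + t^α - (τ - t)^α. Hence z is linear on an interval up to k times an increment
of that function, and the sum telescopes to O(k); this suffices for p = 1. For p ≥ 2 the fractional
integral of z is differentiated as well, which places z within O(h³ (x₀^(α-2) + (τ - x₁)^(α-2))) of
a quadratic on an interval (x₀, x₁) of length h (`polyApprox_two`). These weights sum to O(k^(1+α))
by comparison with telescoping sums, and the first and last intervals are of the same order by the
linear bound. No logarithm arises: the factor max{1, log n} enters only through being at least 1.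

Regularity is expressed as distance to polynomials (`PolyApprox`), so no second derivative of z is
ever formed. -/

noncomputable section

namespace DGVolterra

open Polynomial MeasureTheory

/-! ### Local approximation by polynomials -/

/-- On `(x₀, x₁)` the function `v` is within `ε` of a polynomial of degree at most `m`. -/
def PolyApprox (m : ℕ) (x₀ x₁ : ℝ) (v : ℝ → ℝ) (ε : ℝ) : Prop :=
  ∃ Q : ℝ[X], Q.natDegree ≤ m ∧ ∀ x ∈ Ioo x₀ x₁, |v x - Q.eval x| ≤ ε

theorem PolyApprox.mono {m m' : ℕ} {x₀ x₁ ε ε' : ℝ} {v : ℝ → ℝ} (h : PolyApprox m x₀ x₁ v ε)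
    (hm : m ≤ m') (hε : ε ≤ ε') : PolyApprox m' x₀ x₁ v ε' := by
  obtain ⟨Q, hQ, h⟩ := h
  exact ⟨Q, hQ.trans hm, fun x hx => (h x hx).trans hε⟩

theorem PolyApprox.congr {m : ℕ} {x₀ x₁ ε : ℝ} {v w : ℝ → ℝ} (h : PolyApprox m x₀ x₁ v ε)
    (hvw : ∀ x ∈ Ioo x₀ x₁, v x = w x) : PolyApprox m x₀ x₁ w ε := by
  obtain ⟨Q, hQ, h⟩ := h
  exact ⟨Q, hQ, fun x hx => hvw x hx ▸ h x hx⟩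

theorem PolyApprox.of_osc {x₀ x₁ ε : ℝ} {v : ℝ → ℝ} (hx : x₀ < x₁)
    (h : ∀ x ∈ Ioo x₀ x₁, ∀ y ∈ Ioo x₀ x₁, x ≤ y → |v y - v x| ≤ ε) :
    PolyApprox 0 x₀ x₁ v ε := by
  have hc : (x₀ + x₁) / 2 ∈ Ioo x₀ x₁ := ⟨by linarith, by linarith⟩
  refine ⟨C (v ((x₀ + x₁) / 2)), by simp, fun x hx => ?_⟩
  rw [eval_C]
  rcases le_total x ((x₀ + x₁) / 2) with h' | h'
  · rw [abs_sub_comm]; exact h _ hx _ hc h'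
  · exact h _ hc _ hx h'

theorem exists_antiderivative (m : ℕ) (Q : ℝ[X]) (hQ : Q.natDegree ≤ m) :
    ∃ A : ℝ[X], A.natDegree ≤ m + 1 ∧ derivative A = Q := by
  refine ⟨∑ i ∈ Finset.range (m + 1), C (Q.coeff i / (i + 1)) * X ^ (i + 1), ?_, ?_⟩
  · refine natDegree_sum_le_of_forall_le _ _ fun i hi => ?_
    refine (natDegree_C_mul_X_pow_le _ _).trans ?_
    have := Finset.mem_range.1 hi
    omega
  · rw [derivative_sum]
    conv_rhs => rw [Q.as_sum_range_C_mul_X_pow' (Nat.lt_succ_of_le hQ)]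
    refine Finset.sum_congr rfl fun i _ => ?_
    rw [derivative_C_mul_X_pow]
    congr 2
    push_cast
    field_simp

/-- Integration gains one degree and one power of the length. -/
theorem PolyApprox.integrate {m : ℕ} {x₀ x₁ ε : ℝ} {v v' : ℝ → ℝ} (hx : x₀ < x₁)
    (hv : ∀ x ∈ Ioo x₀ x₁, HasDerivAt v (v' x) x) (h : PolyApprox m x₀ x₁ v' ε) :
    PolyApprox (m + 1) x₀ x₁ v (ε * (x₁ - x₀)) := by
  obtain ⟨Q, hQ, h⟩ := h
  obtain ⟨A, hA, hAQ⟩ := exists_antiderivative m Q hQ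
  have hc : (x₀ + x₁) / 2 ∈ Ioo x₀ x₁ := ⟨by linarith, by linarith⟩
  have hε : 0 ≤ ε := (abs_nonneg _).trans (h _ hc)
  refine ⟨A + C (v ((x₀ + x₁) / 2) - A.eval ((x₀ + x₁) / 2)), ?_, fun x hx' => ?_⟩
  · exact (natDegree_add_le _ _).trans (by simp [hA])
  have key := (convex_Ioo x₀ x₁).norm_image_sub_le_of_norm_hasDerivWithin_le
    (f := fun x => v x - A.eval x) (f' := fun x => v' x - Q.eval x) (C := ε)
    (fun y hy => ((hv y hy).sub (hAQ ▸ A.hasDerivAt y)).hasDerivWithinAt)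
    (fun y hy => h y hy) hc hx'
  simp only [Real.norm_eq_abs] at key
  rw [eval_add, eval_C]
  calc _ = |v x - A.eval x - (v ((x₀ + x₁) / 2) - A.eval ((x₀ + x₁) / 2))| := by ring_nf
    _ ≤ _ := key
    _ ≤ _ := by
      gcongr
      rw [abs_le]
      constructor <;> linarith [hx'.1, hx'.2]

/-- A bounded top derivative keeps the derivative below it nearly constant, by the mean value
inequality. Each integration downwards then gains one degree and one power of the length, so
Taylor's formula with its endpoint conditions is not needed. -/
theorem polyApprox_iteratedDeriv {m : ℕ} {x₀ x₁ B : ℝ} {v : ℝ → ℝ} (hx : x₀ < x₁)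
    (hd : ∀ j < m, ∀ t ∈ Ioo x₀ x₁, DifferentiableAt ℝ (iteratedDeriv j v) t)
    (hB : ∀ t ∈ Ioo x₀ x₁, |iteratedDeriv m v t| ≤ B) (i : ℕ) (hi : i + 1 ≤ m) :
    PolyApprox i x₀ x₁ (iteratedDeriv (m - (i + 1)) v) (B * (x₁ - x₀) ^ (i + 1)) := by
  have hder : ∀ j < m, ∀ t ∈ Ioo x₀ x₁,
      HasDerivAt (iteratedDeriv j v) (iteratedDeriv (j + 1) v t) t := by
    intro j hj t ht
    rw [iteratedDeriv_succ]
    exact (hd j hj t ht).hasDerivAt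
  induction i with
  | zero =>
    refine PolyApprox.of_osc hx fun x hx' y hy hxy => ?_
    have key := (convex_Ioo x₀ x₁).norm_image_sub_le_of_norm_hasDerivWithin_le
      (f := iteratedDeriv (m - 1) v) (f' := iteratedDeriv m v) (C := B)
      (fun y hy => by
        have := (hder (m - 1) (by omega) y hy).hasDerivWithinAt (s := Ioo x₀ x₁)
        rwa [show m - 1 + 1 = m by omega] at this) (fun y hy => hB y hy) hx' hy
    simp only [Real.norm_eq_abs] at key
    refine key.trans ?_
    have : 0 ≤ B := (abs_nonneg _).trans (hB x hx')
    simp only [zero_add, pow_one]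
    gcongr
    rw [abs_le]
    constructor <;> linarith [hx'.1, hx'.2, hy.1, hy.2]
  | succ i ih =>
    have h1 := ih (by omega)
    have := PolyApprox.integrate hx (v := iteratedDeriv (m - (i + 1 + 1)) v)
      (v' := iteratedDeriv (m - (i + 1)) v) (fun x hx' => by
        have := hder (m - (i + 1 + 1)) (by omega) x hx'
        rwa [show m - (i + 1 + 1) + 1 = m - (i + 1) by omega] at this) h1
    rwa [mul_assoc, ← pow_succ] at this

/-- A product is linear up to products of oscillations and errors of the factors. -/
theorem PolyApprox.mul {x₀ x₁ εf εg of og Bf Bg : ℝ} {f g : ℝ → ℝ} (hx : x₀ < x₁)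
    (hf : PolyApprox 1 x₀ x₁ f εf) (hg : PolyApprox 1 x₀ x₁ g εg)
    (hof : ∀ x ∈ Ioo x₀ x₁, ∀ y ∈ Ioo x₀ x₁, x ≤ y → |f y - f x| ≤ of)
    (hog : ∀ x ∈ Ioo x₀ x₁, ∀ y ∈ Ioo x₀ x₁, x ≤ y → |g y - g x| ≤ og)
    (hBf : ∀ x ∈ Ioo x₀ x₁, |f x| ≤ Bf) (hBg : ∀ x ∈ Ioo x₀ x₁, |g x| ≤ Bg) :
    PolyApprox 1 x₀ x₁ (fun x => f x * g x) (of * og + Bf * εg + Bg * εf) := by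
  obtain ⟨F, hF, hf⟩ := hf
  obtain ⟨G, hG, hg⟩ := hg
  set c := (x₀ + x₁) / 2
  have hc : c ∈ Ioo x₀ x₁ := ⟨by simp only [c]; linarith, by simp only [c]; linarith⟩
  -- The product F G would be quadratic. Freezing one factor at the midpoint in each term keeps the
  -- degree at one and leaves the product of the oscillations as remainder.
  refine ⟨C (f c) * G + C (g c) * F - C (f c * g c), ?_, fun x hx' => ?_⟩
  · refine (natDegree_sub_le _ _).trans (max_le ((natDegree_add_le _ _).trans (max_le ?_ ?_)) ?_)
    · exact (natDegree_C_mul_le _ _).trans hG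
    · exact (natDegree_C_mul_le _ _).trans hF
    · rw [natDegree_C]; exact zero_le_one
  have e1 : |f x - f c| ≤ of := by
    rcases le_total x c with h | h
    · rw [abs_sub_comm]; exact hof _ hx' _ hc h
    · exact hof _ hc _ hx' h
  have e2 : |g x - g c| ≤ og := by
    rcases le_total x c with h | h
    · rw [abs_sub_comm]; exact hog _ hx' _ hc h
    · exact hog _ hc _ hx' h
  simp only [eval_add, eval_sub, eval_mul, eval_C]
  calc _ = |(f x - f c) * (g x - g c) + f c * (g x - G.eval x) + g c * (f x - F.eval x)| := by
        ring_nf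
    _ ≤ |(f x - f c) * (g x - g c)| + |f c * (g x - G.eval x)| + |g c * (f x - F.eval x)| :=
        abs_add_three _ _ _
    _ ≤ _ := by
      simp only [abs_mul]
      have := (abs_nonneg _).trans e1
      have := (abs_nonneg _).trans (hBf c hc)
      have := (abs_nonneg _).trans (hBg c hc)
      gcongr
      · exact hBf c hc
      · exact hg x hx'
      · exact hBg c hc
      · exact hf x hx'

theorem PolyApprox.add {m : ℕ} {x₀ x₁ εf εg : ℝ} {f g : ℝ → ℝ}
    (hf : PolyApprox m x₀ x₁ f εf) (hg : PolyApprox m x₀ x₁ g εg) :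
    PolyApprox m x₀ x₁ (fun x => f x + g x) (εf + εg) := by
  obtain ⟨F, hF, hf⟩ := hf
  obtain ⟨G, hG, hg⟩ := hg
  refine ⟨F + G, (natDegree_add_le _ _).trans (max_le hF hG), fun x hx => ?_⟩
  rw [eval_add]
  calc _ = |(f x - F.eval x) + (g x - G.eval x)| := by ring_nf
    _ ≤ _ := (abs_add_le _ _).trans (add_le_add (hf x hx) (hg x hx))

/-! ### The projection matching one endpoint value -/

/-- A polynomial of degree `≤ p` vanishing at `1` and orthogonal to degree `< p` on `[0, 1]` is
zero. -/
theorem eq_zero_of_orthogonal {p : ℕ} {P : ℝ[X]} (hP : P.natDegree ≤ p) (h1 : P.eval 1 = 0)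
    (h : ∀ q : ℝ[X], q.natDegree < p → ∫ x in (0 : ℝ)..1, P.eval x * q.eval x = 0) : P = 0 := by
  -- With P = (X - 1) q, the cofactor q is itself an admissible test polynomial, and testing with it
  -- gives ∫ (1 - x) q² = 0.
  obtain ⟨q, rfl⟩ := dvd_iff_isRoot.2 h1
  by_contra hne
  have hq : q ≠ 0 := right_ne_zero_of_mul hne
  rw [natDegree_mul (X_sub_C_ne_zero 1) hq, natDegree_X_sub_C] at hP
  have h0 := h q (by omega)
  have h0' : ∫ x in (0 : ℝ)..1, (1 - x) * q.eval x ^ 2 = 0 := by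
    have : ∀ x : ℝ, (1 - x) * q.eval x ^ 2 = -(((X - C 1) * q).eval x * q.eval x) := fun x => by
      simp only [eval_mul, eval_sub, eval_X, eval_C]
      ring
    simp only [this]
    rw [intervalIntegral.integral_neg, h0, neg_zero]
  have hcont : Continuous fun x : ℝ => (1 - x) * q.eval x ^ 2 := by fun_prop
  have hnn : 0 ≤ᵐ[volume.restrict (Ioc (0 : ℝ) 1)] fun x : ℝ => (1 - x) * q.eval x ^ 2 := by
    refine (ae_restrict_iff' measurableSet_Ioc).2 (Filter.Eventually.of_forall fun x hx => ?_)
    exact mul_nonneg (by linarith [hx.2]) (sq_nonneg _)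
  rw [intervalIntegral.integral_eq_zero_iff_of_le_of_nonneg_ae zero_le_one hnn
    (hcont.intervalIntegrable _ _)] at h0'
  have := Measure.eqOn_Ioc_of_ae_eq (μ := volume) h0' hcont.continuousOn continuousOn_const
  refine hq (eq_zero_of_infinite_isRoot q ((Ioo_infinite (zero_lt_one' ℝ)).mono fun x hx => ?_))
  have h2 := this ⟨hx.1, hx.2.le⟩
  simp only [Pi.zero_apply, mul_eq_zero] at h2
  rcases h2 with h2 | h2
  · linarith [hx.2]
  · exact pow_eq_zero_iff (two_ne_zero) |>.1 h2

/-- The functionals that determine the projection. -/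
def projData (p : ℕ) : ℝ[X] →ₗ[ℝ] (Fin (p + 1) → ℝ) where
  toFun P i := if (i : ℕ) < p then ∫ x in (0 : ℝ)..1, P.eval x * x ^ (i : ℕ) else P.eval 1
  map_add' P Q := by
    ext i
    simp only [eval_add, Pi.add_apply]
    split_ifs
    · rw [← intervalIntegral.integral_add]
      · simp only [add_mul]
      · exact Continuous.intervalIntegrable (by fun_prop) _ _
      · exact Continuous.intervalIntegrable (by fun_prop) _ _
    · rfl
  map_smul' c P := by
    ext i
    simp only [eval_smul, smul_eq_mul, RingHom.id_apply, Pi.smul_apply]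
    split_ifs
    · rw [← intervalIntegral.integral_const_mul]
      simp only [mul_assoc]
    · rfl

theorem integral_mul_poly {p : ℕ} {w : ℝ → ℝ} (hw : ContinuousOn w (Icc 0 1))
    (h : ∀ i < p, ∫ x in (0 : ℝ)..1, w x * x ^ i = 0) (q : ℝ[X]) (hq : q.natDegree < p) :
    ∫ x in (0 : ℝ)..1, w x * q.eval x = 0 := by
  have : ∀ x, w x * q.eval x = ∑ i ∈ Finset.range p, q.coeff i * (w x * x ^ i) := by
    intro x
    rw [eval_eq_sum_range' hq, Finset.mul_sum]
    exact Finset.sum_congr rfl fun i _ => by ring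
  simp only [this]
  rw [intervalIntegral.integral_finsetSum]
  · refine Finset.sum_eq_zero fun i hi => ?_
    rw [intervalIntegral.integral_const_mul, h i (Finset.mem_range.1 hi), mul_zero]
  · intro i _
    refine ContinuousOn.intervalIntegrable ?_
    rw [uIcc_of_le zero_le_one]
    fun_prop

/-- Polynomials of degree at most p and their `projData` have equal dimension, so
`eq_zero_of_orthogonal` makes the data map bijective. Its inverse S is bounded by finite
dimensionality. The data of v are at most ε, hence each of the p + 1 coefficients is at most ‖S‖ ε.
-/
theorem exists_projection_unit (p : ℕ) : ∃ K : ℝ, 0 ≤ K ∧ ∀ (v : ℝ → ℝ) (ε : ℝ),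
    ContinuousOn v (Icc 0 1) → (∀ x ∈ Icc (0 : ℝ) 1, |v x| ≤ ε) →
    ∃ P : ℝ[X], P.natDegree ≤ p ∧ P.eval 1 = v 1 ∧
      (∀ q : ℝ[X], q.natDegree < p → ∫ x in (0 : ℝ)..1, (v x - P.eval x) * q.eval x = 0) ∧
      ∀ x ∈ Icc (0 : ℝ) 1, |P.eval x| ≤ K * ε := by
  let e := degreeLTEquiv ℝ (p + 1)
  let A : (Fin (p + 1) → ℝ) →ₗ[ℝ] (Fin (p + 1) → ℝ) :=
    (projData p).comp ((degreeLT ℝ (p + 1)).subtype.comp e.symm.toLinearMap)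
  have hdeg : ∀ c, ((e.symm c : ℝ[X])).natDegree ≤ p := fun c => by
    have := mem_degreeLT.1 (e.symm c).2
    exact natDegree_le_iff_coeff_eq_zero.2 fun N hN => (degree_lt_iff_coeff_zero _ _).1 this N hN
  have hinj : Function.Injective A := by
    rw [← LinearMap.ker_eq_bot, LinearMap.ker_eq_bot']
    intro c hc
    have hP : (e.symm c : ℝ[X]) = 0 := by
      refine eq_zero_of_orthogonal (hdeg c) ?_ (integral_mul_poly (by fun_prop) fun i hi => ?_)
      · have := congrFun hc (Fin.last p)
        simpa [A, projData] using this
      · have := congrFun hc ⟨i, by omega⟩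
        simpa [A, projData, hi] using this
    have : e.symm c = 0 := Subtype.ext hP
    simpa using this
  have hsurj := LinearMap.injective_iff_surjective.1 hinj
  let E := LinearEquiv.ofBijective A ⟨hinj, hsurj⟩
  let S := LinearMap.toContinuousLinearMap E.symm.toLinearMap
  refine ⟨(p + 1 : ℕ) * ‖S‖, by positivity, fun v ε hv hε => ?_⟩
  have hε0 : 0 ≤ ε := (abs_nonneg _).trans (hε 0 (by simp))
  let d : Fin (p + 1) → ℝ := fun i =>
    if (i : ℕ) < p then ∫ x in (0 : ℝ)..1, v x * x ^ (i : ℕ) else v 1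
  have hd : ‖d‖ ≤ ε := by
    refine (pi_norm_le_iff_of_nonneg hε0).2 fun i => ?_
    simp only [d]
    split_ifs
    · have := intervalIntegral.norm_integral_le_of_norm_le_const (a := (0 : ℝ)) (b := 1)
        (f := fun x => v x * x ^ (i : ℕ)) (C := ε) (fun x hx => by
          rw [uIoc_of_le zero_le_one] at hx
          rw [Real.norm_eq_abs, abs_mul]
          rw [abs_of_nonneg (pow_nonneg hx.1.le _)]
          exact (mul_le_mul (hε x ⟨hx.1.le, hx.2⟩) (pow_le_one₀ hx.1.le hx.2)
            (pow_nonneg hx.1.le _) hε0).trans (mul_one ε).le)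
      simpa using this
    · exact hε 1 (by simp)
  let c := S d
  have hc : A c = d := E.apply_symm_apply d
  have hcn : ‖c‖ ≤ ‖S‖ * ε := (S.le_opNorm d).trans (by gcongr)
  refine ⟨e.symm c, hdeg c, ?_, ?_, fun x hx => ?_⟩
  · have := congrFun hc (Fin.last p)
    simpa [A, projData, d] using this
  · refine integral_mul_poly (by fun_prop) fun i hi => ?_
    have := congrFun hc ⟨i, by omega⟩
    simp only [A, projData, d, LinearMap.comp_apply, LinearMap.coe_mk, AddHom.coe_mk, hi,
      if_true] at this
    simp only [sub_mul]
    rw [intervalIntegral.integral_sub, sub_eq_zero]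
    · exact this.symm
    · refine ContinuousOn.intervalIntegrable ?_
      rw [uIcc_of_le zero_le_one]
      fun_prop
    · exact Continuous.intervalIntegrable (by fun_prop) _ _
  · have hcoeff : ∀ i : Fin (p + 1), ((e.symm c : ℝ[X])).coeff i = c i := fun i => by
      conv_rhs => rw [← e.apply_symm_apply c]
      rfl
    rw [eval_eq_sum_range' (Nat.lt_succ_of_le (hdeg c)), Finset.sum_range]
    calc _ ≤ ∑ i : Fin (p + 1), |((e.symm c : ℝ[X])).coeff i * x ^ (i : ℕ)| :=
          Finset.abs_sum_le_sum_abs _ _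
      _ ≤ ∑ i : Fin (p + 1), ‖S‖ * ε := by
        refine Finset.sum_le_sum fun i _ => ?_
        rw [hcoeff, abs_mul, abs_of_nonneg (pow_nonneg hx.1 _)]
        exact (mul_le_mul ((norm_le_pi_norm c i).trans hcn) (pow_le_one₀ hx.1 hx.2)
          (pow_nonneg hx.1 _) (by positivity)).trans (mul_one _).le
      _ = _ := by simp; ring

/-- The projection onto polynomials of degree at most `p` on the interval between `x₀` and `x₁`
that matches the value at `x₁` and the moments of order less than `p` is quasi-optimal. -/
theorem exists_projection (p : ℕ) : ∃ K : ℝ, 0 ≤ K ∧ ∀ (x₀ x₁ : ℝ) (v : ℝ → ℝ) (ε : ℝ),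
    x₀ ≠ x₁ → ContinuousOn v (uIcc x₀ x₁) → PolyApprox p (min x₀ x₁) (max x₀ x₁) v ε →
    ∃ P : ℝ[X], P.natDegree ≤ p ∧ P.eval x₁ = v x₁ ∧
      (∀ q : ℝ[X], q.natDegree < p → ∫ x in x₀..x₁, (v x - P.eval x) * q.eval x = 0) ∧
      ∀ x ∈ uIcc x₀ x₁, |v x - P.eval x| ≤ K * ε := by
  obtain ⟨K, hK0, hK⟩ := exists_projection_unit p
  refine ⟨1 + K, by positivity, fun x₀ x₁ v ε hne hv ⟨Q, hQ, hvQ⟩ => ?_⟩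
  have hvQ' : ∀ x ∈ uIcc x₀ x₁, |v x - Q.eval x| ≤ ε := by
    intro x hx
    have hcl : closure (Ioo (min x₀ x₁) (max x₀ x₁)) = uIcc x₀ x₁ :=
      closure_Ioo (by simpa using hne)
    have hc : ContinuousOn (fun x => |v x - Q.eval x|) (uIcc x₀ x₁) := by fun_prop
    have := hc.mono hcl.le
    exact le_on_closure (f := fun x => |v x - Q.eval x|) (g := fun _ => ε) hvQ this
      continuousOn_const (hcl ▸ hx)
  -- h may be negative: x₁ is the matched endpoint and may lie on either side, so one lemma serves
  -- both u (right endpoint) and z (left endpoint).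
  set h := x₁ - x₀ with hh
  have hh0 : h ≠ 0 := sub_ne_zero.2 hne.symm
  let m : ℝ → ℝ := fun s => x₀ + h * s
  have hm : ∀ s ∈ Icc (0 : ℝ) 1, m s ∈ uIcc x₀ x₁ := by
    intro s hs
    have : m s = (1 - s) • x₀ + s • x₁ := by simp only [m, hh, smul_eq_mul]; ring
    rw [this]
    exact (convex_uIcc x₀ x₁) left_mem_uIcc right_mem_uIcc (by linarith [hs.2]) hs.1 (by ring)
  have hm' : ∀ x ∈ uIcc x₀ x₁, (x - x₀) / h ∈ Icc (0 : ℝ) 1 := by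
    intro x hx
    rcases le_total x₀ x₁ with h1 | h1
    · rw [uIcc_of_le h1] at hx
      have : 0 < h := lt_of_le_of_ne (by linarith) hh0.symm
      exact ⟨div_nonneg (by linarith [hx.1]) this.le, (div_le_one this).2 (by linarith [hx.2])⟩
    · rw [uIcc_of_ge h1] at hx
      have : h < 0 := lt_of_le_of_ne (by linarith) hh0
      exact ⟨div_nonneg_of_nonpos (by linarith [hx.2]) this.le,
        (div_le_one_of_neg this).2 (by linarith [hx.1])⟩
  obtain ⟨P, hP, hP1, hPo, hPb⟩ := hK (fun s => v (m s) - Q.eval (m s)) ε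
    (by
      have : ContinuousOn (fun s => v (m s)) (Icc 0 1) :=
        hv.comp (by fun_prop) hm
      exact this.sub (Continuous.continuousOn (by fun_prop))) (fun s hs => hvQ' _ (hm s hs))
  let ℓ : ℝ[X] := C h⁻¹ * (X - C x₀)
  let ℓ' : ℝ[X] := C h * X + C x₀
  have hℓ : ℓ.natDegree ≤ 1 := by
    refine (natDegree_C_mul_le _ _).trans (natDegree_X_sub_C x₀).le
  have hℓ' : ℓ'.natDegree ≤ 1 := natDegree_linear_le
  have evℓ : ∀ x, ℓ.eval x = (x - x₀) / h := fun x => by simp [ℓ]; ring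
  have evℓ' : ∀ s, ℓ'.eval s = m s := fun x => by simp [ℓ', m]; ring
  -- The projection reproduces Q, so only the remainder v - Q, of size ε, is projected on the unit
  -- interval. This is what makes the constant 1 + K.
  refine ⟨Q + P.comp ℓ, ?_, ?_, fun q hq => ?_, fun x hx => ?_⟩
  · refine (natDegree_add_le _ _).trans (max_le hQ (natDegree_comp_le.trans ?_))
    calc _ ≤ p * 1 := Nat.mul_le_mul hP hℓ
      _ = p := mul_one p
  · rw [eval_add, eval_comp, evℓ, ← hh, div_self hh0, hP1]
    simp [m, hh]
  · have h1 := hPo (q.comp ℓ') (by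
      refine lt_of_le_of_lt (natDegree_comp_le.trans (Nat.mul_le_mul le_rfl hℓ')) ?_
      simpa using hq)
    have h2 := intervalIntegral.smul_integral_comp_add_mul (a := 0) (b := 1)
      (fun x => (v x - (Q + P.comp ℓ).eval x) * q.eval x) h x₀
    rw [mul_zero, add_zero, mul_one, show x₀ + h = x₁ by rw [hh]; ring] at h2
    rw [← h2, smul_eq_mul]
    have : ∀ s, (v (x₀ + h * s) - (Q + P.comp ℓ).eval (x₀ + h * s)) * q.eval (x₀ + h * s) =
        (v (m s) - Q.eval (m s) - P.eval s) * (q.comp ℓ').eval s := by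
      intro s
      rw [eval_comp, evℓ', eval_add, eval_comp, evℓ]
      simp only [m]
      rw [show (x₀ + h * s - x₀) / h = s by field_simp; ring]
      ring
    simp only [this]
    rw [h1, mul_zero]
  · rw [eval_add, eval_comp, evℓ]
    have h1 := hPb _ (hm' x hx)
    calc _ = |(v x - Q.eval x) - P.eval ((x - x₀) / h)| := by ring_nf
      _ ≤ ε + K * ε := (abs_sub _ _).trans (add_le_add (hvQ' x hx) h1)
      _ = _ := by ring

end DGVolterra

end

noncomputable section

namespace DGVolterra

open MeasureTheory

/-! ### The weakly singular kernel -/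

/-- The kernel `r ^ (α - 1)` for `r > 0`, extended by zero. -/
def ker (α r : ℝ) : ℝ := max r 0 ^ (α - 1)

theorem ker_nonneg (α r : ℝ) : 0 ≤ ker α r := Real.rpow_nonneg (le_max_right _ _) _

theorem ker_of_pos {α r : ℝ} (hr : 0 < r) : ker α r = r ^ (α - 1) := by
  rw [ker, max_eq_left hr.le]

theorem ker_of_nonpos {α r : ℝ} (hα : α < 1) (hr : r ≤ 0) : ker α r = 0 := by
  rw [ker, max_eq_right hr, Real.zero_rpow (by linarith)]

theorem measurable_ker (α : ℝ) : Measurable (ker α) := by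
  unfold ker
  fun_prop

theorem ker_intervalIntegrable {α : ℝ} (h0 : 0 < α) (h1 : α < 1) (x y : ℝ) :
    IntervalIntegrable (ker α) volume x y := by
  refine (intervalIntegral.intervalIntegrable_rpow' (r := α - 1) (by linarith)).mono_fun
    (measurable_ker α).aestronglyMeasurable (Filter.Eventually.of_forall fun r => ?_)
  rcases lt_or_ge 0 r with hr | hr
  · simp [ker_of_pos hr]
  · simp [ker_of_nonpos h1 hr]

theorem integral_ker {α : ℝ} (h0 : 0 < α) (h1 : α < 1) (x y : ℝ) :
    ∫ r in x..y, ker α r = (max y 0 ^ α - max x 0 ^ α) / α := by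
  have key : ∀ y, ∫ r in (0 : ℝ)..y, ker α r = max y 0 ^ α / α := by
    intro y
    rcases le_total 0 y with hy | hy
    · rw [intervalIntegral.integral_congr_ae (g := fun r => r ^ (α - 1))
        (Filter.Eventually.of_forall fun r hr => by
          rw [uIoc_of_le hy] at hr; exact ker_of_pos hr.1), integral_rpow (Or.inl (by linarith)),
        max_eq_left hy]
      simp [Real.zero_rpow h0.ne']
    · rw [intervalIntegral.integral_congr_ae (g := fun r => 0)
        (Filter.Eventually.of_forall fun r hr => by
          rw [uIoc_of_ge hy] at hr; exact ker_of_nonpos h1 hr.2), max_eq_right hy]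
      simp [Real.zero_rpow h0.ne']
  rw [← intervalIntegral.integral_interval_sub_left (ker_intervalIntegrable h0 h1 0 y)
    (ker_intervalIntegrable h0 h1 0 x), key, key, sub_div]

theorem ker_sub_left_intervalIntegrable {α : ℝ} (h0 : 0 < α) (h1 : α < 1) (t x y : ℝ) :
    IntervalIntegrable (fun s => ker α (t - s)) volume x y := by
  simpa using (ker_intervalIntegrable h0 h1 (t - x) (t - y)).comp_sub_left t

theorem ker_sub_right_intervalIntegrable {α : ℝ} (h0 : 0 < α) (h1 : α < 1) (s x y : ℝ) :
    IntervalIntegrable (fun t => ker α (t - s)) volume x y := by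
  simpa using (ker_intervalIntegrable h0 h1 (x - s) (y - s)).comp_sub_right s

theorem integral_ker_sub_left {α : ℝ} (h0 : 0 < α) (h1 : α < 1) (t x y : ℝ) :
    ∫ s in x..y, ker α (t - s) = (max (t - x) 0 ^ α - max (t - y) 0 ^ α) / α := by
  rw [intervalIntegral.integral_comp_sub_left, integral_ker h0 h1]

theorem integral_ker_sub_right {α : ℝ} (h0 : 0 < α) (h1 : α < 1) (s x y : ℝ) :
    ∫ t in x..y, ker α (t - s) = (max (y - s) 0 ^ α - max (x - s) 0 ^ α) / α := by
  rw [intervalIntegral.integral_comp_sub_right, integral_ker h0 h1]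

/-! ### Bounded measurable functions -/

/-- Measurable functions that are bounded. -/
structure BddMeas (φ : ℝ → ℝ) : Prop where
  measurable : Measurable φ
  bdd : ∃ C, ∀ x, |φ x| ≤ C

theorem BddMeas.mul {φ ψ : ℝ → ℝ} (hφ : BddMeas φ) (hψ : BddMeas ψ) :
    BddMeas (fun x => φ x * ψ x) := by
  obtain ⟨C, hC⟩ := hφ.bdd
  obtain ⟨D, hD⟩ := hψ.bdd
  refine ⟨hφ.1.mul hψ.1, C * D, fun x => ?_⟩
  rw [abs_mul]
  exact mul_le_mul (hC x) (hD x) (abs_nonneg _) ((abs_nonneg _).trans (hC x))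

theorem BddMeas.add {φ ψ : ℝ → ℝ} (hφ : BddMeas φ) (hψ : BddMeas ψ) :
    BddMeas (fun x => φ x + ψ x) := by
  obtain ⟨C, hC⟩ := hφ.bdd
  obtain ⟨D, hD⟩ := hψ.bdd
  exact ⟨hφ.1.add hψ.1, C + D, fun x => (abs_add_le _ _).trans (add_le_add (hC x) (hD x))⟩

theorem BddMeas.sub {φ ψ : ℝ → ℝ} (hφ : BddMeas φ) (hψ : BddMeas ψ) :
    BddMeas (fun x => φ x - ψ x) := by
  obtain ⟨C, hC⟩ := hφ.bdd
  obtain ⟨D, hD⟩ := hψ.bdd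
  exact ⟨hφ.1.sub hψ.1, C + D, fun x => (abs_sub _ _).trans (add_le_add (hC x) (hD x))⟩

theorem BddMeas.abs {φ : ℝ → ℝ} (hφ : BddMeas φ) : BddMeas (fun x => |φ x|) := by
  obtain ⟨C, hC⟩ := hφ.bdd
  exact ⟨hφ.1.abs, C, fun x => by rw [abs_abs]; exact hC x⟩

theorem BddMeas.const (c : ℝ) : BddMeas (fun _ => c) := ⟨measurable_const, |c|, fun _ => le_rfl⟩

theorem BddMeas.indicator {φ : ℝ → ℝ} (hφ : BddMeas φ) {s : Set ℝ} (hs : MeasurableSet s) :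
    BddMeas (s.indicator φ) := by
  obtain ⟨C, hC⟩ := hφ.bdd
  refine ⟨hφ.1.indicator hs, C, fun x => ?_⟩
  by_cases h : x ∈ s
  · simpa [h] using hC x
  · simpa [h] using (abs_nonneg _).trans (hC x)

theorem BddMeas.intervalIntegrable_mul {φ g : ℝ → ℝ} (hφ : BddMeas φ) {x y : ℝ}
    (hg : IntervalIntegrable g volume x y) :
    IntervalIntegrable (fun s => g s * φ s) volume x y := by
  obtain ⟨C, hC⟩ := hφ.bdd
  rw [intervalIntegrable_iff] at hg ⊢
  exact hg.mul_bdd hφ.1.aestronglyMeasurable (Filter.Eventually.of_forall hC)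

theorem BddMeas.intervalIntegrable {φ : ℝ → ℝ} (hφ : BddMeas φ) (x y : ℝ) :
    IntervalIntegrable φ volume x y := by
  simpa using hφ.intervalIntegrable_mul (g := fun _ => 1) (x := x) (y := y) (by simp)

theorem BddMeas.iccExtend {x y : ℝ} (h : x ≤ y) {v : ℝ → ℝ}
    (hv : ContinuousOn v (Icc x y)) : BddMeas (IccExtend h (Icc x y |>.domRestrict v)) := by
  have hc : Continuous (IccExtend h (Icc x y |>.domRestrict v)) := hv.domRestrict.Icc_extend'
  refine ⟨hc.measurable, ?_⟩
  obtain ⟨C, hC⟩ := isCompact_Icc.exists_bound_of_continuousOn hv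
  exact ⟨C, fun s => hC _ (projIcc x y h s).2⟩

/-! ### The fractional integrals -/

/-- `∫₀^τ κ(t - s) φ(s) ds`, the forward fractional integral at `t ≤ τ`. -/
def fwd (α τ : ℝ) (φ : ℝ → ℝ) (t : ℝ) : ℝ := ∫ s in (0 : ℝ)..τ, ker α (t - s) * φ s

/-- `∫₀^τ κ(t - s) ψ(t) dt`, the backward fractional integral at `s ≤ τ`. -/
def bwd (α τ : ℝ) (ψ : ℝ → ℝ) (s : ℝ) : ℝ := ∫ t in (0 : ℝ)..τ, ker α (t - s) * ψ t

section
variable {α τ : ℝ} (h0 : 0 < α) (h1 : α < 1)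
include h0 h1

theorem fwd_intervalIntegrable {φ : ℝ → ℝ} (hφ : BddMeas φ) (t x y : ℝ) :
    IntervalIntegrable (fun s => ker α (t - s) * φ s) volume x y :=
  hφ.intervalIntegrable_mul (ker_sub_left_intervalIntegrable h0 h1 t x y)

theorem bwd_intervalIntegrable {ψ : ℝ → ℝ} (hψ : BddMeas ψ) (s x y : ℝ) :
    IntervalIntegrable (fun t => ker α (t - s) * ψ t) volume x y :=
  hψ.intervalIntegrable_mul (ker_sub_right_intervalIntegrable h0 h1 s x y)

theorem fwd_one {t : ℝ} (ht : 0 ≤ t) (htτ : t ≤ τ) : fwd α τ (fun _ => 1) t = t ^ α / α := by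
  simp only [fwd, mul_one]
  rw [integral_ker_sub_left h0 h1, sub_zero, max_eq_left ht, max_eq_right (by linarith),
    Real.zero_rpow h0.ne', sub_zero]

theorem bwd_one {s : ℝ} (hs : 0 ≤ s) (hsτ : s ≤ τ) : bwd α τ (fun _ => 1) s = (τ - s) ^ α / α := by
  simp only [bwd, mul_one]
  rw [integral_ker_sub_right h0 h1, zero_sub, max_eq_left (by linarith),
    max_eq_right (by linarith : -s ≤ 0), Real.zero_rpow h0.ne', sub_zero]

theorem fwd_eq_of_le {φ : ℝ → ℝ} (hφ : BddMeas φ) {t τ' : ℝ} (htτ : t ≤ τ) (htτ' : t ≤ τ') :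
    fwd α τ φ t = fwd α τ' φ t := by
  have key : ∀ τ, t ≤ τ → fwd α τ φ t = ∫ s in (0 : ℝ)..t, ker α (t - s) * φ s := by
    intro τ hτ
    have hi := fwd_intervalIntegrable h0 h1 hφ t
    rw [fwd, ← intervalIntegral.integral_add_adjacent_intervals (hi 0 t) (hi t τ),
      intervalIntegral.integral_congr_ae (a := t) (b := τ) (g := fun _ => 0)
      (Filter.Eventually.of_forall fun s hs => by
        rw [uIoc_of_le hτ] at hs
        rw [ker_of_nonpos h1 (by linarith [hs.1]), zero_mul])]
    simp
  rw [key τ htτ, key τ' htτ']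

theorem volterra_eq_fwd {b v : ℝ → ℝ} (hbv : BddMeas (fun s => b s * v s)) {t : ℝ} (ht : 0 ≤ t)
    (htτ : t ≤ τ) : volterra α b v t = fwd α τ (fun s => b s * v s) t := by
  rw [fwd_eq_of_le h0 h1 hbv htτ le_rfl, fwd, volterra]
  refine intervalIntegral.integral_congr_ae ?_
  have : ∀ᵐ s : ℝ, s ≠ t := by simp [ae_iff]
  filter_upwards [this] with s hs hs'
  rw [uIoc_of_le ht] at hs'
  rw [ker_of_pos (sub_pos.2 (lt_of_le_of_ne hs'.2 hs)), mul_assoc]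

omit h0 h1 in
theorem abs_fwd_le (φ : ℝ → ℝ) (hτ : 0 ≤ τ) (t : ℝ) :
    |fwd α τ φ t| ≤ fwd α τ (fun s => |φ s|) t := by
  refine (intervalIntegral.abs_integral_le_integral_abs hτ).trans (le_of_eq ?_)
  simp only [abs_mul, abs_of_nonneg (ker_nonneg _ _)]
  rfl

theorem fwd_mono {φ ψ : ℝ → ℝ} (hφ : BddMeas φ) (hψ : BddMeas ψ) (hτ : 0 ≤ τ)
    (h : ∀ s ∈ Icc 0 τ, φ s ≤ ψ s) (t : ℝ) : fwd α τ φ t ≤ fwd α τ ψ t :=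
  intervalIntegral.integral_mono_on hτ (fwd_intervalIntegrable h0 h1 hφ t 0 τ)
    (fwd_intervalIntegrable h0 h1 hψ t 0 τ) fun s hs =>
      mul_le_mul_of_nonneg_left (h s hs) (ker_nonneg _ _)

omit h0 h1 in
theorem fwd_const_mul (φ : ℝ → ℝ) (c t : ℝ) :
    fwd α τ (fun s => c * φ s) t = c * fwd α τ φ t := by
  simp only [fwd, ← intervalIntegral.integral_const_mul]
  congr 1; ext s; ring

omit h0 h1 in
theorem bwd_const_mul (φ : ℝ → ℝ) (c t : ℝ) :
    bwd α τ (fun s => c * φ s) t = c * bwd α τ φ t := by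
  simp only [bwd, ← intervalIntegral.integral_const_mul]
  congr 1; ext s; ring

theorem fwd_add {φ ψ : ℝ → ℝ} (hφ : BddMeas φ) (hψ : BddMeas ψ) (t : ℝ) :
    fwd α τ (fun s => φ s + ψ s) t = fwd α τ φ t + fwd α τ ψ t := by
  simp only [fwd, mul_add]
  exact intervalIntegral.integral_add (fwd_intervalIntegrable h0 h1 hφ t 0 τ)
    (fwd_intervalIntegrable h0 h1 hψ t 0 τ)

theorem fwd_sub {φ ψ : ℝ → ℝ} (hφ : BddMeas φ) (hψ : BddMeas ψ) (t : ℝ) :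
    fwd α τ (fun s => φ s - ψ s) t = fwd α τ φ t - fwd α τ ψ t := by
  simp only [fwd, mul_sub]
  exact intervalIntegral.integral_sub (fwd_intervalIntegrable h0 h1 hφ t 0 τ)
    (fwd_intervalIntegrable h0 h1 hψ t 0 τ)

theorem bwd_sub {φ ψ : ℝ → ℝ} (hφ : BddMeas φ) (hψ : BddMeas ψ) (t : ℝ) :
    bwd α τ (fun s => φ s - ψ s) t = bwd α τ φ t - bwd α τ ψ t := by
  simp only [bwd, mul_sub]
  exact intervalIntegral.integral_sub (bwd_intervalIntegrable h0 h1 hφ t 0 τ)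
    (bwd_intervalIntegrable h0 h1 hψ t 0 τ)

theorem abs_fwd_le_of_bound {φ : ℝ → ℝ} (hφ : BddMeas φ) {B : ℝ}
    (hB : ∀ s ∈ Icc 0 τ, |φ s| ≤ B) {t : ℝ} (ht : 0 ≤ t) (htτ : t ≤ τ) :
    |fwd α τ φ t| ≤ B * (t ^ α / α) := by
  refine (abs_fwd_le φ (ht.trans htτ) t).trans ?_
  refine (fwd_mono h0 h1 hφ.abs (BddMeas.const B) (ht.trans htτ) hB t).trans (le_of_eq ?_)
  have := fwd_const_mul (α := α) (τ := τ) (fun _ => 1) B t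
  simp only [mul_one] at this
  rw [this, fwd_one h0 h1 ht htτ]

theorem abs_bwd_le_of_bound {φ : ℝ → ℝ} (hφ : BddMeas φ) {B t : ℝ}
    (hB : ∀ s ∈ Icc t τ, |φ s| ≤ B) (ht : 0 ≤ t) (htτ : t ≤ τ) :
    |bwd α τ φ t| ≤ B * ((τ - t) ^ α / α) := by
  have e := bwd_const_mul (α := α) (τ := τ) (fun _ => 1) B t
  simp only [mul_one] at e
  rw [← bwd_one h0 h1 ht htτ, ← e]
  refine (intervalIntegral.abs_integral_le_integral_abs (ht.trans htτ)).trans ?_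
  refine intervalIntegral.integral_mono_on (ht.trans htτ) (bwd_intervalIntegrable h0 h1 hφ t 0 τ).abs
    (bwd_intervalIntegrable h0 h1 (BddMeas.const B) t 0 τ) fun s hs => ?_
  rw [abs_mul, abs_of_nonneg (ker_nonneg _ _)]
  rcases le_total s t with h | h
  · simp [ker_of_nonpos h1 (sub_nonpos.2 h)]
  · exact mul_le_mul_of_nonneg_left (hB s ⟨h, hs.2⟩) (ker_nonneg _ _)

/-- Since the kernel vanishes for nonpositive arguments, both fractional integrals run over the
whole of (0, τ]. Their adjointness is therefore Fubini on a square, for which this is the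
integrability hypothesis. -/
theorem integrable_ker_prod (hτ : 0 ≤ τ) : Integrable (fun z : ℝ × ℝ => ker α (z.1 - z.2))
    ((volume.restrict (Ioc 0 τ)).prod (volume.restrict (Ioc 0 τ))) := by
  have hm : Measurable (fun z : ℝ × ℝ => ker α (z.1 - z.2)) :=
    (measurable_ker α).comp (measurable_fst.sub measurable_snd)
  rw [integrable_prod_iff hm.aestronglyMeasurable]
  refine ⟨Filter.Eventually.of_forall fun t => ?_, ?_⟩
  · have := ker_sub_left_intervalIntegrable h0 h1 t 0 τ
    rwa [intervalIntegrable_iff_integrableOn_Ioc_of_le hτ] at this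
  · have : ∀ t, ∫ s in Ioc 0 τ, ‖ker α (t - s)‖ = (max t 0 ^ α - max (t - τ) 0 ^ α) / α := by
      intro t
      simp only [Real.norm_eq_abs, abs_of_nonneg (ker_nonneg _ _)]
      rw [← intervalIntegral.integral_of_le hτ, integral_ker_sub_left h0 h1, sub_zero]
    simp only [this]
    have hc : Continuous fun t : ℝ => (max t 0 ^ α - max (t - τ) 0 ^ α) / α := by
      refine Continuous.div_const (Continuous.sub ?_ ?_) _
      · exact Continuous.rpow_const (by fun_prop) fun _ => Or.inr h0.le
      · exact Continuous.rpow_const (by fun_prop) fun _ => Or.inr h0.le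
    have := hc.intervalIntegrable (μ := volume) 0 τ
    rwa [intervalIntegrable_iff_integrableOn_Ioc_of_le hτ] at this

theorem integrable_ker_mul_mul (hτ : 0 ≤ τ) {φ ψ : ℝ → ℝ} (hφ : BddMeas φ) (hψ : BddMeas ψ) :
    Integrable (fun z : ℝ × ℝ => ker α (z.1 - z.2) * φ z.2 * ψ z.1)
    ((volume.restrict (Ioc 0 τ)).prod (volume.restrict (Ioc 0 τ))) := by
  obtain ⟨C, hC⟩ := hφ.bdd
  obtain ⟨D, hD⟩ := hψ.bdd
  exact ((integrable_ker_prod h0 h1 hτ).mul_bdd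
    (hφ.1.comp measurable_snd).aestronglyMeasurable
      (Filter.Eventually.of_forall fun z => hC z.2)).mul_bdd
    (hψ.1.comp measurable_fst).aestronglyMeasurable (Filter.Eventually.of_forall fun z => hD z.1)

theorem fwd_mul_intervalIntegrable (hτ : 0 ≤ τ) {φ ψ : ℝ → ℝ} (hφ : BddMeas φ)
    (hψ : BddMeas ψ) : IntervalIntegrable (fun t => fwd α τ φ t * ψ t) volume 0 τ := by
  have h := (integrable_ker_mul_mul h0 h1 hτ hφ hψ).integral_prod_left
  rw [intervalIntegrable_iff_integrableOn_Ioc_of_le hτ]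
  refine h.congr (Filter.Eventually.of_forall fun t => ?_)
  simp only [fwd, intervalIntegral.integral_of_le hτ]
  rw [integral_mul_const]

theorem mul_bwd_intervalIntegrable (hτ : 0 ≤ τ) {φ ψ : ℝ → ℝ} (hφ : BddMeas φ)
    (hψ : BddMeas ψ) : IntervalIntegrable (fun s => φ s * bwd α τ ψ s) volume 0 τ := by
  have h := (integrable_ker_mul_mul h0 h1 hτ hφ hψ).integral_prod_right
  rw [intervalIntegrable_iff_integrableOn_Ioc_of_le hτ]
  refine h.congr (Filter.Eventually.of_forall fun s => ?_)
  simp only [bwd, intervalIntegral.integral_of_le hτ]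
  rw [← integral_const_mul]
  congr 1; ext t; ring

/-- The forward and the backward fractional integral are adjoint. -/
theorem integral_fwd_mul (hτ : 0 ≤ τ) {φ ψ : ℝ → ℝ} (hφ : BddMeas φ) (hψ : BddMeas ψ) :
    ∫ t in (0 : ℝ)..τ, fwd α τ φ t * ψ t = ∫ s in (0 : ℝ)..τ, φ s * bwd α τ ψ s := by
  have h := integral_integral_swap
    (f := fun t s => ker α (t - s) * φ s * ψ t) (integrable_ker_mul_mul h0 h1 hτ hφ hψ)
  simp only [fwd, bwd, intervalIntegral.integral_of_le hτ]
  calc _ = ∫ t in Ioc 0 τ, ∫ s in Ioc 0 τ, ker α (t - s) * φ s * ψ t := by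
        simp only [integral_mul_const]
    _ = _ := h
    _ = _ := by
      simp only [← integral_const_mul]
      congr 1; ext s; congr 1; ext t; ring

end
end DGVolterra

end

noncomputable section

namespace DGVolterra

open MeasureTheory

/-! ### The dual problem: existence -/

section
variable {α τ : ℝ} (h0 : 0 < α) (h1 : α < 1)
include h0 h1

/-- Substituting t = s + (τ - s) x freezes both the singularity and the range of integration, so
continuity in s follows by dominated convergence. -/
theorem bwd_eq_scaled {z : ℝ → ℝ} (hz : BddMeas z) {s : ℝ} (hs : 0 ≤ s) (hsτ : s ≤ τ) :
    bwd α τ z s = (τ - s) ^ α * ∫ x in (0 : ℝ)..1, x ^ (α - 1) * z (s + (τ - s) * x) := by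
  have hi := bwd_intervalIntegrable h0 h1 hz s
  rw [bwd, ← intervalIntegral.integral_add_adjacent_intervals (hi 0 s) (hi s τ),
    intervalIntegral.integral_congr_ae (a := 0) (b := s) (g := fun _ => 0)
      (Filter.Eventually.of_forall fun t ht => by
        rw [uIoc_of_le hs] at ht
        rw [ker_of_nonpos h1 (by linarith [ht.2]), zero_mul])]
  have h2 := intervalIntegral.smul_integral_comp_add_mul (a := 0) (b := 1)
    (fun t => ker α (t - s) * z t) (τ - s) s
  rw [mul_zero, add_zero, mul_one, add_sub_cancel] at h2
  rw [← h2, smul_eq_mul, intervalIntegral.integral_zero, zero_add,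
    ← intervalIntegral.integral_const_mul, ← intervalIntegral.integral_const_mul]
  refine intervalIntegral.integral_congr_ae (Filter.Eventually.of_forall fun x hx => ?_)
  rw [uIoc_of_le zero_le_one] at hx
  rcases hsτ.eq_or_lt with rfl | hlt
  · simp [Real.zero_rpow h0.ne']
  · have hp : 0 < τ - s := sub_pos.2 hlt
    rw [show s + (τ - s) * x - s = (τ - s) * x by ring, ker_of_pos (mul_pos hp hx.1),
      Real.mul_rpow hp.le hx.1.le, Real.rpow_sub_one hp.ne']
    field_simp

theorem continuousOn_bwd {z : ℝ → ℝ} (hz : Continuous z) (hz' : BddMeas z) :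
    ContinuousOn (bwd α τ z) (Icc 0 τ) := by
  have key : Continuous fun s => max (τ - s) 0 ^ α *
      ∫ x in (0 : ℝ)..1, x ^ (α - 1) * z (s + (τ - s) * x) := by
    refine Continuous.mul (Continuous.rpow_const (by fun_prop) fun _ => Or.inr h0.le) ?_
    obtain ⟨C, hC⟩ := hz'.bdd
    refine intervalIntegral.continuous_of_dominated_interval
      (bound := fun x => x ^ (α - 1) * C) (fun s => ?_) (fun s => ?_) ?_ ?_
    · exact Measurable.aestronglyMeasurable (by fun_prop)
    · refine Filter.Eventually.of_forall fun x hx => ?_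
      rw [uIoc_of_le zero_le_one] at hx
      rw [Real.norm_eq_abs, abs_mul, abs_of_nonneg (Real.rpow_nonneg hx.1.le _)]
      exact mul_le_mul_of_nonneg_left (hC _) (Real.rpow_nonneg hx.1.le _)
    · exact (intervalIntegral.intervalIntegrable_rpow' (by linarith)).mul_const C
    · exact Filter.Eventually.of_forall fun x _ => by fun_prop
  refine key.continuousOn.congr fun s hs => ?_
  simp only [bwd_eq_scaled h0 h1 hz' hs.1 hs.2, max_eq_left (sub_nonneg.2 hs.2)]

end

theorem integral_exp_decay {lam : ℝ} (hl : 0 < lam) (t τ : ℝ) :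
    ∫ s in t..τ, Real.exp (lam * (τ - s)) = (Real.exp (lam * (τ - t)) - 1) / lam := by
  have : ∀ s ∈ uIcc t τ,
      HasDerivAt (fun s => -(Real.exp (lam * (τ - s)) / lam)) (Real.exp (lam * (τ - s))) s := by
    intro s _
    have h := (((hasDerivAt_id s).const_sub τ).const_mul lam).exp.div_const lam |>.neg
    have e : Real.exp (lam * (τ - s)) = -(Real.exp (lam * (τ - s)) * (lam * -1) / lam) := by
      field_simp
    rw [e]
    exact h
  rw [intervalIntegral.integral_eq_sub_of_hasDerivAt this
    (Continuous.intervalIntegrable (by fun_prop) _ _)]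
  simp
  ring

/-- The adjoint problem `z' = a z + b ∫ₜ^τ (s - t) ^ (α - 1) z(s) ds`, `z(τ) = 1`, has a solution
on `[0, τ]`, bounded uniformly in `τ ≤ T`. -/
theorem exists_dual {α : ℝ} (h0 : 0 < α) (h1 : α < 1) (T μ : ℝ) (hT : 0 < T) (hμ : 0 ≤ μ) :
    ∃ L : ℝ, 0 ≤ L ∧ ∀ τ, 0 < τ → τ ≤ T → ∀ a b : ℝ → ℝ, Continuous a → Continuous b →
      (∀ x, |a x| ≤ μ) → (∀ x, |b x| ≤ μ) →
      ∃ z : ℝ → ℝ, Continuous z ∧ z τ = 1 ∧ (∀ x, |z x| ≤ L) ∧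
        ∀ t ∈ Ioo 0 τ, HasDerivAt z (a t * z t + b t * bwd α τ z t) t := by
  -- μ (1 + T^α / α) is the Lipschitz constant of the right-hand side in the weighted norm below;
  -- the added 1 keeps Λ positive when μ = 0. Taking `lam` = 2 Λ makes the contraction factor Λ /
  -- `lam` = 1/2.
  set Λ : ℝ := μ * (1 + T ^ α / α) + 1 with hΛ
  have hTα : 0 ≤ T ^ α / α := by positivity
  have hΛ0 : 0 < Λ := by positivity
  set lam : ℝ := 2 * Λ with hlam
  have hl0 : 0 < lam := by positivity
  refine ⟨Real.exp (lam * T) * 2, by positivity, fun τ hτ hτT a b ha hb haμ hbμ => ?_⟩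
  -- The unknown is y = exp(-`lam` (τ - t)) z, so the sup norm of y is an exponentially weighted
  -- norm of z in which the integral equation contracts on all of [0, τ] at once.
  let Z : C(Icc 0 τ, ℝ) → ℝ → ℝ := fun y =>
    IccExtend hτ.le (fun t : Icc 0 τ => Real.exp (lam * (τ - t)) * y t)
  have hZc : ∀ y, Continuous (Z y) := fun y => Continuous.Icc_extend' (by fun_prop)
  have hZv : ∀ y t (ht : t ∈ Icc 0 τ), Z y t = Real.exp (lam * (τ - t)) * y ⟨t, ht⟩ :=
    fun y t ht => IccExtend_of_mem hτ.le _ ht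
  have hZb : ∀ y t, |Z y t| ≤ Real.exp (lam * T) * ‖y‖ := fun y t => by
    simp only [Z, IccExtend, Function.comp_apply, abs_mul, Real.abs_exp]
    have := (projIcc 0 τ hτ.le t).2.1
    gcongr
    · linarith
    · exact y.norm_coe_le_norm _
  have hZm : ∀ y, BddMeas (Z y) := fun y => ⟨(hZc y).measurable, _, hZb y⟩
  let G : C(Icc 0 τ, ℝ) → ℝ → ℝ := fun y =>
    IccExtend hτ.le ((Icc 0 τ).domRestrict fun s => a s * Z y s + b s * bwd α τ (Z y) s)
  have hGc : ∀ y, Continuous (G y) := fun y => by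
    refine Continuous.Icc_extend' (ContinuousOn.domRestrict ?_)
    exact (ha.mul (hZc y)).continuousOn.add
      (hb.continuousOn.mul (continuousOn_bwd h0 h1 (hZc y) (hZm y)))
  have hGv : ∀ y t, t ∈ Icc 0 τ → G y t = a t * Z y t + b t * bwd α τ (Z y) t :=
    fun y t ht => IccExtend_of_mem hτ.le _ ht
  have hI : ∀ y, Continuous fun t => ∫ s in t..τ, G y s := fun y => by
    have := intervalIntegral.continuous_primitive (μ := volume)
      (fun x y' => (hGc y).intervalIntegrable x y') τ
    simp only [intervalIntegral.integral_symm τ]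
    exact this.neg
  let N : C(Icc 0 τ, ℝ) → C(Icc 0 τ, ℝ) := fun y =>
    ⟨fun t => Real.exp (-(lam * (τ - t))) * (1 - ∫ s in (t : ℝ)..τ, G y s), by
      have := (hI y).comp (continuous_subtype_val (p := fun x => x ∈ Icc 0 τ))
      simp only [Function.comp_def] at this
      fun_prop⟩
  have hGd : ∀ y y' s, s ∈ Icc 0 τ →
      |G y s - G y' s| ≤ Λ * ‖y - y'‖ * Real.exp (lam * (τ - s)) := by
    intro y y' s hs
    have hzd : ∀ t ∈ Icc s τ, |Z y t - Z y' t| ≤ Real.exp (lam * (τ - s)) * ‖y - y'‖ := by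
      intro t ht
      have ht' : t ∈ Icc 0 τ := ⟨hs.1.trans ht.1, ht.2⟩
      rw [hZv y t ht', hZv y' t ht', ← mul_sub, abs_mul, Real.abs_exp]
      have := ht.1
      gcongr
      exact (y - y').norm_coe_le_norm ⟨t, ht'⟩
    have hJ := abs_bwd_le_of_bound h0 h1 ((hZm y).sub (hZm y')) hzd hs.1 hs.2
    rw [bwd_sub h0 h1 (hZm y) (hZm y')] at hJ
    have hpow : (τ - s) ^ α / α ≤ T ^ α / α := by
      have := hs.1; have := hs.2
      gcongr
      linarith
    rw [hGv y s hs, hGv y' s hs]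
    calc _ = |a s * (Z y s - Z y' s) + b s * (bwd α τ (Z y) s - bwd α τ (Z y') s)| := by ring_nf
      _ ≤ |a s| * |Z y s - Z y' s| + |b s| * |bwd α τ (Z y) s - bwd α τ (Z y') s| := by
        rw [← abs_mul, ← abs_mul]; exact abs_add_le _ _
      _ ≤ μ * (Real.exp (lam * (τ - s)) * ‖y - y'‖) +
          μ * (Real.exp (lam * (τ - s)) * ‖y - y'‖ * (T ^ α / α)) := by
        gcongr
        · exact haμ s
        · exact hzd s ⟨le_rfl, hs.2⟩
        · exact hbμ s
        · exact hJ.trans (by gcongr)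
      _ = (Λ - 1) * ‖y - y'‖ * Real.exp (lam * (τ - s)) := by rw [hΛ]; ring
      _ ≤ _ := by gcongr; linarith
  have hNd : ∀ y y' (t : Icc 0 τ), |N y t - N y' t| ≤ 1 / 2 * ‖y - y'‖ := by
    intro y y' t
    have hint : |∫ s in (t : ℝ)..τ, (G y s - G y' s)| ≤
        Λ * ‖y - y'‖ * ((Real.exp (lam * (τ - t)) - 1) / lam) := by
      rw [← integral_exp_decay hl0, ← intervalIntegral.integral_const_mul]
      refine (intervalIntegral.abs_integral_le_integral_abs t.2.2).trans ?_
      refine intervalIntegral.integral_mono_on t.2.2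
        (Continuous.intervalIntegrable (((hGc y).sub (hGc y')).abs) _ _)
        (Continuous.intervalIntegrable (by fun_prop) _ _) fun s hs => ?_
      exact hGd y y' s ⟨t.2.1.trans hs.1, hs.2⟩
    rw [intervalIntegral.integral_sub ((hGc y).intervalIntegrable _ _)
      ((hGc y').intervalIntegrable _ _)] at hint
    change |Real.exp (-(lam * (τ - t))) * (1 - ∫ s in (t : ℝ)..τ, G y s) -
      Real.exp (-(lam * (τ - t))) * (1 - ∫ s in (t : ℝ)..τ, G y' s)| ≤ _
    rw [← mul_sub, abs_mul, Real.abs_exp, abs_sub_comm,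
      show ∀ x y : ℝ, 1 - x - (1 - y) = y - x by intros; ring]
    calc _ ≤ Real.exp (-(lam * (τ - t))) *
          (Λ * ‖y - y'‖ * ((Real.exp (lam * (τ - t)) - 1) / lam)) := by
          gcongr
      _ ≤ Real.exp (-(lam * (τ - t))) * (Λ * ‖y - y'‖ * (Real.exp (lam * (τ - t)) / lam)) := by
          gcongr; linarith
      _ = _ := by
          rw [Real.exp_neg, hlam]
          field_simp
  have hcon : ContractingWith (1 / 2 : NNReal) N := by
    refine ⟨by rw [← NNReal.coe_lt_coe]; norm_num, LipschitzWith.of_dist_le_mul fun y y' => ?_⟩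
    rw [ContinuousMap.dist_le (by positivity)]
    intro t
    rw [Real.dist_eq, dist_eq_norm]
    simpa using hNd y y' t
  have : Nonempty (C(Icc 0 τ, ℝ)) := ⟨0⟩
  set y := hcon.fixedPoint N
  have hy : N y = y := hcon.fixedPoint_isFixedPt
  -- The map sends 0 to a function of norm at most 1, so ‖y‖ ≤ 1 + ‖y‖ / 2. The bound does not
  -- depend on τ.
  have hyn : ‖y‖ ≤ 2 := by
    have h2 : ‖y‖ ≤ 1 + 1 / 2 * ‖y‖ := by
      rw [ContinuousMap.norm_le _ (by positivity)]
      intro t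
      have h3 := hNd y 0 t
      have h4 : |N 0 t| ≤ 1 := by
        have hZ0 : Z 0 = fun _ => 0 := by ext s; simp [Z, IccExtend]
        have hG0 : ∀ s ∈ uIcc (t : ℝ) τ, G 0 s = 0 := fun s hs => by
          rw [uIcc_of_le t.2.2] at hs
          rw [hGv 0 s ⟨t.2.1.trans hs.1, hs.2⟩, hZ0]
          simp [bwd]
        change |Real.exp (-(lam * (τ - t))) * (1 - ∫ s in (t : ℝ)..τ, G 0 s)| ≤ 1
        rw [intervalIntegral.integral_congr (g := fun _ => 0) hG0]
        simp only [intervalIntegral.integral_zero, sub_zero, mul_one, Real.abs_exp]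
        rw [Real.exp_le_one_iff]
        have := t.2.2
        have : 0 ≤ lam * (τ - t) := mul_nonneg hl0.le (by linarith)
        linarith
      rw [hy, sub_zero] at h3
      rw [Real.norm_eq_abs]
      have := abs_sub_abs_le_abs_sub (y t) (N 0 t)
      linarith
    linarith
  have hzeq : ∀ t ∈ Icc 0 τ, Z y t = 1 - ∫ s in t..τ, G y s := by
    intro t ht
    rw [hZv y t ht]
    have h2 : N y ⟨t, ht⟩ = y ⟨t, ht⟩ := by rw [hy]
    rw [← h2]
    change _ * (Real.exp (-(lam * (τ - t))) * (1 - ∫ s in (t : ℝ)..τ, G y s)) = _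
    rw [← mul_assoc, ← Real.exp_add, add_neg_cancel, Real.exp_zero, one_mul]
  refine ⟨Z y, hZc y, ?_, fun x => (hZb y x).trans (by gcongr), fun t ht => ?_⟩
  · rw [hzeq τ ⟨hτ.le, le_rfl⟩]; simp
  · rw [← hGv y t ⟨ht.1.le, ht.2.le⟩]
    have h2 : HasDerivAt (fun t => 1 - ∫ s in t..τ, G y s) (G y t) t := by
      have := (intervalIntegral.integral_hasDerivAt_left ((hGc y).intervalIntegrable t τ)
        ((hGc y).stronglyMeasurableAtFilter _ _) (hGc y).continuousAt).const_sub 1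
      simpa using this
    refine h2.congr_of_eventuallyEq ?_
    filter_upwards [isOpen_Ioo.mem_nhds ht] with s hs
    exact hzeq s ⟨hs.1.le, hs.2.le⟩

end DGVolterra

end

noncomputable section

namespace DGVolterra

open MeasureTheory

/-! ### Elementary inequalities for powers -/

theorem rpow_sub_rpow_le_mul {α u v : ℝ} (h1 : α < 1) (hu : 0 < u) (huv : u ≤ v) :
    v ^ α - u ^ α ≤ (v - u) * u ^ (α - 1) := by
  have hv : 0 < v := hu.trans_le huv
  have e : v ^ (α - 1) ≤ u ^ (α - 1) :=
    Real.rpow_le_rpow_of_nonpos hu huv (by linarith)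
  have e1 : v ^ α = v * v ^ (α - 1) := by
    rw [Real.rpow_sub_one hv.ne']; field_simp
  have e2 : u ^ α = u * u ^ (α - 1) := by
    rw [Real.rpow_sub_one hu.ne']; field_simp
  rw [e1, e2]
  nlinarith

theorem rpow_sub_one_sub_le {α u v : ℝ} (h0 : 0 < α) (hu : 0 < u) (huv : u ≤ v) :
    u ^ (α - 1) - v ^ (α - 1) ≤ (v - u) * u ^ (α - 2) := by
  have hv : 0 < v := hu.trans_le huv
  have e : u ^ α ≤ v ^ α := Real.rpow_le_rpow hu.le huv h0.le
  have e2 : u ^ (α - 2) = u ^ α / u ^ 2 := by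
    rw [Real.rpow_sub hu]; norm_num
  rw [Real.rpow_sub_one hv.ne', Real.rpow_sub_one hu.ne', e2]
  have hup : 0 ≤ u ^ α := Real.rpow_nonneg hu.le _
  calc u ^ α / u - v ^ α / v ≤ u ^ α / u - u ^ α / v := by gcongr
    _ = u ^ α * (v - u) / (u * v) := by field_simp
    _ ≤ u ^ α * (v - u) / (u * u) := by
        have := sub_nonneg.2 huv
        gcongr
    _ = _ := by ring

theorem rpow_sub_rpow_le {α u v : ℝ} (h0 : 0 < α) (h1 : α < 1) (hu : 0 ≤ u) (huv : u ≤ v) :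
    v ^ α - u ^ α ≤ (v - u) ^ α := by
  have := Real.rpow_add_le_add_rpow (sub_nonneg.2 huv) hu h0.le h1.le
  rw [sub_add_cancel] at this
  linarith

/-- `∫₀ʷ r ^ (α - 1) (w - r) ^ (α - 1) dr` is bounded by a multiple of `w ^ (α - 1)`. -/
theorem integral_ker_mul_ker_le {α w T : ℝ} (h0 : 0 < α) (h1 : α < 1) (hw : 0 < w) (hwT : w ≤ T) :
    IntervalIntegrable (fun r => ker α r * ker α (w - r)) volume 0 w ∧
    ∫ r in (0 : ℝ)..w, ker α r * ker α (w - r) ≤ 4 * (T ^ α / α) * w ^ (α - 1) := by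
  -- One of r and w - r is at least w / 2, so one of the two factors is at most (w / 2)^(α-1).
  have hb : ∀ r ∈ Ioo (0 : ℝ) w, ker α r * ker α (w - r) ≤
      (w / 2) ^ (α - 1) * (ker α r + ker α (w - r)) := by
    intro r hr
    have hr' : 0 < w - r := by linarith [hr.2]
    have h2 : 0 ≤ (w / 2) ^ (α - 1) := by positivity
    rcases le_total r (w / 2) with h | h
    · have : ker α (w - r) ≤ (w / 2) ^ (α - 1) := by
        rw [ker_of_pos hr']
        exact Real.rpow_le_rpow_of_nonpos (by positivity) (by linarith) (by linarith)
      nlinarith [ker_nonneg α r, ker_nonneg α (w - r)]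
    · have : ker α r ≤ (w / 2) ^ (α - 1) := by
        rw [ker_of_pos hr.1]
        exact Real.rpow_le_rpow_of_nonpos (by positivity) (by linarith) (by linarith)
      nlinarith [ker_nonneg α r, ker_nonneg α (w - r)]
  have hi : IntervalIntegrable (fun r => (w / 2) ^ (α - 1) * (ker α r + ker α (w - r)))
      volume 0 w :=
    ((ker_intervalIntegrable h0 h1 0 w).add
      (ker_sub_left_intervalIntegrable h0 h1 w 0 w)).const_mul _
  have hm : Measurable fun r => ker α r * ker α (w - r) :=
    (measurable_ker α).mul ((measurable_ker α).comp (by fun_prop))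
  have hint : IntervalIntegrable (fun r => ker α r * ker α (w - r)) volume 0 w := by
    refine hi.mono_fun hm.aestronglyMeasurable ?_
    have : ∀ᵐ s : ℝ, s ≠ w := by simp [ae_iff]
    rw [Filter.EventuallyLE, ae_restrict_iff' measurableSet_uIoc]
    filter_upwards [this] with r hr hr'
    rw [uIoc_of_le hw.le] at hr'
    rw [Real.norm_of_nonneg (mul_nonneg (ker_nonneg _ _) (ker_nonneg _ _)), Real.norm_eq_abs]
    exact (hb r ⟨hr'.1, lt_of_le_of_ne hr'.2 hr⟩).trans (le_abs_self _)
  refine ⟨hint, ?_⟩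
  calc _ ≤ ∫ r in (0 : ℝ)..w, (w / 2) ^ (α - 1) * (ker α r + ker α (w - r)) :=
        intervalIntegral.integral_mono_on_of_le_Ioo hw.le hint hi hb
    _ = (w / 2) ^ (α - 1) * (2 * (w ^ α / α)) := by
        rw [intervalIntegral.integral_const_mul, intervalIntegral.integral_add
          (ker_intervalIntegrable h0 h1 0 w) (ker_sub_left_intervalIntegrable h0 h1 w 0 w),
          integral_ker h0 h1, integral_ker_sub_left h0 h1]
        rw [sub_zero, sub_self, max_eq_left hw.le, max_self, Real.zero_rpow h0.ne']
        ring
    _ ≤ (2 * w ^ (α - 1)) * (2 * (T ^ α / α)) := by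
        have e : (w / 2) ^ (α - 1) ≤ 2 * w ^ (α - 1) := by
          rw [Real.div_rpow hw.le zero_le_two, div_eq_mul_inv, ← Real.rpow_neg zero_le_two, mul_comm]
          gcongr
          calc (2 : ℝ) ^ (-(α - 1)) ≤ 2 ^ (1 : ℝ) :=
                Real.rpow_le_rpow_of_exponent_le one_le_two (by linarith)
            _ = 2 := Real.rpow_one 2
        gcongr
    _ = _ := by ring

/-! ### The dual problem: regularity -/

/-- `z` solves the dual problem on `[0, τ]`; the coefficients have modulus of continuity controlled
by `t ^ α`. -/
structure IsDual (α T μ M₁ L τ : ℝ) (a b z : ℝ → ℝ) : Prop where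
  pos : 0 < τ
  le : τ ≤ T
  bound_a : ∀ x, |a x| ≤ μ
  bound_b : ∀ x, |b x| ≤ μ
  cont_a : Continuous a
  cont_b : Continuous b
  diff_a : ∀ x y, 0 ≤ x → x ≤ y → y ≤ T → |a y - a x| ≤ M₁ * (y ^ α - x ^ α)
  diff_b : ∀ x y, 0 ≤ x → x ≤ y → y ≤ T → |b y - b x| ≤ M₁ * (y ^ α - x ^ α)
  cont : Continuous z
  last : z τ = 1
  bound : ∀ x, |z x| ≤ L
  deriv : ∀ t ∈ Ioo 0 τ, HasDerivAt z (a t * z t + b t * bwd α τ z t) t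

/-- A bound for the derivative of a dual solution. -/
def dualD (α T μ L : ℝ) : ℝ := μ * L * (1 + T ^ α / α)

/-- A bound for the variation of the derivative of a dual solution. -/
def dualG (α T μ M₁ L : ℝ) : ℝ :=
  (M₁ * L + μ * dualD α T μ L) * (1 + T ^ α / α) + μ * L / α

section
variable {α : ℝ} (h0 : 0 < α) (h1 : α < 1)
include h0 h1

/-- After the shift t = r + s the kernel no longer depends on s, so increments in s fall on ψ and on
the upper limit only. -/
theorem bwd_eq_shift {τ : ℝ} {ψ : ℝ → ℝ} (hψ : BddMeas ψ) {s : ℝ} (hs : 0 ≤ s) :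
    bwd α τ ψ s = ∫ r in (0 : ℝ)..τ - s, ker α r * ψ (r + s) := by
  have h := intervalIntegral.integral_comp_add_right (a := -s) (b := τ - s)
    (fun t => ker α (t - s) * ψ t) s
  simp only [add_sub_cancel_right, neg_add_cancel, sub_add_cancel] at h
  have hsh : BddMeas (fun r => ψ (r + s)) := by
    obtain ⟨C, hC⟩ := hψ.bdd
    exact ⟨hψ.1.comp (by fun_prop), C, fun x => hC _⟩
  have hi : ∀ x y, IntervalIntegrable (fun r => ker α r * ψ (r + s)) volume x y := fun x y =>
    hsh.intervalIntegrable_mul (ker_intervalIntegrable h0 h1 x y)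
  rw [bwd, ← h, ← intervalIntegral.integral_add_adjacent_intervals (hi (-s) 0) (hi 0 (τ - s)),
    intervalIntegral.integral_congr_ae (a := -s) (b := 0) (g := fun _ => 0)
      (Filter.Eventually.of_forall fun t ht => by
        rw [uIoc_of_le (by linarith)] at ht
        rw [ker_of_nonpos h1 ht.2, zero_mul])]
  simp

/-- On the common range [0, τ - y] the difference is an increment of ψ. The surplus range [τ - y, τ
- x] costs B times the integral of the kernel, which is where the singular behaviour at τ comes
from. -/
theorem abs_bwd_sub_le {τ : ℝ} {ψ Ω : ℝ → ℝ} (hψ : BddMeas ψ) {B x y : ℝ} (hx : 0 ≤ x)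
    (hxy : x ≤ y) (hy : y ≤ τ) (hB : ∀ s ∈ Icc 0 τ, |ψ s| ≤ B)
    (hΩi : IntervalIntegrable (fun r => ker α r * Ω r) volume 0 (τ - y))
    (hΩ : ∀ r ∈ Ioo 0 (τ - y), |ψ (r + y) - ψ (r + x)| ≤ Ω r) :
    |bwd α τ ψ y - bwd α τ ψ x| ≤
      (∫ r in (0 : ℝ)..τ - y, ker α r * Ω r) + B * (((τ - x) ^ α - (τ - y) ^ α) / α) := by
  have hsh : ∀ s, BddMeas (fun r => ψ (r + s)) := fun s => by
    obtain ⟨C, hC⟩ := hψ.bdd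
    exact ⟨hψ.1.comp (by fun_prop), C, fun x => hC _⟩
  have hi : ∀ s x y, IntervalIntegrable (fun r => ker α r * ψ (r + s)) volume x y := fun s x y =>
    (hsh s).intervalIntegrable_mul (ker_intervalIntegrable h0 h1 x y)
  have hyτ : 0 ≤ τ - y := by linarith
  rw [bwd_eq_shift h0 h1 hψ (hx.trans hxy), bwd_eq_shift h0 h1 hψ hx,
    ← intervalIntegral.integral_add_adjacent_intervals (hi x 0 (τ - y)) (hi x (τ - y) (τ - x)),
    ← sub_sub, ← intervalIntegral.integral_sub (hi y _ _) (hi x _ _)]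
  refine (abs_sub _ _).trans (add_le_add ?_ ?_)
  · refine (intervalIntegral.abs_integral_le_integral_abs hyτ).trans ?_
    refine intervalIntegral.integral_mono_on_of_le_Ioo hyτ ((hi y _ _).sub (hi x _ _)).abs hΩi
      fun r hr => ?_
    rw [← mul_sub, abs_mul, abs_of_nonneg (ker_nonneg _ _)]
    exact mul_le_mul_of_nonneg_left (hΩ r hr) (ker_nonneg _ _)
  · refine (intervalIntegral.abs_integral_le_integral_abs (by linarith)).trans ?_
    calc _ ≤ ∫ r in τ - y..τ - x, B * ker α r := by
          refine intervalIntegral.integral_mono_on (by linarith) (hi x _ _).abs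
            ((ker_intervalIntegrable h0 h1 _ _).const_mul B) fun r hr => ?_
          rw [abs_mul, abs_of_nonneg (ker_nonneg _ _), mul_comm]
          exact mul_le_mul_of_nonneg_right (hB _ ⟨by linarith [hr.1], by linarith [hr.2]⟩)
            (ker_nonneg _ _)
      _ = _ := by
          rw [intervalIntegral.integral_const_mul, integral_ker h0 h1, max_eq_left hyτ,
            max_eq_left (by linarith)]

variable {T μ M₁ L τ : ℝ} {a b z : ℝ → ℝ} (hz : IsDual α T μ M₁ L τ a b z)
include hz

omit h0 h1 in
theorem IsDual.mu_nonneg : 0 ≤ μ := (abs_nonneg _).trans (hz.bound_a 0)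

omit h0 h1 in
theorem IsDual.L_nonneg : 0 ≤ L := (abs_nonneg _).trans (hz.bound 0)

omit h0 h1 in
theorem IsDual.T_pos : 0 < T := hz.pos.trans_le hz.le

omit h1 in
theorem IsDual.M_nonneg : 0 ≤ M₁ := by
  have h := (abs_nonneg _).trans (hz.diff_a 0 T le_rfl hz.T_pos.le le_rfl)
  rw [Real.zero_rpow h0.ne', sub_zero] at h
  exact nonneg_of_mul_nonneg_left h (Real.rpow_pos_of_pos hz.T_pos _)

omit h0 h1 in
theorem IsDual.bddMeas : BddMeas z := ⟨hz.cont.measurable, L, hz.bound⟩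

theorem IsDual.abs_bwd_le {t : ℝ} (ht : t ∈ Icc 0 τ) : |bwd α τ z t| ≤ L * (T ^ α / α) := by
  refine (abs_bwd_le_of_bound h0 h1 hz.bddMeas (fun s _ => hz.bound s) ht.1 ht.2).trans ?_
  have := hz.L_nonneg
  have := ht.1; have := ht.2; have := hz.le
  gcongr
  linarith

theorem IsDual.abs_deriv_le {t : ℝ} (ht : t ∈ Icc 0 τ) :
    |a t * z t + b t * bwd α τ z t| ≤ dualD α T μ L := by
  have := hz.mu_nonneg
  calc _ ≤ |a t| * |z t| + |b t| * |bwd α τ z t| := by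
        rw [← abs_mul, ← abs_mul]; exact abs_add_le _ _
    _ ≤ μ * L + μ * (L * (T ^ α / α)) := by
        gcongr
        · exact hz.bound_a t
        · exact hz.bound t
        · exact hz.bound_b t
        · exact hz.abs_bwd_le h0 h1 ht
    _ = _ := by rw [dualD]; ring

theorem IsDual.dualD_nonneg : 0 ≤ dualD α T μ L :=
  (abs_nonneg _).trans (hz.abs_deriv_le h0 h1 ⟨le_rfl, hz.pos.le⟩)

theorem IsDual.lipschitz {x y : ℝ} (hx : 0 ≤ x) (hxy : x ≤ y) (hy : y ≤ τ) :
    |z y - z x| ≤ dualD α T μ L * (y - x) := by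
  have := norm_image_sub_le_of_norm_deriv_right_le_segment (f := z) (a := x) (b := y)
    (f' := fun t => a t * z t + b t * bwd α τ z t) (C := dualD α T μ L)
    hz.cont.continuousOn
  rcases hx.eq_or_lt with rfl | hx
  · -- approach the left endpoint from inside
    rcases hxy.eq_or_lt with rfl | hxy
    · simp
    have key : ∀ x ∈ Ioo 0 y, |z y - z x| ≤ dualD α T μ L * (y - x) := by
      intro x hx
      have := norm_image_sub_le_of_norm_deriv_right_le_segment (f := z) (a := x) (b := y)
        (f' := fun t => a t * z t + b t * bwd α τ z t) (C := dualD α T μ L)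
        hz.cont.continuousOn
        (fun t ht => (hz.deriv t ⟨hx.1.trans_le ht.1, ht.2.trans_le hy⟩).hasDerivWithinAt)
        (fun t ht => hz.abs_deriv_le h0 h1 ⟨(hx.1.trans_le ht.1).le, (ht.2.trans_le hy).le⟩)
      exact this y ⟨hx.2.le, le_rfl⟩
    have hcl : (0 : ℝ) ∈ closure (Ioo 0 y) := by
      rw [closure_Ioo hxy.ne]; exact ⟨le_rfl, hxy.le⟩
    have hzc := hz.cont
    exact le_on_closure (f := fun x => |z y - z x|) (g := fun x => dualD α T μ L * (y - x)) key
      (by fun_prop) (by fun_prop) hcl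
  · exact this (fun t ht => (hz.deriv t ⟨hx.trans_le ht.1, ht.2.trans_le hy⟩).hasDerivWithinAt)
      (fun t ht => hz.abs_deriv_le h0 h1 ⟨(hx.trans_le ht.1).le, (ht.2.trans_le hy).le⟩)
      y ⟨hxy, le_rfl⟩

theorem IsDual.abs_bwd_sub_le {x y : ℝ} (hx : 0 ≤ x) (hxy : x ≤ y) (hy : y ≤ τ) :
    |bwd α τ z y - bwd α τ z x| ≤
      dualD α T μ L * (T ^ α / α) * (y - x) + L / α * ((τ - x) ^ α - (τ - y) ^ α) := by
  have hD := hz.dualD_nonneg h0 h1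
  have hyτ : 0 ≤ τ - y := by linarith
  refine (DGVolterra.abs_bwd_sub_le h0 h1 hz.bddMeas (B := L)
    (Ω := fun _ => dualD α T μ L * (y - x)) hx hxy hy
    (fun s _ => hz.bound s) ((ker_intervalIntegrable h0 h1 _ _).mul_const _) fun r hr => ?_).trans ?_
  · refine (hz.lipschitz h0 h1 (by linarith [hr.1]) (by linarith) (by linarith [hr.2])).trans
      (le_of_eq ?_)
    ring
  · rw [intervalIntegral.integral_mul_const, integral_ker h0 h1, max_eq_left hyτ, max_self,
      Real.zero_rpow h0.ne', sub_zero]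
    have : (τ - y) ^ α / α * (dualD α T μ L * (y - x)) ≤ T ^ α / α * (dualD α T μ L * (y - x)) := by
      have := hz.le
      have := sub_nonneg.2 hxy
      gcongr
      linarith
    calc _ ≤ T ^ α / α * (dualD α T μ L * (y - x)) + L * (((τ - x) ^ α - (τ - y) ^ α) / α) := by
          gcongr
      _ = _ := by ring

/-- The variation of `z'` is controlled by that of `t + t ^ α - (τ - t) ^ α`. -/
theorem IsDual.abs_deriv_sub_le {x y : ℝ} (hx : 0 ≤ x) (hxy : x ≤ y) (hy : y ≤ τ) :
    |(a y * z y + b y * bwd α τ z y) - (a x * z x + b x * bwd α τ z x)| ≤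
      dualG α T μ M₁ L * ((y - x) + (y ^ α - x ^ α) + ((τ - x) ^ α - (τ - y) ^ α)) := by
  have hD := hz.dualD_nonneg h0 h1
  have hμ := hz.mu_nonneg
  have hL := hz.L_nonneg
  have hM := hz.M_nonneg h0
  have hT := hz.T_pos
  have hK : 0 ≤ T ^ α / α := by positivity
  set D := dualD α T μ L with hDdef
  set K := T ^ α / α with hKdef
  have p1 : 0 ≤ y - x := by linarith
  have p2 : 0 ≤ y ^ α - x ^ α := sub_nonneg.2 (Real.rpow_le_rpow hx hxy h0.le)
  have p3 : 0 ≤ (τ - x) ^ α - (τ - y) ^ α :=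
    sub_nonneg.2 (Real.rpow_le_rpow (by linarith) (by linarith) h0.le)
  set P1 := y - x
  set P2 := y ^ α - x ^ α
  set P3 := (τ - x) ^ α - (τ - y) ^ α
  have hyT : y ≤ T := hy.trans hz.le
  calc _ = |((a y - a x) * z y + a x * (z y - z x)) +
        ((b y - b x) * bwd α τ z y + b x * (bwd α τ z y - bwd α τ z x))| := by ring_nf
    _ ≤ (|a y - a x| * |z y| + |a x| * |z y - z x|) +
        (|b y - b x| * |bwd α τ z y| + |b x| * |bwd α τ z y - bwd α τ z x|) := by
        simp only [← abs_mul]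
        exact (abs_add_le _ _).trans (add_le_add (abs_add_le _ _) (abs_add_le _ _))
    _ ≤ (M₁ * P2 * L + μ * (D * P1)) +
        (M₁ * P2 * (L * K) + μ * (D * K * P1 + L / α * P3)) := by
        gcongr
        · exact hz.diff_a x y hx hxy hyT
        · exact hz.bound y
        · exact hz.bound_a x
        · exact hz.lipschitz h0 h1 hx hxy hy
        · exact hz.diff_b x y hx hxy hyT
        · exact hz.abs_bwd_le h0 h1 ⟨hx.trans hxy, hy⟩
        · exact hz.bound_b x
        · exact hz.abs_bwd_sub_le h0 h1 hx hxy hy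
    _ = M₁ * L * (1 + K) * P2 + μ * D * (1 + K) * P1 + μ * L / α * P3 := by ring
    _ ≤ _ := by
        rw [dualG, ← hDdef, ← hKdef]
        have q1 : 0 ≤ M₁ * L * (1 + K) := by positivity
        have q2 : 0 ≤ μ * D * (1 + K) := by positivity
        have q3 : 0 ≤ μ * L / α := by positivity
        rw [show ((M₁ * L + μ * D) * (1 + K) + μ * L / α) * (P1 + P2 + P3) =
          (M₁ * L * (1 + K) * P2 + μ * D * (1 + K) * P1 + μ * L / α * P3) +
          (M₁ * L * (1 + K) * P1 + M₁ * L * (1 + K) * P3 + μ * D * (1 + K) * P2 +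
            μ * D * (1 + K) * P3 + μ * L / α * P1 + μ * L / α * P2) by ring]
        have := add_nonneg (add_nonneg (add_nonneg (add_nonneg (add_nonneg (mul_nonneg q1 p1)
          (mul_nonneg q1 p3)) (mul_nonneg q2 p2)) (mul_nonneg q2 p3)) (mul_nonneg q3 p1))
          (mul_nonneg q3 p2)
        linarith

omit hz in
theorem dualG_nonneg (hz : IsDual α T μ M₁ L τ a b z) : 0 ≤ dualG α T μ M₁ L := by
  have hD := hz.dualD_nonneg h0 h1
  have hμ := hz.mu_nonneg
  have hL := hz.L_nonneg
  have hM := hz.M_nonneg h0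
  have hT := hz.T_pos
  rw [dualG]
  positivity

/-- The middle factor is an increment of t + t^α - (τ - t)^α and is left in that form because it
telescopes over a mesh. The bound is usable on every interval, including those touching 0 or τ. -/
theorem IsDual.polyApprox_one {x₀ x₁ : ℝ} (hx : 0 ≤ x₀) (hx01 : x₀ < x₁) (hx1 : x₁ ≤ τ) :
    PolyApprox 1 x₀ x₁ z (dualG α T μ M₁ L *
      ((x₁ - x₀) + (x₁ ^ α - x₀ ^ α) + ((τ - x₀) ^ α - (τ - x₁) ^ α)) * (x₁ - x₀)) := by
  refine PolyApprox.integrate hx01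
    (fun t ht => hz.deriv t ⟨hx.trans_lt ht.1, ht.2.trans_le hx1⟩)
    (PolyApprox.of_osc hx01 fun x hx' y hy hxy => ?_)
  refine (hz.abs_deriv_sub_le h0 h1 (by linarith [hx'.1]) hxy (by linarith [hy.2])).trans ?_
  have := dualG_nonneg h0 h1 hz
  have := hx'.1; have := hy.2; have := hx'.2; have := hy.1
  gcongr
  · linarith
  · linarith

end
end DGVolterra

end

noncomputable section

namespace DGVolterra

open MeasureTheory

/-! ### The dual problem: second order regularity -/

theorem integral_indicator_Ioi_mul {x τ : ℝ} (hx : 0 ≤ x) (hxτ : x ≤ τ) (F : ℝ → ℝ) :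
    ∫ s in (0 : ℝ)..τ, (Ioi x).indicator (fun _ => 1) s * F s = ∫ s in x..τ, F s := by
  have : ∀ s, (Ioi x).indicator (fun _ => (1 : ℝ)) s * F s = (Ioi x).indicator F s := fun s => by
    by_cases h : s ∈ Ioi x
    · rw [indicator_of_mem h, indicator_of_mem h, one_mul]
    · rw [indicator_of_notMem h, indicator_of_notMem h, zero_mul]
  simp only [this]
  rw [intervalIntegral.integral_of_le (hx.trans hxτ), intervalIntegral.integral_of_le hxτ,
    setIntegral_indicator measurableSet_Ioi]
  congr 2
  ext s
  simp only [mem_inter_iff, mem_Ioc, mem_Ioi]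
  constructor
  · exact fun h => ⟨h.2, h.1.2⟩
  · exact fun h => ⟨⟨hx.trans_lt h.1, h.2⟩, h.1⟩

section
variable {α : ℝ} (h0 : 0 < α) (h1 : α < 1)
include h0 h1
variable {T μ M₁ L τ : ℝ} {a b z : ℝ → ℝ} (hz : IsDual α T μ M₁ L τ a b z)
include hz

/-- Extending the formula for z' by its endpoint values gives a function on the line that can itself
be put into the fractional integrals. -/
theorem IsDual.exists_deriv : ∃ g : ℝ → ℝ, Continuous g ∧ BddMeas g ∧
    ∀ t ∈ Icc 0 τ, g t = a t * z t + b t * bwd α τ z t := by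
  have hc : ContinuousOn (fun t => a t * z t + b t * bwd α τ z t) (Icc 0 τ) :=
    (hz.cont_a.mul hz.cont).continuousOn.add
      (hz.cont_b.continuousOn.mul (continuousOn_bwd h0 h1 hz.cont hz.bddMeas))
  exact ⟨_, hc.domRestrict.Icc_extend', BddMeas.iccExtend hz.pos.le hc,
    fun t ht => IccExtend_of_mem hz.pos.le _ ht⟩

variable {g : ℝ → ℝ} (hgc : Continuous g) (hgm : BddMeas g)
  (hg : ∀ t ∈ Icc 0 τ, g t = a t * z t + b t * bwd α τ z t)
include hgc hgm hg

/-- Adjointness is applied to the indicator of (x, ∞), whose forward integral is (t - x)₊^α / α;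
integration by parts against z' then uses z(τ) = 1. This avoids differentiating under a singular
integral. -/
theorem IsDual.integral_bwd_deriv {x : ℝ} (hx : 0 ≤ x) (hxτ : x ≤ τ) :
    ∫ s in x..τ, bwd α τ g s = (τ - x) ^ α / α - bwd α τ z x := by
  have hφ : BddMeas ((Ioi x).indicator fun _ => (1 : ℝ)) := (BddMeas.const 1).indicator measurableSet_Ioi
  have hadj := integral_fwd_mul h0 h1 hz.pos.le hφ hgm
  rw [integral_indicator_Ioi_mul hx hxτ] at hadj
  have hf : ∀ t, t ≤ τ → fwd α τ ((Ioi x).indicator fun _ => (1 : ℝ)) t = max (t - x) 0 ^ α / α := by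
    intro t ht
    rw [fwd]
    simp only [mul_comm (ker α _)]
    rw [integral_indicator_Ioi_mul hx hxτ, integral_ker_sub_left h0 h1, max_eq_right (b := (0:ℝ))
      (a := t - τ) (by linarith), Real.zero_rpow h0.ne', sub_zero]
  have hprod : ∫ t in (0 : ℝ)..τ, fwd α τ ((Ioi x).indicator fun _ => (1 : ℝ)) t * g t =
      ∫ t in x..τ, (t - x) ^ α / α * g t := by
    rw [← integral_indicator_Ioi_mul hx hxτ]
    refine intervalIntegral.integral_congr fun t ht => ?_
    rw [uIcc_of_le hz.pos.le] at ht
    rw [hf t ht.2]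
    by_cases h : x < t
    · rw [indicator_of_mem (show t ∈ Ioi x from h), one_mul, max_eq_left (by linarith)]
    · rw [indicator_of_notMem (show t ∉ Ioi x from h), zero_mul, max_eq_right (by linarith),
        Real.zero_rpow h0.ne', zero_div, zero_mul]
  rw [← hadj, hprod]
  have hparts := intervalIntegral.integral_mul_deriv_eq_deriv_mul_of_hasDeriv_right
    (a := x) (b := τ) (u := fun t => (t - x) ^ α / α) (v := z) (u' := fun t => ker α (t - x))
    (v' := g)
    (ContinuousOn.div_const (Continuous.continuousOn
      (Continuous.rpow_const (by fun_prop) fun _ => Or.inr h0.le)) _)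
    hz.cont.continuousOn
    (fun t ht => by
      rw [min_eq_left hxτ, max_eq_right hxτ] at ht
      have hp : 0 < t - x := sub_pos.2 ht.1
      have := (((hasDerivAt_id t).sub_const x).rpow_const (p := α) (Or.inl hp.ne')).div_const α
      refine HasDerivAt.hasDerivWithinAt ?_
      rw [ker_of_pos hp]
      have e : (t - x) ^ (α - 1) = 1 * α * (t - x) ^ (α - 1) / α := by field_simp
      rw [e]
      exact this)
    (fun t ht => by
      rw [min_eq_left hxτ, max_eq_right hxτ] at ht
      have ht' : t ∈ Ioo 0 τ := ⟨hx.trans_lt ht.1, ht.2⟩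
      rw [hg t ⟨ht'.1.le, ht'.2.le⟩]
      exact (hz.deriv t ht').hasDerivWithinAt)
    (ker_sub_right_intervalIntegrable h0 h1 x x τ) (hgc.intervalIntegrable _ _)
  rw [hparts, hz.last, sub_self, Real.zero_rpow h0.ne', zero_div, zero_mul, sub_zero, mul_one]
  congr 1
  have hi := bwd_intervalIntegrable h0 h1 hz.bddMeas x
  rw [bwd, ← intervalIntegral.integral_add_adjacent_intervals (hi 0 x) (hi x τ),
    intervalIntegral.integral_congr_ae (a := 0) (b := x) (g := fun _ => 0)
      (Filter.Eventually.of_forall fun t ht => by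
        rw [uIoc_of_le hx] at ht
        rw [ker_of_nonpos h1 (by linarith [ht.2]), zero_mul])]
  simp

/-- The fundamental theorem of calculus applied to `integral_bwd_deriv`. The term (τ - x)^(α-1) is
the trace of z(τ) = 1. -/
theorem IsDual.hasDerivAt_bwd {x : ℝ} (hx : x ∈ Ioo 0 τ) :
    HasDerivAt (bwd α τ z) (bwd α τ g x - (τ - x) ^ (α - 1)) x := by
  have hc := continuousOn_bwd (α := α) (τ := τ) h0 h1 hgc hgm
  have hpos : 0 < τ - x := sub_pos.2 hx.2
  have d1 : HasDerivAt (fun s => ∫ t in s..τ, bwd α τ g t) (-bwd α τ g x) x := by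
    refine intervalIntegral.integral_hasDerivAt_left ?_ ?_ ?_
    · refine ContinuousOn.intervalIntegrable (hc.mono ?_)
      rw [uIcc_of_le hx.2.le]
      exact Icc_subset_Icc_left hx.1.le
    · exact (hc.mono Ioo_subset_Icc_self).stronglyMeasurableAtFilter isOpen_Ioo x hx
    · exact hc.continuousAt (Icc_mem_nhds hx.1 hx.2)
  have d2 : HasDerivAt (fun s => (τ - s) ^ α / α) (-(τ - x) ^ (α - 1)) x := by
    have := (((hasDerivAt_id x).const_sub τ).rpow_const (p := α) (Or.inl hpos.ne')).div_const α
    have e : -(τ - x) ^ (α - 1) = -1 * α * (τ - x) ^ (α - 1) / α := by field_simp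
    rw [e]
    exact this
  have d3 := d2.sub d1
  rw [show bwd α τ g x - (τ - x) ^ (α - 1) = -(τ - x) ^ (α - 1) - -bwd α τ g x by ring]
  refine d3.congr_of_eventuallyEq ?_
  filter_upwards [isOpen_Ioo.mem_nhds hx] with s hs
  simp only [Pi.sub_apply]
  rw [hz.integral_bwd_deriv h0 h1 hgc hgm hg hs.1.le hs.2.le]
  ring

omit hgc in
-- Increments of z' already carry a kernel singularity at τ. Convolving it with the kernel again is
-- harmless: by `integral_ker_mul_ker_le` the result is no worse than (τ - y)^(α-1).
theorem IsDual.abs_bwd_deriv_sub_le {x y : ℝ} (hx : 0 < x) (hxy : x ≤ y) (hy : y < τ) :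
    |bwd α τ g y - bwd α τ g x| ≤
      (dualG α T μ M₁ L * (4 * (T ^ α / α)) + dualD α T μ L / α) *
        ((y - x) * (1 + x ^ (α - 1) + (τ - y) ^ (α - 1))) := by
  have hG := dualG_nonneg h0 h1 hz
  have hD := hz.dualD_nonneg h0 h1
  have hw : 0 < τ - y := sub_pos.2 hy
  have hwT : τ - y ≤ T := by linarith [hz.le]
  have hT := hz.T_pos
  have hK : 0 ≤ T ^ α / α := by positivity
  obtain ⟨hki, hkb⟩ := integral_ker_mul_ker_le h0 h1 hw hwT
  set w := τ - y with hwdef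
  set G := dualG α T μ M₁ L
  set K := T ^ α / α
  set h := y - x with hhdef
  have hh : 0 ≤ h := sub_nonneg.2 hxy
  have hΩe : ∀ r, ker α r * (G * h * (1 + x ^ (α - 1) + ker α (w - r))) =
      G * h * (1 + x ^ (α - 1)) * ker α r + G * h * (ker α r * ker α (w - r)) := fun r => by ring
  have i1 : IntervalIntegrable (fun r => G * h * (1 + x ^ (α - 1)) * ker α r) volume 0 w :=
    (ker_intervalIntegrable h0 h1 _ _).const_mul _
  have i2 : IntervalIntegrable (fun r => G * h * (ker α r * ker α (w - r))) volume 0 w :=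
    hki.const_mul _
  refine (DGVolterra.abs_bwd_sub_le h0 h1 hgm (B := dualD α T μ L)
    (Ω := fun r => G * h * (1 + x ^ (α - 1) + ker α (w - r))) hx.le hxy hy.le
    (fun s hs => hg s hs ▸ hz.abs_deriv_le h0 h1 hs) (by simp only [hΩe]; exact i1.add i2)
    fun r hr => ?_).trans ?_
  · have hry : r + y ∈ Icc 0 τ := ⟨by linarith [hr.1], by linarith [hr.2]⟩
    have hrx : r + x ∈ Icc 0 τ := ⟨by linarith [hr.1], by linarith [hr.2]⟩
    rw [hg _ hry, hg _ hrx]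
    refine (hz.abs_deriv_sub_le h0 h1 hrx.1 (by linarith) hry.2).trans ?_
    have e1 : (r + y) ^ α - (r + x) ^ α ≤ h * x ^ (α - 1) := by
      have hrx0 : 0 < r + x := add_pos hr.1 hx
      refine (rpow_sub_rpow_le_mul h1 hrx0 (by linarith)).trans ?_
      rw [show r + y - (r + x) = h by rw [hhdef]; ring]
      exact mul_le_mul_of_nonneg_left
        (Real.rpow_le_rpow_of_nonpos hx (by linarith [hr.1]) (by linarith)) hh
    have e2 : (τ - (r + x)) ^ α - (τ - (r + y)) ^ α ≤ h * ker α (w - r) := by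
      have : 0 < τ - (r + y) := by linarith [hr.2]
      refine (rpow_sub_rpow_le_mul h1 this (by linarith)).trans (le_of_eq ?_)
      rw [show w - r = τ - (r + y) by rw [hwdef]; ring, ker_of_pos this]
      rw [hhdef]; ring
    calc _ ≤ G * (h + h * x ^ (α - 1) + h * ker α (w - r)) := by
          gcongr
          rw [hhdef]; linarith
      _ = _ := by ring
  · simp only [hΩe]
    rw [intervalIntegral.integral_add i1 i2, intervalIntegral.integral_const_mul,
      intervalIntegral.integral_const_mul, integral_ker h0 h1, max_self, max_eq_left hw.le,
      Real.zero_rpow h0.ne', sub_zero]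
    have e3 : w ^ α / α ≤ K := by simp only [K]; gcongr
    have e4 : (τ - x) ^ α - w ^ α ≤ h * w ^ (α - 1) := by
      refine (rpow_sub_rpow_le_mul h1 hw (by linarith)).trans (le_of_eq ?_)
      rw [hhdef, hwdef]; ring
    have hxp : 0 ≤ x ^ (α - 1) := by positivity
    have hwp : 0 ≤ w ^ (α - 1) := by positivity
    calc _ ≤ G * h * (1 + x ^ (α - 1)) * K + G * h * (4 * K * w ^ (α - 1)) +
          dualD α T μ L * ((h * w ^ (α - 1)) / α) := by gcongr
      _ ≤ G * h * (1 + x ^ (α - 1)) * (4 * K) + G * h * (4 * K * w ^ (α - 1)) +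
          dualD α T μ L / α * (h * (1 + x ^ (α - 1) + w ^ (α - 1))) := by
          gcongr ?_ + _ + ?_
          · gcongr; linarith
          · rw [mul_div_assoc', div_mul_eq_mul_div]
            gcongr
            linarith
      _ = _ := by ring

omit hgc hgm hg hz h0 in
theorem one_add_rpow_le {x w : ℝ} (hx : 0 < x) (hxT : x ≤ T) (hw : 0 < w) (hwT : w ≤ T) :
    1 + x ^ (α - 1) + w ^ (α - 1) ≤ (T ^ (2 - α) + T) * (x ^ (α - 2) + w ^ (α - 2)) := by
  have hT : 0 < T := hx.trans_le hxT
  have e : ∀ y, 0 < y → y ≤ T → y ^ (α - 1) ≤ T * y ^ (α - 2) := by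
    intro y hy hyT
    rw [show α - 1 = 1 + (α - 2) by ring, Real.rpow_add hy, Real.rpow_one]
    gcongr
  have e1 : 1 ≤ T ^ (2 - α) * x ^ (α - 2) := by
    calc (1 : ℝ) = x ^ (2 - α) * x ^ (α - 2) := by
          rw [← Real.rpow_add hx]; simp
      _ ≤ _ := by
          have : 0 ≤ 2 - α := by linarith
          gcongr
  have := e x hx hxT
  have := e w hw hwT
  have : 0 ≤ T ^ (2 - α) * w ^ (α - 2) := by positivity
  linarith

omit hgc hgm hg in
/-- Away from the end points, `z` is within `O(h³)` of quadratic polynomials, with the appropriate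
weights. -/
theorem IsDual.polyApprox_two {x₀ x₁ M₂ : ℝ} (hx : 0 < x₀) (hx01 : x₀ < x₁) (hx1 : x₁ < τ)
    (hM₂ : 0 ≤ M₂)
    (hA : PolyApprox 1 x₀ x₁ a (M₂ * x₀ ^ (α - 2) * (x₁ - x₀) ^ 2))
    (hB : PolyApprox 1 x₀ x₁ b (M₂ * x₀ ^ (α - 2) * (x₁ - x₀) ^ 2)) :
    PolyApprox 2 x₀ x₁ z
      ((M₁ * dualD α T μ L * T + μ * (dualG α T μ M₁ L * (T ^ (2 - α) + T)) + L * M₂ +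
        (M₁ * (dualD α T μ L * (T ^ α / α) + L / α) * (T + T ^ α) +
        μ * (1 + (dualG α T μ M₁ L * (4 * (T ^ α / α)) + dualD α T μ L / α) *
          (T ^ (2 - α) + T)) + L * (T ^ α / α) * M₂)) *
        ((x₁ - x₀) ^ 3 * (x₀ ^ (α - 2) + (τ - x₁) ^ (α - 2)))) := by
  obtain ⟨g, hgc, hgm, hg⟩ := hz.exists_deriv h0 h1
  have hG := dualG_nonneg h0 h1 hz
  have hD := hz.dualD_nonneg h0 h1
  have hμ := hz.mu_nonneg
  have hL := hz.L_nonneg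
  have hM := hz.M_nonneg h0
  have hT := hz.T_pos
  have hw : 0 < τ - x₁ := sub_pos.2 hx1
  have hwT : τ - x₁ ≤ T := by linarith [hz.le]
  have hxT : x₀ ≤ T := by linarith [hz.le]
  have hK : 0 ≤ T ^ α / α := by positivity
  have hΦ := one_add_rpow_le h1 hx hxT hw hwT
  set w := τ - x₁ with hwdef
  set G := dualG α T μ M₁ L
  set D := dualD α T μ L
  set K := T ^ α / α
  set h := x₁ - x₀ with hhdef
  have hh : 0 < h := sub_pos.2 hx01
  set S := T ^ (2 - α) + T
  have hS : 0 ≤ S := by positivity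
  have hxp2 : 0 ≤ x₀ ^ (α - 2) := by positivity
  have hwp2 : 0 ≤ w ^ (α - 2) := by positivity
  have hxp1 : 0 ≤ x₀ ^ (α - 1) := by positivity
  have hwp1 : 0 ≤ w ^ (α - 1) := by positivity
  set Ψ := x₀ ^ (α - 2) + w ^ (α - 2)
  have hΨ : 0 ≤ Ψ := by positivity
  set CJ := G * (4 * K) + D / α
  have hCJ : 0 ≤ CJ := by positivity
  have hmem : ∀ x ∈ Ioo x₀ x₁, x ∈ Ioo 0 τ := fun x hx' => ⟨hx.trans hx'.1, hx'.2.trans hx1⟩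
  have hmem' : ∀ x ∈ Ioo x₀ x₁, x ∈ Icc 0 τ := fun x hx' => Ioo_subset_Icc_self (hmem x hx')
  have hdiff : ∀ x ∈ Ioo x₀ x₁, ∀ y ∈ Ioo x₀ x₁, x ≤ y → 0 ≤ y - x ∧ y - x ≤ h := by
    intro x hx' y hy hxy
    exact ⟨sub_nonneg.2 hxy, by linarith [hx'.1, hy.2]⟩
  -- approximation of the fractional integral of `z`
  have aJ : PolyApprox 1 x₀ x₁ (bwd α τ z) ((1 + CJ * S) * (h ^ 2 * Ψ)) := by
    have := PolyApprox.integrate (m := 0) (ε := h * w ^ (α - 2) + CJ * (h * (S * Ψ))) hx01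
      (fun x hx' => hz.hasDerivAt_bwd h0 h1 hgc hgm hg (hmem x hx'))
      (PolyApprox.of_osc hx01 fun x hx' y hy hxy => by
        obtain ⟨d0, d1⟩ := hdiff x hx' y hy hxy
        have hyτ : 0 < τ - y := by linarith [hy.2]
        have hx0 : 0 < x := hx.trans hx'.1
        have e1 := hz.abs_bwd_deriv_sub_le h0 h1 hgm hg hx0 hxy (by linarith)
        have e2 : |(τ - y) ^ (α - 1) - (τ - x) ^ (α - 1)| ≤ h * w ^ (α - 2) := by
          rw [abs_of_nonneg (sub_nonneg.2 (Real.rpow_le_rpow_of_nonpos hyτ (by linarith)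
            (by linarith)))]
          refine (rpow_sub_one_sub_le h0 hyτ (by linarith)).trans ?_
          have : (τ - y) ^ (α - 2) ≤ w ^ (α - 2) :=
            Real.rpow_le_rpow_of_nonpos hw (by linarith [hy.2]) (by linarith)
          rw [show τ - x - (τ - y) = y - x by ring]
          gcongr
        have e3 : x ^ (α - 1) ≤ x₀ ^ (α - 1) :=
          Real.rpow_le_rpow_of_nonpos hx hx'.1.le (by linarith)
        have e4 : (τ - y) ^ (α - 1) ≤ w ^ (α - 1) :=
          Real.rpow_le_rpow_of_nonpos hw (by linarith [hy.2]) (by linarith)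
        calc _ = |(bwd α τ g y - bwd α τ g x) - ((τ - y) ^ (α - 1) - (τ - x) ^ (α - 1))| := by
              ring_nf
          _ ≤ CJ * ((y - x) * (1 + x ^ (α - 1) + (τ - y) ^ (α - 1))) + h * w ^ (α - 2) :=
              (abs_sub _ _).trans (add_le_add e1 e2)
          _ ≤ CJ * (h * (S * Ψ)) + h * w ^ (α - 2) := by
              have : 1 + x ^ (α - 1) + (τ - y) ^ (α - 1) ≤ S * Ψ := by linarith
              have : 0 ≤ x ^ (α - 1) := by positivity
              have : 0 ≤ (τ - y) ^ (α - 1) := by positivity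
              gcongr
          _ = _ := by ring)
    refine this.mono le_rfl ?_
    have : h * w ^ (α - 2) ≤ h * Ψ := by
      gcongr; exact le_add_of_nonneg_left hxp2
    calc (h * w ^ (α - 2) + CJ * (h * (S * Ψ))) * h ≤ (h * Ψ + CJ * (h * (S * Ψ))) * h := by
          gcongr
      _ = _ := by ring
  have az : PolyApprox 1 x₀ x₁ z (G * S * (h ^ 2 * Ψ)) := by
    refine (hz.polyApprox_one h0 h1 hx.le hx01 hx1.le).mono le_rfl ?_
    have e1 : x₁ ^ α - x₀ ^ α ≤ h * x₀ ^ (α - 1) := rpow_sub_rpow_le_mul h1 hx hx01.le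
    have e2 : (τ - x₀) ^ α - w ^ α ≤ h * w ^ (α - 1) := by
      refine (rpow_sub_rpow_le_mul h1 hw (by linarith)).trans (le_of_eq ?_)
      rw [hhdef, hwdef]; ring
    calc _ ≤ G * (h + h * x₀ ^ (α - 1) + h * w ^ (α - 1)) * h := by gcongr
      _ = G * (h * (1 + x₀ ^ (α - 1) + w ^ (α - 1))) * h := by ring
      _ ≤ G * (h * (S * Ψ)) * h := by gcongr
      _ = _ := by ring
  have aA : PolyApprox 1 x₀ x₁ a (M₂ * (h ^ 2 * Ψ)) := by
    refine hA.mono le_rfl ?_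
    have : x₀ ^ (α - 2) ≤ Ψ := le_add_of_nonneg_right hwp2
    calc _ ≤ M₂ * Ψ * h ^ 2 := by gcongr
      _ = _ := by ring
  have aB : PolyApprox 1 x₀ x₁ b (M₂ * (h ^ 2 * Ψ)) := by
    refine hB.mono le_rfl ?_
    have : x₀ ^ (α - 2) ≤ Ψ := le_add_of_nonneg_right hwp2
    calc _ ≤ M₂ * Ψ * h ^ 2 := by gcongr
      _ = _ := by ring
  have oab : ∀ x ∈ Ioo x₀ x₁, ∀ y ∈ Ioo x₀ x₁, x ≤ y →
      M₁ * (y ^ α - x ^ α) ≤ M₁ * (h * x₀ ^ (α - 1)) := by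
    intro x hx' y hy hxy
    obtain ⟨d0, d1⟩ := hdiff x hx' y hy hxy
    have e3 : x ^ (α - 1) ≤ x₀ ^ (α - 1) :=
      Real.rpow_le_rpow_of_nonpos hx hx'.1.le (by linarith)
    have : 0 ≤ x ^ (α - 1) := Real.rpow_nonneg (hx.trans hx'.1).le _
    refine mul_le_mul_of_nonneg_left ((rpow_sub_rpow_le_mul h1 (hx.trans hx'.1) hxy).trans ?_) hM
    gcongr
  have oA : ∀ x ∈ Ioo x₀ x₁, ∀ y ∈ Ioo x₀ x₁, x ≤ y → |a y - a x| ≤ M₁ * (h * x₀ ^ (α - 1)) :=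
    fun x hx' y hy hxy => (hz.diff_a x y (hmem x hx').1.le hxy
      ((hmem' y hy).2.trans hz.le)).trans (oab x hx' y hy hxy)
  have oB : ∀ x ∈ Ioo x₀ x₁, ∀ y ∈ Ioo x₀ x₁, x ≤ y → |b y - b x| ≤ M₁ * (h * x₀ ^ (α - 1)) :=
    fun x hx' y hy hxy => (hz.diff_b x y (hmem x hx').1.le hxy
      ((hmem' y hy).2.trans hz.le)).trans (oab x hx' y hy hxy)
  have oz : ∀ x ∈ Ioo x₀ x₁, ∀ y ∈ Ioo x₀ x₁, x ≤ y → |z y - z x| ≤ D * h := by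
    intro x hx' y hy hxy
    refine (hz.lipschitz h0 h1 (hmem x hx').1.le hxy (hmem y hy).2.le).trans ?_
    have := (hdiff x hx' y hy hxy).2
    gcongr
  have oJ : ∀ x ∈ Ioo x₀ x₁, ∀ y ∈ Ioo x₀ x₁, x ≤ y →
      |bwd α τ z y - bwd α τ z x| ≤ (D * K + L / α) * (h * (1 + w ^ (α - 1))) := by
    intro x hx' y hy hxy
    obtain ⟨d0, d1⟩ := hdiff x hx' y hy hxy
    refine (hz.abs_bwd_sub_le h0 h1 (hmem x hx').1.le hxy (hmem y hy).2.le).trans ?_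
    have hyτ : 0 < τ - y := by linarith [hy.2]
    have e4 : (τ - y) ^ (α - 1) ≤ w ^ (α - 1) :=
      Real.rpow_le_rpow_of_nonpos hw (by linarith [hy.2]) (by linarith)
    have e2 : (τ - x) ^ α - (τ - y) ^ α ≤ h * w ^ (α - 1) := by
      refine (rpow_sub_rpow_le_mul h1 hyτ (by linarith)).trans ?_
      rw [show τ - x - (τ - y) = y - x by ring]
      gcongr
    have q : 0 ≤ D * K := by positivity
    have q' : 0 ≤ L / α := by positivity
    calc _ ≤ D * K * h + L / α * (h * w ^ (α - 1)) := by gcongr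
      _ ≤ D * K * (h * (1 + w ^ (α - 1))) + L / α * (h * (1 + w ^ (α - 1))) := by
          gcongr
          · exact le_mul_of_one_le_right hh.le (by linarith)
          · linarith
      _ = _ := by ring
  -- Both products in z' = a z + b (fractional integral of z) are nearly linear, and one integration
  -- makes z nearly quadratic.
  have m1 := PolyApprox.mul hx01 aA az oA oz (fun x _ => hz.bound_a x) (fun x _ => hz.bound x)
  have m2 := PolyApprox.mul hx01 aB aJ oB oJ (fun x _ => hz.bound_b x)
    (fun x hx' => hz.abs_bwd_le h0 h1 (hmem' x hx'))
  have m3 := PolyApprox.integrate hx01 (fun x hx' => hz.deriv x (hmem x hx')) (m1.add m2)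
  refine m3.mono le_rfl ?_
  have f1 : x₀ ^ (α - 1) ≤ T * Ψ := by
    calc x₀ ^ (α - 1) = x₀ * x₀ ^ (α - 2) := by
          rw [show α - 1 = 1 + (α - 2) by ring, Real.rpow_add hx, Real.rpow_one]
      _ ≤ T * Ψ := by gcongr; exact le_add_of_nonneg_right hwp2
  -- The oscillation of b is singular at 0 and that of the fractional integral at τ. The
  -- arithmetic-geometric mean inequality splits their product into the two separate weights, as
  -- (y^(α-1))² = y^α y^(α-2).
  have f2 : x₀ ^ (α - 1) * w ^ (α - 1) ≤ T ^ α * Ψ := by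
    have e : ∀ y, 0 < y → y ≤ T → (y ^ (α - 1)) ^ 2 ≤ T ^ α * y ^ (α - 2) := by
      intro y hy hyT
      rw [← Real.rpow_natCast, ← Real.rpow_mul hy.le,
        show (α - 1) * ((2 : ℕ) : ℝ) = α + (α - 2) by push_cast; ring, Real.rpow_add hy]
      gcongr
    have := e _ hx hxT
    have := e _ hw hwT
    have := two_mul_le_add_sq (x₀ ^ (α - 1)) (w ^ (α - 1))
    have := mul_nonneg hxp1 hwp1
    simp only [Ψ]
    nlinarith
  have q1 : 0 ≤ M₁ * (D * K + L / α) := by positivity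
  calc _ = (M₁ * D * h ^ 2 * x₀ ^ (α - 1) + μ * (G * S * (h ^ 2 * Ψ)) + L * (M₂ * (h ^ 2 * Ψ)) +
        (M₁ * (D * K + L / α) * h ^ 2 * (x₀ ^ (α - 1) + x₀ ^ (α - 1) * w ^ (α - 1)) +
          μ * ((1 + CJ * S) * (h ^ 2 * Ψ)) + L * K * (M₂ * (h ^ 2 * Ψ)))) * h := by ring
    _ ≤ (M₁ * D * h ^ 2 * (T * Ψ) + μ * (G * S * (h ^ 2 * Ψ)) + L * (M₂ * (h ^ 2 * Ψ)) +
        (M₁ * (D * K + L / α) * h ^ 2 * (T * Ψ + T ^ α * Ψ) +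
          μ * ((1 + CJ * S) * (h ^ 2 * Ψ)) + L * K * (M₂ * (h ^ 2 * Ψ)))) * h := by
        gcongr
    _ = _ := by ring

end
end DGVolterra

end

noncomputable section

namespace DGVolterra

open MeasureTheory Polynomial

/-! ### A discrete Gronwall inequality with a weakly singular weight -/

/-- Split at ε^(1/α): below it r^α ≤ ε, above it r^(α-1) is bounded. This replaces the weight r^α in
the Gronwall argument by a linear one plus an absorbable constant. -/
theorem exists_rpow_le_add_mul {α ε : ℝ} (h0 : 0 < α) (h1 : α < 1) (hε : 0 < ε) :
    ∃ C : ℝ, 0 ≤ C ∧ ∀ r, 0 ≤ r → r ^ α ≤ ε + C * r := by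
  set r₀ := ε ^ (1 / α)
  have hr₀ : 0 < r₀ := by positivity
  refine ⟨r₀ ^ (α - 1), by positivity, fun r hr => ?_⟩
  rcases le_total r r₀ with h | h
  · have : r ^ α ≤ ε := by
      calc r ^ α ≤ r₀ ^ α := by gcongr
        _ = ε := by
          rw [← Real.rpow_mul hε.le, one_div, inv_mul_cancel₀ h0.ne', Real.rpow_one]
    have : 0 ≤ r₀ ^ (α - 1) * r := by positivity
    linarith
  · have hr' : 0 < r := hr₀.trans_le h
    have : r ^ α = r ^ (α - 1) * r := by
      rw [Real.rpow_sub_one hr'.ne']; field_simp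
    have : r ^ (α - 1) ≤ r₀ ^ (α - 1) := Real.rpow_le_rpow_of_nonpos hr₀ h (by linarith)
    nlinarith

theorem monotone_nodes {N : ℕ} {t : ℕ → ℝ} (ht : ∀ n < N, t n < t (n + 1)) {i j : ℕ} (hij : i ≤ j)
    (hj : j ≤ N) : t i ≤ t j := by
  induction j, hij using Nat.le_induction with
  | base => exact le_rfl
  | succ j _ ih => exact (ih (by omega)).trans (ht j (by omega)).le

/-- Half of A absorbs the constant part of the weight (t_n - t_j)^α, and its linear part gives an
ordinary Gronwall inequality. Nondecreasing steps give t_n - t_j ≤ 2 (t_n - t_{j+1}) for j < n - 1,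
so the linear weight may start at t_{j+1}. The remaining term j = n - 1 is absorbed by the smallness
of the step. -/
theorem exists_discrete_gronwall {α A c : ℝ} (T : ℝ) (h0 : 0 < α) (h1 : α < 1) (hA : 0 < A)
    (hc : 0 ≤ c) : ∃ C : ℝ, 0 ≤ C ∧ ∀ (N : ℕ) (t E : ℕ → ℝ) (D : ℝ), 0 ≤ D → t 0 = 0 → t N ≤ T →
      (∀ n < N, t n < t (n + 1)) →
      (∀ n, n + 1 < N → t (n + 1) - t n ≤ t (n + 2) - t (n + 1)) →
      (∀ n < N, c * (t (n + 1) - t n) ^ α ≤ A / 2) → (∀ n < N, 0 ≤ E n) →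
      (∀ n ≤ N, A * ∑ j ∈ Finset.range n, E j ≤
        D + c * ∑ j ∈ Finset.range n, (t n - t j) ^ α * E j) →
      ∀ n ≤ N, ∑ j ∈ Finset.range n, E j ≤ C * D := by
  obtain ⟨Cε, hCε, hε⟩ := exists_rpow_le_add_mul h0 h1
    (show 0 < A / (2 * (c + 1)) by positivity)
  set B := 2 * c * Cε with hB
  have hB0 : 0 ≤ B := by positivity
  refine ⟨2 / A * Real.exp (2 * B / A * T), by positivity, ?_⟩
  intro N t E D hD ht0 htN ht hmono hk hE H
  have hterm : ∀ n ≤ N, ∀ j < n, c * (t n - t j) ^ α ≤ A / 2 + B * (t n - t (j + 1)) := by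
    intro n hn j hj
    rcases Nat.lt_or_ge (j + 1) n with h | h
    · have e1 := hmono j (by omega)
      have e2 := monotone_nodes ht (show j + 2 ≤ n by omega) hn
      have e3 := ht j (by omega)
      have e4 := hε (t n - t j) (by linarith [ht (j + 1) (by omega)])
      have e5 : c * (A / (2 * (c + 1))) ≤ A / 2 := by
        rw [mul_div_assoc', div_le_div_iff₀ (by positivity) (by positivity)]
        nlinarith
      have e6 : t n - t j ≤ 2 * (t n - t (j + 1)) := by linarith
      calc c * (t n - t j) ^ α ≤ c * (A / (2 * (c + 1)) + Cε * (2 * (t n - t (j + 1)))) := by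
            gcongr
            exact e4.trans (by gcongr)
        _ = c * (A / (2 * (c + 1))) + B * (t n - t (j + 1)) := by rw [hB]; ring
        _ ≤ _ := by gcongr
    · obtain rfl : n = j + 1 := by omega
      simpa using hk j (by omega)
  set y : ℕ → ℝ := fun n => ∑ j ∈ Finset.range n, E j
  set G : ℕ → ℝ := fun n => ∑ j ∈ Finset.range n, (t n - t (j + 1)) * E j
  have hy : ∀ n ≤ N, A / 2 * y n ≤ D + B * G n := by
    intro n hn
    have e1 : c * ∑ j ∈ Finset.range n, (t n - t j) ^ α * E j ≤ A / 2 * y n + B * G n := by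
      simp only [y, G, Finset.mul_sum, ← Finset.sum_add_distrib]
      refine Finset.sum_le_sum fun j hj => ?_
      have := mul_le_mul_of_nonneg_right (hterm n hn j (Finset.mem_range.1 hj))
        (hE j ((Finset.mem_range.1 hj).trans_le hn))
      linarith
    have e2 : A * y n ≤ D + c * ∑ j ∈ Finset.range n, (t n - t j) ^ α * E j := H n hn
    linarith
  -- The newest term of G has weight zero, so the recursion is explicit and the growth factor 1 + x
  -- can be bounded by exp x without a further step restriction.
  have hG : ∀ n, G (n + 1) = G n + (t (n + 1) - t n) * y n := by
    intro n
    simp only [G, y, Finset.sum_range_succ, Finset.mul_sum, sub_self, zero_mul, add_zero,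
      ← Finset.sum_add_distrib]
    exact Finset.sum_congr rfl fun j _ => by ring
  have hexp : ∀ n ≤ N, D + B * G n ≤ D * Real.exp (2 * B / A * t n) := by
    intro n
    induction n with
    | zero => intro _; simp [G, ht0]
    | succ n ih =>
      intro hn
      have e1 := ih (by omega)
      have e2 := hy n (by omega)
      have e3 := sub_pos.2 (ht n (by omega))
      have e4 : y n ≤ 2 / A * (D + B * G n) := by
        rw [div_mul_eq_mul_div, le_div_iff₀ hA]; linarith
      have e5 : 0 ≤ D + B * G n := le_trans (mul_nonneg (by positivity)
        (Finset.sum_nonneg fun j hj => hE j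
          ((Finset.mem_range.1 hj).trans (by omega)))) e2
      calc D + B * G (n + 1) = D + B * G n + B * (t (n + 1) - t n) * y n := by rw [hG]; ring
        _ ≤ D + B * G n + B * (t (n + 1) - t n) * (2 / A * (D + B * G n)) := by gcongr
        _ = (D + B * G n) * (2 * B / A * (t (n + 1) - t n) + 1) := by ring
        _ ≤ (D * Real.exp (2 * B / A * t n)) * Real.exp (2 * B / A * (t (n + 1) - t n)) := by
            gcongr
            exact Real.add_one_le_exp _
        _ = _ := by rw [mul_assoc, ← Real.exp_add]; congr 2; ring
  intro n hn
  have e1 := hy n hn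
  have e2 := hexp n hn
  have e3 : Real.exp (2 * B / A * t n) ≤ Real.exp (2 * B / A * T) := by
    gcongr
    exact (monotone_nodes ht hn le_rfl).trans htN
  have e4 : A / 2 * y n ≤ D * Real.exp (2 * B / A * T) :=
    e1.trans (e2.trans (by gcongr))
  calc y n = 2 / A * (A / 2 * y n) := by field_simp
    _ ≤ 2 / A * (D * Real.exp (2 * B / A * T)) := by gcongr
    _ = _ := by ring

/-! ### Piecewise polynomials -/

/-- The function equal to the polynomial `P n` on `(t n, t (n + 1)]` for `n < N`. -/
def piecewise (N : ℕ) (t : ℕ → ℝ) (P : ℕ → ℝ[X]) (s : ℝ) : ℝ :=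
  ∑ n ∈ Finset.range N, (Ioc (t n) (t (n + 1))).indicator (fun s => (P n).eval s) s

theorem piecewise_eq {N : ℕ} {t : ℕ → ℝ} (ht : ∀ n < N, t n < t (n + 1)) (P : ℕ → ℝ[X]) {n : ℕ}
    (hn : n < N) {s : ℝ} (hs : s ∈ Ioc (t n) (t (n + 1))) :
    piecewise N t P s = (P n).eval s := by
  rw [piecewise, Finset.sum_eq_single n]
  · rw [indicator_of_mem hs]
  · intro m hm hmn
    refine indicator_of_notMem (fun hs' => ?_) _
    rcases lt_or_gt_of_ne hmn with h | h
    · have := monotone_nodes ht (show m + 1 ≤ n from h) hn.le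
      linarith [hs.1, hs'.2]
    · have := monotone_nodes ht (show n + 1 ≤ m from h) (Finset.mem_range.1 hm).le
      linarith [hs.2, hs'.1]
  · exact fun h => absurd (Finset.mem_range.2 hn) h

theorem bddMeas_piecewise (N : ℕ) (t : ℕ → ℝ) (P : ℕ → ℝ[X]) : BddMeas (piecewise N t P) := by
  have key : ∀ n, BddMeas ((Ioc (t n) (t (n + 1))).indicator (fun s => (P n).eval s)) := by
    intro n
    refine ⟨(P n).continuous.measurable.indicator measurableSet_Ioc, ?_⟩
    obtain ⟨C, hC⟩ := isCompact_Icc.exists_bound_of_continuousOn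
      (s := Icc (t n) (t (n + 1))) (P n).continuous.continuousOn
    refine ⟨max C 0, fun s => ?_⟩
    by_cases h : s ∈ Ioc (t n) (t (n + 1))
    · rw [indicator_of_mem h]
      exact (hC s (Ioc_subset_Icc_self h)).trans (le_max_left _ _)
    · rw [indicator_of_notMem h, abs_zero]
      exact le_max_right _ _
  induction N with
  | zero =>
    have : piecewise 0 t P = fun _ => 0 := by ext s; simp [piecewise]
    rw [this]
    exact BddMeas.const 0
  | succ N ih =>
    have : piecewise (N + 1) t P = fun s => piecewise N t P s +
        (Ioc (t N) (t (N + 1))).indicator (fun s => (P N).eval s) s := by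
      ext s
      rw [piecewise, Finset.sum_range_succ]
      rfl
    rw [this]
    exact ih.add (key N)

theorem exists_mem_Ioc {N : ℕ} {t : ℕ → ℝ} {s : ℝ} (hs0 : t 0 < s) (hsN : s ≤ t N) :
    ∃ n < N, s ∈ Ioc (t n) (t (n + 1)) := by
  induction N with
  | zero => exact absurd hsN (not_le.2 hs0)
  | succ N ih =>
    rcases le_or_gt s (t N) with h | h
    · obtain ⟨n, hn, hs⟩ := ih h
      exact ⟨n, by omega, hs⟩
    · exact ⟨N, by omega, h, hsN⟩

end DGVolterra

end

noncomputable section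

namespace DGVolterra

open MeasureTheory Polynomial

/-! ### The error equation and stability -/

/-- The error at the left end of the interval with index `n`. -/
def nodeErr (t : ℕ → ℝ) (u : ℝ → ℝ) (P : ℕ → ℝ[X]) (n : ℕ) : ℝ :=
  if n = 0 then 0 else (P (n - 1)).eval (t n) - u (t n)

/-- The error `e` of a discontinuous Galerkin solution given by the polynomials `P`. -/
def err (N : ℕ) (t : ℕ → ℝ) (u : ℝ → ℝ) (P : ℕ → ℝ[X]) (s : ℝ) : ℝ := piecewise N t P s - u s

/-- The discontinuous Galerkin method in the form of an equation for the error, with coefficients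
and exact solution extended from `[0, T]` to the real line; `u'` is the derivative of `u`. -/
structure IsErrEq (α T μlow μ : ℝ) (p N : ℕ) (t : ℕ → ℝ) (a b u u' : ℝ → ℝ) (P : ℕ → ℝ[X]) :
    Prop where
  α_pos : 0 < α
  α_lt : α < 1
  T_pos : 0 < T
  μlow_pos : 0 < μlow
  p_pos : 1 ≤ p
  first : t 0 = 0
  last : t N = T
  lt : ∀ n < N, t n < t (n + 1)
  a_low : ∀ x, μlow ≤ a x
  bound_a : ∀ x, |a x| ≤ μ
  bound_b : ∀ x, |b x| ≤ μ
  cont_a : Continuous a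
  cont_b : Continuous b
  cont_u : Continuous u
  bdd_u : BddMeas u
  deriv_u : ∀ s ∈ Ioo 0 T, HasDerivAt u (u' s) s
  int_u' : IntervalIntegrable u' volume 0 T
  deg : ∀ n < N, (P n).natDegree ≤ p
  eqn : ∀ n < N, ∀ X : ℝ[X], X.natDegree ≤ p →
    ((P n).eval (t n) - u (t n) - nodeErr t u P n) * X.eval (t n) +
      ∫ s in t n..t (n + 1), ((derivative (P n)).eval s - u' s + a s * err N t u P s +
        fwd α T (fun r => b r * err N t u P r) s) * X.eval s = 0

variable {α T μlow μ : ℝ} {p N : ℕ} {t : ℕ → ℝ} {a b u u' : ℝ → ℝ} {P : ℕ → ℝ[X]}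

namespace IsErrEq

section
variable (H : IsErrEq α T μlow μ p N t a b u u' P)
include H

theorem μ_nonneg : 0 ≤ μ := (abs_nonneg _).trans (H.bound_a 0)

theorem bddMeas_a : BddMeas a := ⟨H.cont_a.measurable, μ, H.bound_a⟩

theorem bddMeas_b : BddMeas b := ⟨H.cont_b.measurable, μ, H.bound_b⟩

theorem bddMeas_err : BddMeas (err N t u P) := (bddMeas_piecewise N t P).sub H.bdd_u

theorem mono {i j : ℕ} (hij : i ≤ j) (hj : j ≤ N) : t i ≤ t j := monotone_nodes H.lt hij hj

theorem node_mem {i : ℕ} (hi : i ≤ N) : t i ∈ Icc 0 T :=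
  ⟨H.first ▸ H.mono (Nat.zero_le i) hi, H.last ▸ H.mono hi le_rfl⟩

theorem Icc_subset {n : ℕ} (hn : n < N) : Icc (t n) (t (n + 1)) ⊆ Icc 0 T :=
  Icc_subset_Icc (H.node_mem hn.le).1 (H.node_mem (i := n + 1) hn).2

theorem Ioo_subset {n : ℕ} (hn : n < N) : Ioo (t n) (t (n + 1)) ⊆ Ioo 0 T :=
  Ioo_subset_Ioo (H.node_mem hn.le).1 (H.node_mem (i := n + 1) hn).2

theorem intervalIntegrable_sub {f : ℝ → ℝ} (hf : IntervalIntegrable f volume 0 T) {n : ℕ}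
    (hn : n < N) : IntervalIntegrable f volume (t n) (t (n + 1)) :=
  hf.mono_set (by
    rw [uIcc_of_le H.T_pos.le, uIcc_of_le (H.lt n hn).le]
    exact H.Icc_subset hn)

theorem fwd_integrable {φ : ℝ → ℝ} (hφ : BddMeas φ) :
    IntervalIntegrable (fwd α T φ) volume 0 T := by
  simpa using fwd_mul_intervalIntegrable H.α_pos H.α_lt H.T_pos.le hφ (BddMeas.const 1)

theorem int_u'_sub {n : ℕ} (hn : n < N) : IntervalIntegrable u' volume (t n) (t (n + 1)) :=
  H.intervalIntegrable_sub H.int_u' hn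

theorem residual_integrable {φ : ℝ → ℝ} (hφ : BddMeas φ) :
    IntervalIntegrable (fun s => a s * φ s + fwd α T (fun r => b r * φ r) s) volume 0 T :=
  ((H.bddMeas_a.mul hφ).intervalIntegrable 0 T).add (H.fwd_integrable (H.bddMeas_b.mul hφ))

/-- Integration by parts for the derivative of the error. -/
theorem integral_deriv_mul {n : ℕ} (hn : n < N) (Q : ℝ[X]) {v v' : ℝ → ℝ} (hv : Continuous v)
    (hv' : ∀ s ∈ Ioo (t n) (t (n + 1)), HasDerivAt v (v' s) s)
    (hi : IntervalIntegrable v' volume (t n) (t (n + 1))) :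
    ∫ s in t n..t (n + 1), ((derivative Q).eval s - u' s) * v s =
      (Q.eval (t (n + 1)) - u (t (n + 1))) * v (t (n + 1)) -
      (Q.eval (t n) - u (t n)) * v (t n) -
      ∫ s in t n..t (n + 1), (Q.eval s - u s) * v' s := by
  have hle := (H.lt n hn).le
  have hcu := H.cont_u
  have key := intervalIntegral.integral_mul_deriv_eq_deriv_mul_of_hasDeriv_right
    (a := t n) (b := t (n + 1)) (u := fun s => Q.eval s - u s) (v := v)
    (u' := fun s => (derivative Q).eval s - u' s) (v' := v')
    (by fun_prop) hv.continuousOn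
    (fun s hs => by
      rw [min_eq_left hle, max_eq_right hle] at hs
      exact ((Q.hasDerivAt s).sub (H.deriv_u s (H.Ioo_subset hn hs))).hasDerivWithinAt)
    (fun s hs => by
      rw [min_eq_left hle, max_eq_right hle] at hs
      exact (hv' s hs).hasDerivWithinAt)
    ((Q.derivative.continuous.intervalIntegrable _ _).sub (H.int_u'_sub hn)) hi
  linarith

/-- The equation for the difference between the discrete solution and the projection of `u`. -/
theorem eqn_sub_projection {Q : ℕ → ℝ[X]} {n : ℕ} (hn : n < N)
    (hQ1 : ∀ n < N, (Q n).eval (t (n + 1)) = u (t (n + 1)))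
    (hQo : ∀ q : ℝ[X], q.natDegree < p →
      ∫ s in t n..t (n + 1), (u s - (Q n).eval s) * q.eval s = 0)
    (X : ℝ[X]) (hX : X.natDegree ≤ p) :
    ((P n - Q n).eval (t n) - nodeErr t u P n) * X.eval (t n) +
      (∫ s in t n..t (n + 1), (derivative (P n - Q n)).eval s * X.eval s) +
      ∫ s in t n..t (n + 1), (a s * err N t u P s +
        fwd α T (fun r => b r * err N t u P r) s) * X.eval s = 0 := by
  have h1 := H.integral_deriv_mul hn (Q n) X.continuous (fun s _ => X.hasDerivAt s)
    (X.derivative.continuous.intervalIntegrable _ _)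
  -- X' has degree below p because p ≥ 1. Together with the match at t_{n+1}, only the boundary term
  -- at t_n is left of Q' - u', and it combines with the jump.
  have h2 : ∫ s in t n..t (n + 1), ((Q n).eval s - u s) * (derivative X).eval s = 0 := by
    have := hQo (derivative X) (lt_of_le_of_lt (natDegree_derivative_le X) (by
      have := H.p_pos; omega))
    rw [← neg_eq_zero, ← intervalIntegral.integral_neg, ← this]
    congr 1; ext s; ring
  rw [h2, hQ1 n hn, sub_self, zero_mul] at h1
  have h3 := H.eqn n hn X hX
  have i1 : IntervalIntegrable (fun s => ((derivative (Q n)).eval s - u' s) * X.eval s) volume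
      (t n) (t (n + 1)) :=
    (((Q n).derivative.continuous.intervalIntegrable _ _).sub
      (H.int_u'_sub hn)).mul_continuousOn X.continuous.continuousOn
  have i2 : IntervalIntegrable (fun s => (derivative (P n - Q n)).eval s * X.eval s) volume
      (t n) (t (n + 1)) :=
    ((P n - Q n).derivative.continuous.mul X.continuous).intervalIntegrable _ _
  have i3 : IntervalIntegrable (fun s => (a s * err N t u P s +
        fwd α T (fun r => b r * err N t u P r) s) * X.eval s) volume (t n) (t (n + 1)) :=
    (H.intervalIntegrable_sub (H.residual_integrable H.bddMeas_err) hn).mul_continuousOn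
      X.continuous.continuousOn
  have h4 : ∫ s in t n..t (n + 1), ((derivative (P n)).eval s - u' s + a s * err N t u P s +
        fwd α T (fun r => b r * err N t u P r) s) * X.eval s =
      (∫ s in t n..t (n + 1), ((derivative (Q n)).eval s - u' s) * X.eval s) +
      (∫ s in t n..t (n + 1), (derivative (P n - Q n)).eval s * X.eval s) +
      ∫ s in t n..t (n + 1), (a s * err N t u P s +
        fwd α T (fun r => b r * err N t u P r) s) * X.eval s := by
    rw [← intervalIntegral.integral_add i1 i2, ← intervalIntegral.integral_add (i1.add i2) i3]
    congr 1; ext s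
    rw [derivative_sub, eval_sub]
    ring
  rw [h4, h1] at h3
  rw [eval_sub]
  linarith

/-- The local energy inequality for `θ = P n - Q n`. -/
theorem local_energy {Q : ℕ → ℝ[X]} {n : ℕ} (hn : n < N) {ε : ℝ}
    (hQd : ∀ n < N, (Q n).natDegree ≤ p)
    (hQ1 : ∀ n < N, (Q n).eval (t (n + 1)) = u (t (n + 1)))
    (hQo : ∀ n < N, ∀ q : ℝ[X], q.natDegree < p →
      ∫ s in t n..t (n + 1), (u s - (Q n).eval s) * q.eval s = 0)
    (hQb : ∀ n < N, ∀ s ∈ Icc (t n) (t (n + 1)), |u s - (Q n).eval s| ≤ ε) :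
    nodeErr t u P (n + 1) ^ 2 / 2 - nodeErr t u P n ^ 2 / 2 +
      (∫ s in t n..t (n + 1), μlow * piecewise N t (fun n => P n - Q n) s ^ 2) ≤
    (∫ s in t n..t (n + 1), (fwd α T (fun r => μ * |piecewise N t (fun n => P n - Q n) r|) s *
        |piecewise N t (fun n => P n - Q n) s| +
      μ * (1 + T ^ α / α) * ε * |piecewise N t (fun n => P n - Q n) s|)) := by
  have h0 := H.α_pos
  have h1 := H.α_lt
  have hTp := H.T_pos
  have hμ := H.μ_nonneg
  have hε : 0 ≤ ε := (abs_nonneg _).trans (hQb n hn (t n) ⟨le_rfl, (H.lt n hn).le⟩)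
  set θ := piecewise N t (fun n => P n - Q n) with hθdef
  have hθ : BddMeas θ := bddMeas_piecewise _ _ _
  set e := err N t u P with hedef
  have he : BddMeas e := H.bddMeas_err
  have hθe : ∀ n < N, ∀ s ∈ Ioc (t n) (t (n + 1)), θ s = (P n - Q n).eval s := fun n hn s hs =>
    piecewise_eq H.lt _ hn hs
  have heθ : ∀ s ∈ Ioc 0 T, |e s - θ s| ≤ ε := by
    intro s hs
    obtain ⟨m, hm, hsm⟩ := exists_mem_Ioc (N := N) (t := t) (H.first ▸ hs.1) (H.last ▸ hs.2)
    rw [hθe m hm s hsm, hedef, err, piecewise_eq H.lt P hm hsm, eval_sub,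
      show (P m).eval s - u s - ((P m).eval s - (Q m).eval s) = -(u s - (Q m).eval s) by ring,
      abs_neg]
    exact hQb m hm s (Ioc_subset_Icc_self hsm)
  have hle := (H.lt n hn).le
  have hdeg : (P n - Q n).natDegree ≤ p :=
    (natDegree_sub_le _ _).trans (max_le (H.deg n hn) (hQd n hn))
  -- The energy test: the test polynomial is θ itself.
  have hmain := H.eqn_sub_projection hn hQ1 (hQo n hn) (P n - Q n) hdeg
  set X := P n - Q n with hX
  have hsq : ∫ s in t n..t (n + 1), (derivative X).eval s * X.eval s =
      X.eval (t (n + 1)) ^ 2 / 2 - X.eval (t n) ^ 2 / 2 := by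
    refine intervalIntegral.integral_eq_sub_of_hasDerivAt (f := fun s => X.eval s ^ 2 / 2)
      (fun s _ => ?_) ((X.derivative.continuous.mul X.continuous).intervalIntegrable _ _)
    have := ((X.hasDerivAt s).pow 2).div_const 2
    have e : (derivative X).eval s * X.eval s =
        ((2 : ℕ) : ℝ) * X.eval s ^ (2 - 1) * (derivative X).eval s / 2 := by
      norm_num; ring
    rw [e]
    exact this
  have hnext : nodeErr t u P (n + 1) = X.eval (t (n + 1)) := by
    rw [nodeErr, if_neg (Nat.succ_ne_zero n), Nat.add_sub_cancel, hX, eval_sub, hQ1 n hn]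
  rw [hsq] at hmain
  rw [hnext]
  have hpt : ∀ s ∈ Ioc (t n) (t (n + 1)), μlow * θ s ^ 2 -
      (fwd α T (fun r => μ * |θ r|) s * |θ s| + μ * (1 + T ^ α / α) * ε * |θ s|) ≤
      (a s * e s + fwd α T (fun r => b r * e r) s) * X.eval s := by
    intro s hs
    have hs0 : s ∈ Ioc 0 T := ⟨(H.node_mem hn.le).1.trans_lt hs.1,
      hs.2.trans (H.node_mem (i := n + 1) hn).2⟩
    rw [← hθe n hn s hs]
    have f1 : fwd α T (fun r => b r * e r) s =
        fwd α T (fun r => b r * θ r) s + fwd α T (fun r => b r * (e r - θ r)) s := by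
      rw [← fwd_add h0 h1 (H.bddMeas_b.mul hθ) (H.bddMeas_b.mul (he.sub hθ))]
      congr 1; ext r; ring
    have f2 : |fwd α T (fun r => b r * θ r) s| ≤ fwd α T (fun r => μ * |θ r|) s := by
      refine (abs_fwd_le _ hTp.le s).trans (fwd_mono h0 h1 (H.bddMeas_b.mul hθ).abs
        ((BddMeas.const μ).mul hθ.abs) hTp.le (fun r _ => ?_) s)
      rw [abs_mul]
      exact mul_le_mul_of_nonneg_right (H.bound_b r) (abs_nonneg _)
    have f3 : |fwd α T (fun r => b r * (e r - θ r)) s| ≤ μ * ε * (T ^ α / α) := by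
      -- the value at the origin is irrelevant
      have hcong : fwd α T (fun r => b r * (e r - θ r)) s =
          fwd α T ((Ioc 0 T).indicator fun r => b r * (e r - θ r)) s := by
        refine intervalIntegral.integral_congr_ae (Filter.Eventually.of_forall fun r hr => ?_)
        rw [uIoc_of_le hTp.le] at hr
        rw [indicator_of_mem hr]
      rw [hcong]
      refine (abs_fwd_le_of_bound h0 h1 ((H.bddMeas_b.mul (he.sub hθ)).indicator measurableSet_Ioc)
        (B := μ * ε) (fun r _ => ?_) hs0.1.le hs0.2).trans ?_
      · by_cases hr : r ∈ Ioc 0 T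
        · rw [indicator_of_mem hr, abs_mul]
          exact mul_le_mul (H.bound_b r) (heθ r hr) (abs_nonneg _) hμ
        · rw [indicator_of_notMem hr, abs_zero]
          positivity
      · have := hs0.1.le; have := hs0.2
        gcongr
    have f4 : |a s * (e s - θ s)| ≤ μ * ε := by
      rw [abs_mul]
      exact mul_le_mul (H.bound_a s) (heθ s hs0) (abs_nonneg _) hμ
    have f5 : |fwd α T (fun r => b r * θ r) s * θ s +
        (a s * (e s - θ s) + fwd α T (fun r => b r * (e r - θ r)) s) * θ s| ≤
        fwd α T (fun r => μ * |θ r|) s * |θ s| + μ * (1 + T ^ α / α) * ε * |θ s| := by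
      calc _ ≤ |fwd α T (fun r => b r * θ r) s| * |θ s| + (|a s * (e s - θ s)| +
            |fwd α T (fun r => b r * (e r - θ r)) s|) * |θ s| := by
            refine (abs_add_le _ _).trans ?_
            rw [abs_mul, abs_mul]
            gcongr
            exact abs_add_le _ _
        _ ≤ fwd α T (fun r => μ * |θ r|) s * |θ s| + (μ * ε + μ * ε * (T ^ α / α)) * |θ s| := by
            gcongr
        _ = _ := by ring
    have f6 : μlow * θ s ^ 2 ≤ a s * θ s ^ 2 :=
      mul_le_mul_of_nonneg_right (H.a_low s) (sq_nonneg _)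
    have f7 := (abs_le.1 f5).1
    rw [f1]
    linarith
  have i1 : IntervalIntegrable (fun s => μlow * θ s ^ 2) volume (t n) (t (n + 1)) := by
    have := ((BddMeas.const μlow).mul (hθ.mul hθ)).intervalIntegrable (t n) (t (n + 1))
    simpa only [← sq] using this
  have i2 : IntervalIntegrable (fun s => fwd α T (fun r => μ * |θ r|) s * |θ s| +
      μ * (1 + T ^ α / α) * ε * |θ s|) volume (t n) (t (n + 1)) := by
    refine IntervalIntegrable.add (H.intervalIntegrable_sub ?_ hn)
      (((BddMeas.const (μ * (1 + T ^ α / α) * ε)).mul hθ.abs).intervalIntegrable _ _)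
    exact fwd_mul_intervalIntegrable h0 h1 hTp.le ((BddMeas.const μ).mul hθ.abs) hθ.abs
  have i3 : IntervalIntegrable (fun s => (a s * e s + fwd α T (fun r => b r * e r) s) * X.eval s)
      volume (t n) (t (n + 1)) :=
    (H.intervalIntegrable_sub (H.residual_integrable he) hn).mul_continuousOn
      X.continuous.continuousOn
  have hint := intervalIntegral.integral_mono_on_of_le_Ioo hle (i1.sub i2) i3
    (fun s hs => hpt s ⟨hs.1, hs.2.le⟩)
  rw [intervalIntegral.integral_sub i1 i2] at hint
  -- The jump term completes the square (θ(t_n⁺) - θ(t_n⁻))² / 2, which is dropped; θ(t_n⁻) is the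
  -- nodal error since Q matches u at right endpoints.
  nlinarith [sq_nonneg (X.eval (t n) - nodeErr t u P n)]

end
end IsErrEq
end DGVolterra

end

/-! ### The global energy estimate and stability in the mean -/

noncomputable section

namespace DGVolterra

open MeasureTheory Polynomial

/-- The quadratic form of the Volterra operator, bounded with a weight that is regular in time. -/
theorem integral_fwd_abs_mul_le {α τ T μ μlow : ℝ} (h0 : 0 < α) (h1 : α < 1) (hτ : 0 ≤ τ)
    (hτT : τ ≤ T) (hT : 0 < T) (hμ : 0 < μ) (hμl : 0 < μlow) {θ : ℝ → ℝ} (hθ : BddMeas θ) :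
    ∫ s in (0 : ℝ)..τ, fwd α τ (fun r => μ * |θ r|) s * |θ s| ≤
      (∫ s in (0 : ℝ)..τ, μlow / 2 * θ s ^ 2) +
      μ ^ 2 * T ^ α / (2 * α ^ 2 * μlow) * ∫ s in (0 : ℝ)..τ, θ s ^ 2 * (τ - s) ^ α := by
  have hsq : BddMeas (fun s => θ s ^ 2) := by simpa only [sq] using hθ.mul hθ
  set K := T ^ α / α with hK
  have hK0 : 0 < K := by positivity
  -- The Young parameter for which the term in θ(s)² is exactly half of the coercivity.
  set d := μlow / (μ * K) with hd
  have hd0 : 0 < d := by positivity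
  have hpt : ∀ s ∈ Icc 0 τ, fwd α τ (fun r => μ * |θ r|) s * |θ s| ≤
      μlow / 2 * θ s ^ 2 + μ / (2 * d) * (fwd α τ (fun r => θ r ^ 2) s * 1) := by
    intro s hs
    have e1 : fwd α τ (fun r => μ * |θ r|) s * |θ s| =
        fwd α τ (fun r => |θ s| * (μ * |θ r|)) s := by
      rw [fwd_const_mul (fun r => μ * |θ r|), mul_comm]
    have e2 : fwd α τ (fun r => μ * d / 2 * θ s ^ 2 * 1 + μ / (2 * d) * θ r ^ 2) s =
        μ * d / 2 * θ s ^ 2 * (s ^ α / α) + μ / (2 * d) * fwd α τ (fun r => θ r ^ 2) s := by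
      rw [fwd_add h0 h1 (BddMeas.const _) ((BddMeas.const _).mul hsq), fwd_const_mul,
        fwd_const_mul, fwd_one h0 h1 hs.1 hs.2]
    have e3 : fwd α τ (fun r => |θ s| * (μ * |θ r|)) s ≤
        fwd α τ (fun r => μ * d / 2 * θ s ^ 2 * 1 + μ / (2 * d) * θ r ^ 2) s := by
      refine fwd_mono h0 h1 ((BddMeas.const _).mul ((BddMeas.const _).mul hθ.abs))
        ((BddMeas.const _).add ((BddMeas.const _).mul hsq)) hτ (fun r _ => ?_) s
      have : 0 ≤ μ / (2 * d) * (d * |θ s| - |θ r|) ^ 2 := by positivity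
      have e : μ / (2 * d) * (d * |θ s| - |θ r|) ^ 2 =
          μ * d / 2 * |θ s| ^ 2 * 1 + μ / (2 * d) * |θ r| ^ 2 - |θ s| * (μ * |θ r|) := by
        field_simp
        ring
      rw [e, sq_abs, sq_abs] at this
      linarith
    have e4 : s ^ α / α ≤ K := by
      have := hs.1; have := hs.2.trans hτT
      rw [hK]; gcongr
    have e5 : μ * d / 2 * K = μlow / 2 := by rw [hd]; field_simp
    calc _ ≤ μ * d / 2 * θ s ^ 2 * (s ^ α / α) + μ / (2 * d) * fwd α τ (fun r => θ r ^ 2) s := by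
          rw [e1, ← e2]; exact e3
      _ ≤ μ * d / 2 * θ s ^ 2 * K + μ / (2 * d) * fwd α τ (fun r => θ r ^ 2) s := by gcongr
      _ = _ := by rw [← e5]; ring
  have i0 := fwd_mul_intervalIntegrable h0 h1 hτ ((BddMeas.const μ).mul hθ.abs) hθ.abs
  have i1 := ((BddMeas.const (μlow / 2)).mul hsq).intervalIntegrable 0 τ
  have i2 := fwd_mul_intervalIntegrable h0 h1 hτ hsq (BddMeas.const 1)
  -- Adjointness moves the fractional integral from θ² onto the constant 1, where it equals (τ -
  -- s)^α / α: the singular kernel becomes a bounded weight.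
  have hint := intervalIntegral.integral_mono_on hτ i0 (i1.add (i2.const_mul _)) hpt
  rw [intervalIntegral.integral_add i1 (i2.const_mul _), intervalIntegral.integral_const_mul (μ / (2 * d)),
    integral_fwd_mul h0 h1 hτ hsq (BddMeas.const 1)] at hint
  have e6 : ∫ s in (0 : ℝ)..τ, θ s ^ 2 * bwd α τ (fun _ => 1) s =
      1 / α * ∫ s in (0 : ℝ)..τ, θ s ^ 2 * (τ - s) ^ α := by
    rw [← intervalIntegral.integral_const_mul]
    refine intervalIntegral.integral_congr fun s hs => ?_
    rw [uIcc_of_le hτ] at hs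
    rw [bwd_one h0 h1 hs.1 hs.2]
    ring
  rw [e6] at hint
  refine hint.trans (le_of_eq ?_)
  rw [intervalIntegral.integral_const_mul, hd, hK]
  field_simp

namespace IsErrEq
variable {α T μlow μ : ℝ} {p N : ℕ} {t : ℕ → ℝ} {a b u u' : ℝ → ℝ} {P : ℕ → ℝ[X]}
variable (H : IsErrEq α T μlow μ p N t a b u u' P)
include H

theorem sum_integral {f : ℝ → ℝ} (hf : IntervalIntegrable f volume 0 T) {n : ℕ} (hn : n ≤ N) :
    ∑ j ∈ Finset.range n, ∫ s in t j..t (j + 1), f s = ∫ s in (0 : ℝ)..t n, f s := by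
  have := intervalIntegral.sum_integral_adjacent_intervals (a := t) (n := n) (f := f)
    (μ := volume) fun k hk => H.intervalIntegrable_sub hf (by omega)
  rw [this, H.first]

theorem μ_pos : 0 < μ := H.μlow_pos.trans_le ((H.a_low 0).trans ((le_abs_self _).trans (H.bound_a 0)))

/-- The nodal squares telescope from zero initial error. Of the coercivity constant, one half pays
for the Volterra form, one quarter for the projection error by Young's inequality, and one quarter
remains. -/
theorem global_energy {Q : ℕ → ℝ[X]} {ε : ℝ}
    (hQd : ∀ n < N, (Q n).natDegree ≤ p)
    (hQ1 : ∀ n < N, (Q n).eval (t (n + 1)) = u (t (n + 1)))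
    (hQo : ∀ n < N, ∀ q : ℝ[X], q.natDegree < p →
      ∫ s in t n..t (n + 1), (u s - (Q n).eval s) * q.eval s = 0)
    (hQb : ∀ n < N, ∀ s ∈ Icc (t n) (t (n + 1)), |u s - (Q n).eval s| ≤ ε) {n : ℕ} (hn : n ≤ N) :
    μlow / 4 * (∑ j ∈ Finset.range n,
      ∫ s in t j..t (j + 1), piecewise N t (fun n => P n - Q n) s ^ 2) ≤
    (μ * (1 + T ^ α / α) * ε) ^ 2 / μlow * T + μ ^ 2 * T ^ α / (2 * α ^ 2 * μlow) *
      ∑ j ∈ Finset.range n, (t n - t j) ^ α *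
        ∫ s in t j..t (j + 1), piecewise N t (fun n => P n - Q n) s ^ 2 := by
  have h0 := H.α_pos
  have h1 := H.α_lt
  have hTp := H.T_pos
  have hμl := H.μlow_pos
  have hμ := H.μ_pos
  have hloc := fun j (hj : j < N) => H.local_energy hj hQd hQ1 hQo hQb
  set θ := piecewise N t (fun n => P n - Q n) with hθdef
  have hθ : BddMeas θ := bddMeas_piecewise _ _ _
  have hsq : BddMeas (fun s => θ s ^ 2) := by simpa only [sq] using hθ.mul hθ
  set δ := μ * (1 + T ^ α / α) * ε
  obtain ⟨hτ, hτT⟩ := H.node_mem hn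
  have i1 := ((BddMeas.const μlow).mul hsq).intervalIntegrable 0 T
  have i2 := fwd_mul_intervalIntegrable h0 h1 hTp.le ((BddMeas.const μ).mul hθ.abs) hθ.abs
  have i3 := ((BddMeas.const δ).mul hθ.abs).intervalIntegrable 0 T
  have hsub : ∀ {f : ℝ → ℝ}, IntervalIntegrable f volume 0 T →
      IntervalIntegrable f volume 0 (t n) := fun hf => hf.mono_set (by
    rw [uIcc_of_le hτ, uIcc_of_le hTp.le]; exact Icc_subset_Icc_right hτT)
  have hsum := Finset.sum_le_sum fun j hj => hloc j ((Finset.mem_range.1 hj).trans_le hn)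
  rw [Finset.sum_add_distrib, H.sum_integral i1 hn, H.sum_integral (i2.add i3) hn,
    Finset.sum_range_sub (fun j => nodeErr t u P j ^ 2 / 2) n,
    intervalIntegral.integral_add (hsub i2) (hsub i3)] at hsum
  have hz : nodeErr t u P 0 = 0 := by simp [nodeErr]
  rw [hz] at hsum
  have e1 : ∫ s in (0 : ℝ)..t n, fwd α T (fun r => μ * |θ r|) s * |θ s| =
      ∫ s in (0 : ℝ)..t n, fwd α (t n) (fun r => μ * |θ r|) s * |θ s| := by
    refine intervalIntegral.integral_congr fun s hs => ?_
    rw [uIcc_of_le hτ] at hs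
    rw [fwd_eq_of_le h0 h1 ((BddMeas.const μ).mul hθ.abs) (hs.2.trans hτT) hs.2]
  have e2 := integral_fwd_abs_mul_le h0 h1 hτ hτT hTp hμ hμl hθ
  have e3 : ∫ s in (0 : ℝ)..t n, δ * |θ s| ≤
      (∫ s in (0 : ℝ)..t n, μlow / 4 * θ s ^ 2) + δ ^ 2 / μlow * T := by
    have i4 := ((BddMeas.const (μlow / 4)).mul hsq).intervalIntegrable 0 (t n)
    have := intervalIntegral.integral_mono_on hτ (hsub i3)
      (i4.add (((BddMeas.const (δ ^ 2 / μlow))).intervalIntegrable 0 (t n))) fun s _ => by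
        have h : 0 ≤ (μlow / 2 * |θ s| - δ) ^ 2 / μlow := by positivity
        have e : (μlow / 2 * |θ s| - δ) ^ 2 / μlow =
            μlow / 4 * |θ s| ^ 2 + δ ^ 2 / μlow - δ * |θ s| := by field_simp; ring
        rw [e, sq_abs] at h
        linarith
    rw [intervalIntegral.integral_add i4 ((BddMeas.const _).intervalIntegrable _ _),
      intervalIntegral.integral_const, sub_zero, smul_eq_mul, mul_comm (t n)] at this
    refine this.trans ?_
    gcongr
  have isq := hsq.intervalIntegrable 0 T
  have e4 : ∫ s in (0 : ℝ)..t n, θ s ^ 2 * (t n - s) ^ α ≤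
      ∑ j ∈ Finset.range n, (t n - t j) ^ α * ∫ s in t j..t (j + 1), θ s ^ 2 := by
    have i5 : IntervalIntegrable (fun s => θ s ^ 2 * (t n - s) ^ α) volume 0 T :=
      isq.mul_continuousOn (Continuous.continuousOn
        (Continuous.rpow_const (by fun_prop) fun _ => Or.inr h0.le))
    rw [← H.sum_integral i5 hn]
    refine Finset.sum_le_sum fun j hj => ?_
    have hjn := Finset.mem_range.1 hj
    have hjN : j < N := hjn.trans_le hn
    rw [← intervalIntegral.integral_const_mul]
    refine intervalIntegral.integral_mono_on (H.lt j hjN).le (H.intervalIntegrable_sub i5 hjN)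
      ((H.intervalIntegrable_sub isq hjN).const_mul _) fun s hs => ?_
    have := H.mono (show j + 1 ≤ n from hjn) hn
    rw [mul_comm]
    have h2 : 0 ≤ t n - s := by linarith [hs.2]
    have := hs.1
    gcongr
  have hc : 0 ≤ μ ^ 2 * T ^ α / (2 * α ^ 2 * μlow) := by positivity
  have e5 := mul_le_mul_of_nonneg_left e4 hc
  rw [H.sum_integral isq hn]
  rw [e1] at hsum
  simp only [intervalIntegral.integral_const_mul] at hsum e2 e3
  have := sq_nonneg (nodeErr t u P n)
  simp only [intervalIntegral.integral_const_mul] at *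
  linarith

omit H in
/-- Stability: the mean error is bounded by the error of the projection of `u`. -/
theorem exists_integral_err_le {α T μlow μ : ℝ} (h0 : 0 < α) (h1 : α < 1) (hT : 0 < T)
    (hμl : 0 < μlow) :
    ∃ C : ℝ, 0 ≤ C ∧ ∀ (p N : ℕ) (t : ℕ → ℝ) (a b u u' : ℝ → ℝ) (P Q : ℕ → ℝ[X]) (ε : ℝ),
      IsErrEq α T μlow μ p N t a b u u' P → 0 < ε →
      (∀ n, n + 1 < N → t (n + 1) - t n ≤ t (n + 2) - t (n + 1)) →
      (∀ n < N, 4 * T ^ α * (μ / (α * μlow)) ^ 2 * (t (n + 1) - t n) ^ α ≤ 1) →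
      (∀ n < N, (Q n).natDegree ≤ p) →
      (∀ n < N, (Q n).eval (t (n + 1)) = u (t (n + 1))) →
      (∀ n < N, ∀ q : ℝ[X], q.natDegree < p →
        ∫ s in t n..t (n + 1), (u s - (Q n).eval s) * q.eval s = 0) →
      (∀ n < N, ∀ s ∈ Icc (t n) (t (n + 1)), |u s - (Q n).eval s| ≤ ε) →
      ∫ s in (0 : ℝ)..T, |err N t u P s| ≤ C * ε := by
  obtain ⟨C, hC, hgr⟩ := exists_discrete_gronwall T h0 h1 (show 0 < μlow / 4 by positivity)
    (show 0 ≤ μ ^ 2 * T ^ α / (2 * α ^ 2 * μlow) by positivity)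
  set Γ := (μ * (1 + T ^ α / α)) ^ 2 / μlow * T with hΓ
  have hΓ0 : 0 ≤ Γ := by positivity
  refine ⟨C * Γ + 2 * T, by positivity, ?_⟩
  intro p N t a b u u' P Q ε H hε hmono hsmall hQd hQ1 hQo hQb
  set θ := piecewise N t (fun n => P n - Q n) with hθdef
  have hθ : BddMeas θ := bddMeas_piecewise _ _ _
  have hsq : BddMeas (fun s => θ s ^ 2) := by simpa only [sq] using hθ.mul hθ
  have hE := hgr N t (fun j => ∫ s in t j..t (j + 1), θ s ^ 2) (Γ * ε ^ 2) (by positivity)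
    H.first H.last.le H.lt hmono (fun n hn => ?_) (fun n hn => ?_) (fun n hn => ?_) N le_rfl
  · rw [H.sum_integral (hsq.intervalIntegrable 0 T) le_rfl, H.last] at hE
    -- Since ∫ θ² is O(ε²), the bound |θ| ≤ θ² / ε + ε yields an L¹ estimate of order ε without the
    -- Cauchy-Schwarz inequality.
    have hpt : ∀ s ∈ Ioo 0 T, |err N t u P s| ≤ θ s ^ 2 / ε + 2 * ε := by
      intro s hs
      obtain ⟨m, hm, hsm⟩ := exists_mem_Ioc (N := N) (t := t) (H.first ▸ hs.1) (H.last ▸ hs.2.le)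
      have e1 : θ s = (P m).eval s - (Q m).eval s := by
        rw [← eval_sub]; exact piecewise_eq H.lt _ hm hsm
      have e2 : err N t u P s = θ s - (u s - (Q m).eval s) := by
        rw [e1, err, piecewise_eq H.lt P hm hsm]; ring
      have e3 : |θ s| ≤ θ s ^ 2 / ε + ε := by
        have h : 0 ≤ (|θ s| - ε) ^ 2 / ε := by positivity
        have e : (|θ s| - ε) ^ 2 / ε = |θ s| ^ 2 / ε + ε - 2 * |θ s| := by field_simp; ring
        rw [e, sq_abs] at h
        linarith [abs_nonneg (θ s)]
      rw [e2]
      have := hQb m hm s (Ioc_subset_Icc_self hsm)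
      have := abs_sub (θ s) (u s - (Q m).eval s)
      linarith
    have i1 := (hsq.mul (BddMeas.const ε⁻¹)).intervalIntegrable 0 T
    simp only [← div_eq_mul_inv] at i1
    have hint := intervalIntegral.integral_mono_on_of_le_Ioo hT.le
      (H.bddMeas_err.abs.intervalIntegrable 0 T)
      (i1.add ((BddMeas.const (2 * ε)).intervalIntegrable 0 T)) hpt
    rw [intervalIntegral.integral_add i1 ((BddMeas.const _).intervalIntegrable _ _),
      intervalIntegral.integral_const, intervalIntegral.integral_div, sub_zero, smul_eq_mul] at hint
    have e4 : (∫ s in (0 : ℝ)..T, θ s ^ 2) / ε ≤ C * Γ * ε := by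
      rw [div_le_iff₀ hε]
      calc _ ≤ C * (Γ * ε ^ 2) := hE
        _ = _ := by ring
    linarith
  -- The smallness condition on k is exactly what keeps the diagonal Gronwall term below half of
  -- `μlow` / 4.
  · have := hsmall n hn
    have e : μ ^ 2 * T ^ α / (2 * α ^ 2 * μlow) * (t (n + 1) - t n) ^ α = μlow / 8 *
        (4 * T ^ α * (μ / (α * μlow)) ^ 2 * (t (n + 1) - t n) ^ α) := by
      field_simp
      ring
    rw [e]
    nlinarith
  · exact intervalIntegral.integral_nonneg (H.lt n hn).le fun s _ => sq_nonneg _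
  · refine (H.global_energy hQd hQ1 hQo hQb hn).trans (le_of_eq ?_)
    rw [hΓ]
    ring

end IsErrEq
end DGVolterra

end

noncomputable section

namespace DGVolterra

open MeasureTheory Polynomial

/-! ### The nodal error by duality -/

namespace IsErrEq
variable {α T μlow μ : ℝ} {p N : ℕ} {t : ℕ → ℝ} {a b u u' : ℝ → ℝ} {P : ℕ → ℝ[X]}
variable (H : IsErrEq α T μlow μ p N t a b u u' P)
include H

/-- By adjointness the integral of a forward fractional integral is the integral of its argument
against the backward integral of 1, which is at most T^α / α. -/
theorem integral_abs_residual_le :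
    ∫ s in (0 : ℝ)..T, |a s * err N t u P s + fwd α T (fun r => b r * err N t u P r) s| ≤
      μ * (1 + T ^ α / α) * ∫ s in (0 : ℝ)..T, |err N t u P s| := by
  have h0 := H.α_pos
  have h1 := H.α_lt
  have hTp := H.T_pos
  have hμ := H.μ_nonneg
  set e := err N t u P
  have he : BddMeas e := H.bddMeas_err
  have hme : BddMeas (fun s => μ * |e s|) := (BddMeas.const μ).mul he.abs
  have i1 := hme.intervalIntegrable 0 T
  have i2 := fwd_mul_intervalIntegrable h0 h1 hTp.le hme (BddMeas.const 1)
  have i3 := mul_bwd_intervalIntegrable h0 h1 hTp.le hme (BddMeas.const 1)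
  have hle := intervalIntegral.integral_mono_on hTp.le (H.residual_integrable he).abs (i1.add i2)
    fun s _ => by
      refine (abs_add_le _ _).trans (add_le_add ?_ ?_)
      · rw [abs_mul]
        exact mul_le_mul_of_nonneg_right (H.bound_a s) (abs_nonneg _)
      · rw [mul_one]
        refine (abs_fwd_le _ hTp.le s).trans (fwd_mono h0 h1 (H.bddMeas_b.mul he).abs hme hTp.le
          (fun r _ => ?_) s)
        rw [abs_mul]
        exact mul_le_mul_of_nonneg_right (H.bound_b r) (abs_nonneg _)
  rw [intervalIntegral.integral_add i1 i2,
    integral_fwd_mul h0 h1 hTp.le hme (BddMeas.const 1)] at hle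
  have h3 : ∫ s in (0 : ℝ)..T, μ * |e s| * bwd α T (fun _ => 1) s ≤
      ∫ s in (0 : ℝ)..T, μ * |e s| * (T ^ α / α) := by
    refine intervalIntegral.integral_mono_on hTp.le i3 (i1.mul_const _) fun s hs => ?_
    rw [bwd_one h0 h1 hs.1 hs.2]
    have := hs.1
    have : 0 ≤ T - s := sub_nonneg.2 hs.2
    gcongr
    linarith
  rw [intervalIntegral.integral_mul_const] at h3
  rw [intervalIntegral.integral_const_mul] at h3 hle
  linarith

/-- The nodal error as a sum of residuals tested with the dual solution. -/
theorem nodeErr_eq_sum {M₁ L : ℝ} {z : ℝ → ℝ} {n : ℕ} (hn : n ≤ N)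
    (hz : IsDual α T μ M₁ L (t n) a b z) :
    nodeErr t u P n = ∑ j ∈ Finset.range n,
      (((P j).eval (t j) - u (t j) - nodeErr t u P j) * z (t j) +
        ∫ s in t j..t (j + 1), ((derivative (P j)).eval s - u' s + a s * err N t u P s +
          fwd α T (fun r => b r * err N t u P r) s) * z s) := by
  have h0 := H.α_pos
  have h1 := H.α_lt
  have hTp := H.T_pos
  obtain ⟨hτ, hτT⟩ := H.node_mem hn
  obtain ⟨g, hgc, hgm, hg⟩ := hz.exists_deriv h0 h1
  set e := err N t u P with hedef
  have he : BddMeas e := H.bddMeas_err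
  have hbe := H.bddMeas_b.mul he
  have ires := (H.residual_integrable he).mul_continuousOn hz.cont.continuousOn
  have ieg := (he.mul hgm).intervalIntegrable 0 T
  -- Integration by parts turns the jump and derivative terms into differences of nodal values times
  -- z, which telescope to the error at t_n because z(t_n) = 1.
  have hterm : ∀ j ∈ Finset.range n,
      (((P j).eval (t j) - u (t j) - nodeErr t u P j) * z (t j) +
        ∫ s in t j..t (j + 1), ((derivative (P j)).eval s - u' s + a s * e s +
          fwd α T (fun r => b r * e r) s) * z s) =
      (nodeErr t u P (j + 1) * z (t (j + 1)) - nodeErr t u P j * z (t j)) +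
      ((∫ s in t j..t (j + 1), (a s * e s + fwd α T (fun r => b r * e r) s) * z s) -
        ∫ s in t j..t (j + 1), e s * g s) := by
    intro j hj
    have hjn := Finset.mem_range.1 hj
    have hjN : j < N := hjn.trans_le hn
    have hle := (H.lt j hjN).le
    have hsub : Ioo (t j) (t (j + 1)) ⊆ Ioo 0 (t n) :=
      Ioo_subset_Ioo (H.node_mem hjN.le).1 (H.mono hjn hn)
    have hparts := H.integral_deriv_mul hjN (P j) hz.cont (v' := g) (fun s hs => by
      rw [hg s (Ioo_subset_Icc_self (hsub hs))]
      exact hz.deriv s (hsub hs)) (hgc.intervalIntegrable _ _)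
    have hcong : ∫ s in t j..t (j + 1), ((P j).eval s - u s) * g s =
        ∫ s in t j..t (j + 1), e s * g s := by
      refine intervalIntegral.integral_congr_ae (Filter.Eventually.of_forall fun s hs => ?_)
      rw [uIoc_of_le hle] at hs
      rw [hedef, err, piecewise_eq H.lt P hjN hs]
    have hsplit : ∫ s in t j..t (j + 1), ((derivative (P j)).eval s - u' s + a s * e s +
          fwd α T (fun r => b r * e r) s) * z s =
        (∫ s in t j..t (j + 1), ((derivative (P j)).eval s - u' s) * z s) +
        ∫ s in t j..t (j + 1), (a s * e s + fwd α T (fun r => b r * e r) s) * z s := by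
      rw [← intervalIntegral.integral_add _ (H.intervalIntegrable_sub ires hjN)]
      · congr 1; ext s; ring
      · exact (((P j).derivative.continuous.intervalIntegrable _ _).sub
          (H.int_u'_sub hjN)).mul_continuousOn hz.cont.continuousOn
    have hnext : nodeErr t u P (j + 1) = (P j).eval (t (j + 1)) - u (t (j + 1)) := by
      rw [nodeErr, if_neg (Nat.succ_ne_zero j), Nat.add_sub_cancel]
    rw [hsplit, hparts, hcong, hnext]
    ring
  rw [Finset.sum_congr rfl hterm, Finset.sum_add_distrib,
    Finset.sum_range_sub (fun j => nodeErr t u P j * z (t j)), Finset.sum_sub_distrib, H.sum_integral ires hn,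
    H.sum_integral ieg hn, hz.last]
  have hzero : nodeErr t u P 0 = 0 := by simp [nodeErr]
  -- This is where the dual equation enters: the volume terms cancel by adjointness. The upper limit
  -- T is first cut to t_n, where z lives, since the kernel vanishes beyond.
  have hmain : ∫ s in (0 : ℝ)..t n, (a s * e s + fwd α T (fun r => b r * e r) s) * z s =
      ∫ s in (0 : ℝ)..t n, e s * g s := by
    have i1 := (((H.bddMeas_a.mul he)).mul hz.bddMeas).intervalIntegrable 0 (t n)
    have i2 := fwd_mul_intervalIntegrable h0 h1 hτ hbe hz.bddMeas
    have i3 := mul_bwd_intervalIntegrable h0 h1 hτ hbe hz.bddMeas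
    calc _ = ∫ s in (0 : ℝ)..t n, (a s * e s * z s + fwd α (t n) (fun r => b r * e r) s * z s) := by
          refine intervalIntegral.integral_congr fun s hs => ?_
          rw [uIcc_of_le hτ] at hs
          rw [fwd_eq_of_le h0 h1 hbe (hs.2.trans hτT) hs.2]
          ring
      _ = (∫ s in (0 : ℝ)..t n, a s * e s * z s) +
          ∫ s in (0 : ℝ)..t n, b s * e s * bwd α (t n) z s := by
          rw [intervalIntegral.integral_add i1 i2, integral_fwd_mul h0 h1 hτ hbe hz.bddMeas]
      _ = ∫ s in (0 : ℝ)..t n, (a s * e s * z s + b s * e s * bwd α (t n) z s) :=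
          (intervalIntegral.integral_add i1 i3).symm
      _ = _ := by
          refine intervalIntegral.integral_congr fun s hs => ?_
          rw [uIcc_of_le hτ] at hs
          rw [hg s hs]
          ring
  rw [hmain, hzero]
  ring

/-- The nodal error is bounded by the projection errors of the dual solution times the error of the
approximation of `u'` and the mean error. -/
theorem abs_nodeErr_le {M₁ L : ℝ} {z : ℝ → ℝ} {n : ℕ} (hn : n ≤ N)
    (hz : IsDual α T μ M₁ L (t n) a b z) {ω : ℕ → ℝ} {r : ℝ} (hr : 0 ≤ r)
    (hX : ∀ j < n, ∃ X : ℝ[X], X.natDegree ≤ p ∧ X.eval (t j) = z (t j) ∧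
      (∀ q : ℝ[X], q.natDegree < p →
        ∫ s in t j..t (j + 1), (z s - X.eval s) * q.eval s = 0) ∧
      ∀ s ∈ Icc (t j) (t (j + 1)), |z s - X.eval s| ≤ ω j)
    (hq : ∀ j < n, PolyApprox (p - 1) (t j) (t (j + 1)) u' (r / (t (j + 1) - t j))) :
    |nodeErr t u P n| ≤ (∑ j ∈ Finset.range n, ω j) *
      (r + μ * (1 + T ^ α / α) * ∫ s in (0 : ℝ)..T, |err N t u P s|) := by
  have hTp := H.T_pos
  rw [H.nodeErr_eq_sum hn hz, Finset.sum_mul]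
  refine (Finset.abs_sum_le_sum_abs _ _).trans (Finset.sum_le_sum fun j hj => ?_)
  have hjn := Finset.mem_range.1 hj
  have hjN : j < N := hjn.trans_le hn
  have hlt := H.lt j hjN
  have hle := hlt.le
  obtain ⟨X, hXd, hX1, hXo, hXb⟩ := hX j hjn
  obtain ⟨q, hqd, hqb⟩ := hq j hjn
  have hω : 0 ≤ ω j := (abs_nonneg _).trans (hXb (t j) ⟨le_rfl, hle⟩)
  have heq := H.eqn j hjN X hXd
  set e := err N t u P with hedef
  have he : BddMeas e := H.bddMeas_err
  have hp := H.p_pos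
  have hzc := hz.cont
  have hw : Continuous fun s => z s - X.eval s := by fun_prop
  have i0 := H.int_u'_sub hjN
  have ires := H.intervalIntegrable_sub (H.residual_integrable he) hjN
  have iq : IntervalIntegrable (fun s => q.eval s - u' s) volume (t j) (t (j + 1)) :=
    (q.continuous.intervalIntegrable _ _).sub i0
  have iP : IntervalIntegrable (fun s => (derivative (P j)).eval s - u' s + a s * e s +
      fwd α T (fun r => b r * e r) s) volume (t j) (t (j + 1)) := by
    have := (((P j).derivative.continuous.intervalIntegrable (μ := volume) (t j) (t (j + 1))).sub
      i0).add ires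
    refine this.congr fun s _ => ?_
    ring
  have hterm : ((P j).eval (t j) - u (t j) - nodeErr t u P j) * z (t j) +
      ∫ s in t j..t (j + 1), ((derivative (P j)).eval s - u' s + a s * e s +
        fwd α T (fun r => b r * e r) s) * z s =
      (∫ s in t j..t (j + 1), (q.eval s - u' s) * (z s - X.eval s)) +
      ∫ s in t j..t (j + 1), (a s * e s + fwd α T (fun r => b r * e r) s) *
        (z s - X.eval s) := by
    -- The discrete derivative disappears by orthogonality and q takes its place, so only the
    -- approximability of u' matters. The jump disappears because X and z agree at t_j.
    have h1 : ∫ s in t j..t (j + 1), (z s - X.eval s) * (derivative (P j) - q).eval s = 0 := by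
      refine hXo _ (lt_of_le_of_lt (natDegree_sub_le _ _) (max_lt ?_ (by omega)))
      exact lt_of_le_of_lt (natDegree_derivative_le _) (by have := H.deg j hjN; omega)
    have h2 : ∫ s in t j..t (j + 1), ((derivative (P j)).eval s - u' s + a s * e s +
        fwd α T (fun r => b r * e r) s) * (z s - X.eval s) =
        (∫ s in t j..t (j + 1), (z s - X.eval s) * (derivative (P j) - q).eval s) +
        (∫ s in t j..t (j + 1), (q.eval s - u' s) * (z s - X.eval s)) +
        ∫ s in t j..t (j + 1), (a s * e s + fwd α T (fun r => b r * e r) s) *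
          (z s - X.eval s) := by
      have j1 : IntervalIntegrable (fun s => (z s - X.eval s) * (derivative (P j) - q).eval s)
          volume (t j) (t (j + 1)) :=
        (hw.mul (derivative (P j) - q).continuous).intervalIntegrable _ _
      have j2 := iq.mul_continuousOn hw.continuousOn
      rw [← intervalIntegral.integral_add j1 j2, ← intervalIntegral.integral_add (j1.add j2)
        (ires.mul_continuousOn hw.continuousOn)]
      congr 1; ext s
      rw [eval_sub]; ring
    have h3 : ∫ s in t j..t (j + 1), ((derivative (P j)).eval s - u' s + a s * e s +
        fwd α T (fun r => b r * e r) s) * (z s - X.eval s) =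
        (∫ s in t j..t (j + 1), ((derivative (P j)).eval s - u' s + a s * e s +
          fwd α T (fun r => b r * e r) s) * z s) -
        ∫ s in t j..t (j + 1), ((derivative (P j)).eval s - u' s + a s * e s +
          fwd α T (fun r => b r * e r) s) * X.eval s := by
      rw [← intervalIntegral.integral_sub (iP.mul_continuousOn hz.cont.continuousOn)
        (iP.mul_continuousOn X.continuous.continuousOn)]
      simp only [mul_sub]
    rw [hX1] at heq
    rw [h1] at h2
    linarith
  rw [hterm]
  have b1 : |∫ s in t j..t (j + 1), (q.eval s - u' s) * (z s - X.eval s)| ≤ ω j * r := by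
    refine (intervalIntegral.abs_integral_le_integral_abs hle).trans ?_
    have hk : 0 < t (j + 1) - t j := sub_pos.2 hlt
    have := intervalIntegral.integral_mono_on_of_le_Ioo hle
      (iq.mul_continuousOn hw.continuousOn).abs
      (intervalIntegrable_const (c := r / (t (j + 1) - t j) * ω j)) fun s hs => by
        rw [abs_mul, abs_sub_comm]
        exact mul_le_mul (hqb s hs) (hXb s (Ioo_subset_Icc_self hs)) (abs_nonneg _)
          (by positivity)
    rw [intervalIntegral.integral_const, smul_eq_mul] at this
    refine this.trans (le_of_eq ?_)
    field_simp
  have b2 : |∫ s in t j..t (j + 1), (a s * e s + fwd α T (fun r => b r * e r) s) *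
      (z s - X.eval s)| ≤ ω j * (μ * (1 + T ^ α / α) * ∫ s in (0 : ℝ)..T, |e s|) := by
    refine (intervalIntegral.abs_integral_le_integral_abs hle).trans ?_
    have h1 := intervalIntegral.integral_mono_on hle (ires.mul_continuousOn hw.continuousOn).abs
      (ires.abs.const_mul (ω j)) fun s hs => by
        rw [abs_mul, mul_comm]
        exact mul_le_mul_of_nonneg_right (hXb s hs) (abs_nonneg _)
    rw [intervalIntegral.integral_const_mul] at h1
    refine h1.trans (mul_le_mul_of_nonneg_left ?_ hω)
    refine le_trans ?_ H.integral_abs_residual_le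
    refine intervalIntegral.integral_mono_interval (H.node_mem hjN.le).1 hle
      (H.node_mem (i := j + 1) hjN).2 (Filter.Eventually.of_forall fun s => abs_nonneg _)
      (H.residual_integrable he).abs
  calc _ ≤ ω j * r + ω j * (μ * (1 + T ^ α / α) * ∫ s in (0 : ℝ)..T, |e s|) :=
        (abs_add_le _ _).trans (add_le_add b1 b2)
    _ = _ := by ring

end IsErrEq
end DGVolterra

end

noncomputable section

namespace DGVolterra

open MeasureTheory Polynomial

/-! ### Consequences of the weighted regularity -/

theorem HasWeightedRegularity.const_nonneg {m : ℕ} {σ T M : ℝ} {v : ℝ → ℝ}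
    (h : HasWeightedRegularity m σ T M v) (hm : 1 ≤ m) (hT : 0 < T) : 0 ≤ M := by
  have ht : T / 2 ∈ Ioo 0 T := ⟨by positivity, by linarith⟩
  exact nonneg_of_mul_nonneg_left ((abs_nonneg _).trans (h.bound 1 le_rfl hm _ ht))
    (Real.rpow_pos_of_pos ht.1 _)

theorem HasWeightedRegularity.hasDerivAt {m : ℕ} {σ T M : ℝ} {v : ℝ → ℝ}
    (h : HasWeightedRegularity m σ T M v) (hm : 1 ≤ m) {t : ℝ} (ht : t ∈ Ioo 0 T) :
    HasDerivAt v (deriv v t) t ∧ |deriv v t| ≤ M * t ^ (σ - 1) := by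
  have h1 := h.differentiable 0 (by omega) t ht
  have h2 := h.bound 1 le_rfl hm t ht
  rw [iteratedDeriv_zero] at h1
  rw [iteratedDeriv_one, Nat.cast_one] at h2
  exact ⟨h1.hasDerivAt, h2⟩

/-- Both (M/α) t^α + v and (M/α) t^α - v have nonnegative derivative on (0, T). Monotonicity extends
to the closed interval by continuity, although v' may be unbounded at 0. -/
theorem HasWeightedRegularity.abs_sub_le {m : ℕ} {α T M : ℝ} {v : ℝ → ℝ} (h0 : 0 < α)
    (h : HasWeightedRegularity m α T M v) (hm : 1 ≤ m) (hc : ContinuousOn v (Icc 0 T)) {x y : ℝ}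
    (hx : 0 ≤ x) (hxy : x ≤ y) (hy : y ≤ T) :
    |v y - v x| ≤ M / α * (y ^ α - x ^ α) := by
  have hcp : ContinuousOn (fun t : ℝ => M / α * t ^ α) (Icc 0 T) :=
    (Continuous.continuousOn (Real.continuous_rpow_const h0.le)).const_smul (M / α)
  have hdp : ∀ t ∈ Ioo 0 T, HasDerivAt (fun t : ℝ => M / α * t ^ α) (M * t ^ (α - 1)) t := by
    intro t ht
    have := (Real.hasDerivAt_rpow_const (p := α) (Or.inl ht.1.ne')).const_mul (M / α)
    have e : M * t ^ (α - 1) = M / α * (α * t ^ (α - 1)) := by field_simp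
    rw [e]; exact this
  have hmem : ∀ t, t ∈ Ioo 0 T → t ∈ interior (Icc 0 T) := fun t ht => by rwa [interior_Icc]
  have m1 : MonotoneOn (fun t => M / α * t ^ α - v t) (Icc 0 T) := by
    refine monotoneOn_of_deriv_nonneg (convex_Icc 0 T) (hcp.sub hc) ?_ ?_
    · rw [interior_Icc]
      exact fun t ht => ((hdp t ht).sub (h.hasDerivAt hm ht).1).differentiableAt.differentiableWithinAt
    · rw [interior_Icc]
      intro t ht
      have := (hdp t ht).sub (h.hasDerivAt hm ht).1
      rw [HasDerivAt.deriv (f := fun t => M / α * t ^ α - v t) this]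
      have := (abs_le.1 (h.hasDerivAt hm ht).2).2
      linarith
  have m2 : MonotoneOn (fun t => M / α * t ^ α + v t) (Icc 0 T) := by
    refine monotoneOn_of_deriv_nonneg (convex_Icc 0 T) (hcp.add hc) ?_ ?_
    · rw [interior_Icc]
      exact fun t ht => ((hdp t ht).add (h.hasDerivAt hm ht).1).differentiableAt.differentiableWithinAt
    · rw [interior_Icc]
      intro t ht
      have := (hdp t ht).add (h.hasDerivAt hm ht).1
      rw [HasDerivAt.deriv (f := fun t => M / α * t ^ α + v t) this]
      have := (abs_le.1 (h.hasDerivAt hm ht).2).1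
      linarith
  have hx' : x ∈ Icc 0 T := ⟨hx, hxy.trans hy⟩
  have hy' : y ∈ Icc 0 T := ⟨hx.trans hxy, hy⟩
  have a1 := m1 hx' hy' hxy
  have a2 := m2 hx' hy' hxy
  simp only at a1 a2
  rw [abs_le]
  constructor <;> linarith

theorem HasWeightedRegularity.polyApprox {m : ℕ} {σ T M : ℝ} {v : ℝ → ℝ}
    (h : HasWeightedRegularity m σ T M v) (hM : 0 ≤ M) (hσ : σ ≤ m) {x₀ x₁ : ℝ} (hx0 : 0 < x₀)
    (hx : x₀ < x₁) (hx1 : x₁ ≤ T) (i : ℕ) (hi : i + 1 ≤ m) :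
    PolyApprox i x₀ x₁ (iteratedDeriv (m - (i + 1)) v)
      (M * x₀ ^ (σ - m) * (x₁ - x₀) ^ (i + 1)) := by
  have hsub : ∀ t ∈ Ioo x₀ x₁, t ∈ Ioo 0 T := fun t ht => ⟨hx0.trans ht.1, ht.2.trans_le hx1⟩
  refine polyApprox_iteratedDeriv hx (fun j hj t ht => h.differentiable j hj t (hsub t ht))
    (fun t ht => (h.bound m (by omega) le_rfl t (hsub t ht)).trans ?_) i hi
  exact mul_le_mul_of_nonneg_left
    (Real.rpow_le_rpow_of_nonpos hx0 ht.1.le (sub_nonpos.2 hσ)) hM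

/-! ### Tangent inequalities for powers -/

/-- Concavity in the form of Bernoulli's inequality. This and the next lemma bound a step times a
power of a node by an increment of another power, so that weighted mesh sums telescope. -/
theorem mul_rpow_sub_one_le {β u v : ℝ} (hβ0 : 0 ≤ β) (hβ1 : β ≤ 1) (hu : 0 ≤ u) (hv : 0 < v) :
    β * (v - u) * v ^ (β - 1) ≤ v ^ β - u ^ β := by
  have h := rpow_one_add_le_one_add_mul_self (s := u / v - 1) (by
    have := div_nonneg hu hv.le; linarith) hβ0 hβ1
  rw [add_sub_cancel, Real.div_rpow hu hv.le, div_le_iff₀ (by positivity)] at h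
  rw [Real.rpow_sub_one hv.ne']
  have e : (1 + β * (u / v - 1)) * v ^ β = v ^ β - β * (v - u) * (v ^ β / v) := by
    field_simp; ring
  linarith

theorem mul_rpow_sub_two_le {α u v : ℝ} (h0 : 0 < α) (h1 : α < 1) (hu : 0 < u) (huv : u ≤ v) :
    (1 - α) * (v - u) * v ^ (α - 2) ≤ u ^ (α - 1) - v ^ (α - 1) := by
  have hv : 0 < v := hu.trans_le huv
  have h := mul_rpow_sub_one_le (β := 1 - α) (by linarith) (by linarith) hu.le hv
  have e1 : v ^ (α - 2) = v ^ (α - 1) * v ^ (-1 : ℝ) := by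
    rw [← Real.rpow_add hv]; ring_nf
  have e2 : v ^ (1 - α - 1) = v ^ (1 - α) * v ^ (-1 : ℝ) := by
    rw [← Real.rpow_add hv]; ring_nf
  have e3 : v ^ (α - 1) = (v ^ (1 - α))⁻¹ := by
    rw [← Real.rpow_neg hv.le]; ring_nf
  have e4 : u ^ (α - 1) = (u ^ (1 - α))⁻¹ := by
    rw [← Real.rpow_neg hu.le]; ring_nf
  rw [e2] at h
  rw [e1, e3, e4]
  have hvp : 0 < v ^ (1 - α) := by positivity
  have hup : 0 < u ^ (1 - α) := by positivity
  set V := v ^ (1 - α)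
  set U := u ^ (1 - α)
  set w := v ^ (-1 : ℝ)
  set c := (1 - α) * (v - u)
  -- `c V w ≤ V - U` implies `c V⁻¹ w ≤ U⁻¹ - V⁻¹`
  have hUV : U ≤ V := Real.rpow_le_rpow hu.le huv (by linarith)
  calc c * (V⁻¹ * w) = (c * (V * w)) / V ^ 2 := by field_simp
    _ ≤ (V - U) / V ^ 2 := by gcongr
    _ ≤ (V - U) / (U * V) := by
        have : 0 ≤ V - U := sub_nonneg.2 hUV
        gcongr
        nlinarith
    _ = _ := by field_simp

/-! ### Sums over graded meshes -/

/-- The sum of the weights that are singular at the final node. -/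
theorem sum_weight_final_le {α k : ℝ} (h0 : 0 < α) (h1 : α < 1) (hk0 : 0 < k) {t : ℕ → ℝ} {n : ℕ}
    (ht : ∀ j < n, t j < t (j + 1)) (hk : ∀ j < n, t (j + 1) - t j ≤ k)
    (hmono : ∀ j, j + 1 < n → t (j + 1) - t j ≤ t (j + 2) - t (j + 1)) :
    ∑ j ∈ Finset.range (n - 1), (t (j + 1) - t j) ^ 3 * (t n - t (j + 1)) ^ (α - 2) ≤
      (1 + 1 / (1 - α)) * k ^ (1 + α) := by
  have h1' : 0 < 1 - α := by linarith
  rcases Nat.lt_or_ge n 2 with hn | hn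
  · rw [show n - 1 = 0 by omega, Finset.sum_range_zero]
    positivity
  obtain ⟨m, rfl⟩ : ∃ m, n = m + 2 := ⟨n - 2, by omega⟩
  set h := t (m + 2) - t (m + 1) with hh
  have hh0 : 0 < h := sub_pos.2 (ht (m + 1) (by omega))
  have hhk : h ≤ k := hk (m + 1) (by omega)
  -- The steps are nondecreasing, so the last step h bounds all others while it is also the distance
  -- at which the singular weight is cut off.
  have hle : ∀ d j, j + d = m + 1 → t (j + 1) - t j ≤ h := by
    intro d
    induction d with
    | zero => intro j hj; obtain rfl : j = m + 1 := by omega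
              exact le_rfl
    | succ d ih => intro j hj; exact (hmono j (by omega)).trans (ih (j + 1) (by omega))
  have hle' : ∀ j ≤ m + 1, t (j + 1) - t j ≤ h := fun j hj => hle (m + 1 - j) j (by omega)
  have hpow : h ^ 2 * h ^ (α - 1) = h ^ (1 + α) := by
    rw [← Real.rpow_natCast, ← Real.rpow_add hh0]; congr 1; push_cast; ring
  have hpow' : h ^ 3 * h ^ (α - 2) = h ^ (1 + α) := by
    rw [← Real.rpow_natCast, ← Real.rpow_add hh0]; congr 1; push_cast; ring
  rw [show m + 2 - 1 = m + 1 by omega, Finset.sum_range_succ]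
  have hlast : (t (m + 1) - t m) ^ 3 * (t (m + 2) - t (m + 1)) ^ (α - 2) ≤ h ^ (1 + α) := by
    rw [← hpow', ← hh]
    have := hle' m (by omega)
    have : 0 ≤ t (m + 1) - t m := (sub_pos.2 (ht m (by omega))).le
    gcongr
  -- One factor of the step is replaced by the following, larger step, so that the increment starts
  -- at t_{j+1}, where the weight is evaluated. The interval j = m has no such room and is estimated
  -- directly.
  have hsum : ∑ j ∈ Finset.range m, (t (j + 1) - t j) ^ 3 * (t (m + 2) - t (j + 1)) ^ (α - 2) ≤
      ∑ j ∈ Finset.range m, h ^ 2 / (1 - α) * ((t (m + 2) - t (j + 1 + 1)) ^ (α - 1) -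
        (t (m + 2) - t (j + 1)) ^ (α - 1)) := by
    refine Finset.sum_le_sum fun j hj => ?_
    have hjm := Finset.mem_range.1 hj
    have p0 := sub_pos.2 (ht j (by omega))
    have p1 := sub_pos.2 (ht (j + 1) (by omega))
    have p2 : 0 < t (m + 2) - t (j + 1 + 1) := by
      have := monotone_nodes (N := m + 2) ht (show j + 1 + 1 ≤ m + 1 by omega) (by omega)
      linarith
    have e1 := mul_rpow_sub_two_le h0 h1 p2 (by linarith : _ ≤ t (m + 2) - t (j + 1))
    have e2 := hle' j (by omega)
    have e3 := hmono j (by omega)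
    have hw : 0 ≤ (t (m + 2) - t (j + 1)) ^ (α - 2) := Real.rpow_nonneg (by linarith) _
    calc _ = (t (j + 1) - t j) ^ 2 * ((t (j + 1) - t j) * (t (m + 2) - t (j + 1)) ^ (α - 2)) := by
          ring
      _ ≤ h ^ 2 * ((t (j + 1 + 1) - t (j + 1)) * (t (m + 2) - t (j + 1)) ^ (α - 2)) := by
          gcongr
      _ = h ^ 2 / (1 - α) * ((1 - α) * (t (m + 2) - t (j + 1) - (t (m + 2) - t (j + 1 + 1))) *
            (t (m + 2) - t (j + 1)) ^ (α - 2)) := by field_simp; ring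
      _ ≤ _ := by gcongr
  rw [← Finset.mul_sum, Finset.sum_range_sub (fun j => (t (m + 2) - t (j + 1)) ^ (α - 1)) m] at hsum
  have h2 : 0 ≤ (t (m + 2) - t (0 + 1)) ^ (α - 1) := by
    have := monotone_nodes (N := m + 2) ht (show 0 + 1 ≤ m + 2 by omega) le_rfl
    exact Real.rpow_nonneg (by linarith) _
  have h3 : h ^ 2 / (1 - α) * ((t (m + 2) - t (m + 1)) ^ (α - 1) -
      (t (m + 2) - t (0 + 1)) ^ (α - 1)) ≤ 1 / (1 - α) * h ^ (1 + α) := by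
    rw [← hpow, ← hh]
    calc _ ≤ h ^ 2 / (1 - α) * h ^ (α - 1) := by
          gcongr; linarith
      _ = _ := by ring
  have h4 : h ^ (1 + α) ≤ k ^ (1 + α) := by gcongr
  calc _ ≤ 1 / (1 - α) * h ^ (1 + α) + h ^ (1 + α) := add_le_add (hsum.trans h3) hlast
    _ = (1 + 1 / (1 - α)) * h ^ (1 + α) := by ring
    _ ≤ _ := by gcongr

/-- The sum of the weights that are singular at the origin. -/
theorem exists_sum_weight_initial_le {α T γ c C : ℝ} (h0 : 0 < α) (h1 : α < 1) (hγ : 1 ≤ γ)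
    (hc : 0 < c) (hC : 0 < C) : ∃ B : ℝ, 0 ≤ B ∧ ∀ (n : ℕ) (t : ℕ → ℝ) (k : ℝ), 0 < k →
      0 < t 1 → t n ≤ T → (∀ j < n, t j < t (j + 1)) → (∀ j < n, t (j + 1) - t j ≤ k) →
      (∀ j < n, 1 ≤ j → t (j + 1) - t j ≤ C * k * t (j + 1) ^ (1 - 1 / γ)) →
      (∀ j < n, 1 ≤ j → t (j + 1) ≤ C * t j) → c * k ^ γ ≤ t 1 →
      ∑ j ∈ Finset.Ico 1 n, (t (j + 1) - t j) ^ 3 * t j ^ (α - 2) ≤ B * k ^ (1 + α) := by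
  -- For γ = 1 two steps are bounded by k and the sum telescopes in t^(α-1), with t_1 ≥ c k
  -- supplying the missing power. Neither case produces a logarithm.
  rcases hγ.eq_or_lt with rfl | hγ1
  · refine ⟨C ^ (2 - α) / (1 - α) * c ^ (α - 1), ?_, ?_⟩
    · have : 0 < 1 - α := by linarith
      positivity
    intro n t k hk ht1 htn ht hkj hgr hno hct
    have h1' : 0 < 1 - α := by linarith
    have hterm : ∀ j ∈ Finset.Ico 1 n, (t (j + 1) - t j) ^ 3 * t j ^ (α - 2) ≤
        k ^ 2 * (C ^ (2 - α) / (1 - α)) * (t j ^ (α - 1) - t (j + 1) ^ (α - 1)) := by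
      intro j hj
      obtain ⟨hj1, hjn⟩ := Finset.mem_Ico.1 hj
      have hpos : 0 < t j := ht1.trans_le (monotone_nodes (N := n) ht hj1 hjn.le)
      have hpos' : 0 < t (j + 1) := hpos.trans (ht j hjn)
      have p0 := sub_pos.2 (ht j hjn)
      have e1 := mul_rpow_sub_two_le h0 h1 hpos (ht j hjn).le
      have e2 := hkj j hjn
      have e3 : t j ^ (α - 2) ≤ C ^ (2 - α) * t (j + 1) ^ (α - 2) := by
        calc t j ^ (α - 2) = C ^ (2 - α) * (C * t j) ^ (α - 2) := by
              rw [Real.mul_rpow hC.le hpos.le, ← mul_assoc, ← Real.rpow_add hC]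
              simp
          _ ≤ _ := by
              exact mul_le_mul_of_nonneg_left (Real.rpow_le_rpow_of_nonpos hpos'
                (hno j hjn hj1) (by linarith)) (by positivity)
      calc _ = (t (j + 1) - t j) ^ 2 * (t (j + 1) - t j) * t j ^ (α - 2) := by ring
        _ ≤ k ^ 2 * (t (j + 1) - t j) * (C ^ (2 - α) * t (j + 1) ^ (α - 2)) := by gcongr
        _ = k ^ 2 * (C ^ (2 - α) / (1 - α)) *
            ((1 - α) * (t (j + 1) - t j) * t (j + 1) ^ (α - 2)) := by field_simp
        _ ≤ _ := by gcongr
    refine (Finset.sum_le_sum hterm).trans ?_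
    rcases Nat.eq_zero_or_pos n with rfl | hn
    · simp; positivity
    have htel : ∑ j ∈ Finset.Ico 1 n, (t j ^ (α - 1) - t (j + 1) ^ (α - 1)) =
        t 1 ^ (α - 1) - t n ^ (α - 1) := by
      have := Finset.sum_Ico_sub (fun j => -t j ^ (α - 1)) hn
      simp only [neg_sub_neg] at this
      exact this
    rw [← Finset.mul_sum, htel]
    have hnn : 0 ≤ t n ^ (α - 1) :=
      Real.rpow_nonneg (ht1.le.trans (monotone_nodes (N := n) ht hn le_rfl)) _
    rw [Real.rpow_one] at hct
    have e4 : t 1 ^ (α - 1) ≤ c ^ (α - 1) * k ^ (α - 1) := by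
      rw [← Real.mul_rpow hc.le hk.le]
      exact Real.rpow_le_rpow_of_nonpos (by positivity) hct (by linarith)
    have e5 : k ^ 2 * k ^ (α - 1) = k ^ (1 + α) := by
      rw [← Real.rpow_natCast, ← Real.rpow_add hk]; congr 1; push_cast; ring
    calc _ ≤ k ^ 2 * (C ^ (2 - α) / (1 - α)) * (c ^ (α - 1) * k ^ (α - 1)) := by
          gcongr; linarith
      _ = C ^ (2 - α) / (1 - α) * c ^ (α - 1) * (k ^ 2 * k ^ (α - 1)) := by ring
      _ = _ := by rw [e5]
  -- In h³ = h · h · h^α · h^(1-α) one h forms the increment of t^ε, one is at most k, h^α uses the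
  -- grading, and h^(1-α) is bounded by a node. The sum telescopes in t^ε, which needs ε > 0, that
  -- is γ > 1.
  · set ε := α * (1 - 1 / γ) with hε
    have hγ' : 1 / γ < 1 := by rw [div_lt_one (by linarith)]; exact hγ1
    have hγ'' : 0 < 1 / γ := by positivity
    have hε0 : 0 < ε := mul_pos h0 (by linarith)
    have hε1 : ε ≤ 1 := by nlinarith
    refine ⟨max 0 (C ^ α * C ^ (1 - α) * C / ε * T ^ ε), le_max_left _ _, ?_⟩
    intro n t k hk ht1 htn ht hkj hgr hno hct
    have hkp : k * k ^ α = k ^ (1 + α) := by rw [Real.rpow_add hk, Real.rpow_one]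
    have hterm : ∀ j ∈ Finset.Ico 1 n, (t (j + 1) - t j) ^ 3 * t j ^ (α - 2) ≤
        C ^ α * C ^ (1 - α) * C / ε * k ^ (1 + α) * (t (j + 1) ^ ε - t j ^ ε) := by
      intro j hj
      obtain ⟨hj1, hjn⟩ := Finset.mem_Ico.1 hj
      have hpos : 0 < t j := ht1.trans_le (monotone_nodes (N := n) ht hj1 hjn.le)
      have hpos' : 0 < t (j + 1) := hpos.trans (ht j hjn)
      have p0 := sub_pos.2 (ht j hjn)
      set h := t (j + 1) - t j with hh
      have e1 : ε * h * t (j + 1) ^ (ε - 1) ≤ t (j + 1) ^ ε - t j ^ ε :=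
        mul_rpow_sub_one_le hε0.le hε1 hpos.le hpos'
      have e2 : h ^ α ≤ C ^ α * k ^ α * t (j + 1) ^ ε := by
        calc h ^ α ≤ (C * k * t (j + 1) ^ (1 - 1 / γ)) ^ α := by
              gcongr; exact hgr j hjn hj1
          _ = _ := by
              rw [Real.mul_rpow (by positivity) (by positivity), Real.mul_rpow hC.le hk.le,
                ← Real.rpow_mul hpos'.le, mul_comm (1 - 1 / γ) α]
      have e3 : h ^ (1 - α) ≤ C ^ (1 - α) * t j ^ (1 - α) := by
        rw [← Real.mul_rpow hC.le hpos.le]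
        have := hno j hjn hj1
        have : h ≤ C * t j := by linarith
        have : 0 ≤ 1 - α := by linarith
        gcongr
      have e4 : t j ^ (1 - α) * t j ^ (α - 2) ≤ C * t (j + 1) ^ (-1 : ℝ) := by
        rw [← Real.rpow_add hpos, show 1 - α + (α - 2) = -1 by ring, Real.rpow_neg_one,
          Real.rpow_neg_one, ← div_eq_mul_inv, le_div_iff₀ hpos', inv_mul_le_iff₀ hpos, mul_comm]
        exact hno j hjn hj1
      have e5 : t (j + 1) ^ ε * t (j + 1) ^ (-1 : ℝ) = t (j + 1) ^ (ε - 1) := by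
        rw [← Real.rpow_add hpos']; ring_nf
      have e6 : h ^ 3 = h * (h * (h ^ α * h ^ (1 - α))) := by
        rw [← Real.rpow_add p0, add_sub_cancel, Real.rpow_one]; ring
      calc h ^ 3 * t j ^ (α - 2) = h * (h * (h ^ α * h ^ (1 - α))) * t j ^ (α - 2) := by rw [e6]
        _ ≤ h * (k * ((C ^ α * k ^ α * t (j + 1) ^ ε) * (C ^ (1 - α) * t j ^ (1 - α)))) *
            t j ^ (α - 2) := by
            gcongr
            exact hkj j hjn
        _ = h * (C ^ α * C ^ (1 - α) * (k * k ^ α)) * t (j + 1) ^ ε *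
            (t j ^ (1 - α) * t j ^ (α - 2)) := by ring
        _ ≤ h * (C ^ α * C ^ (1 - α) * (k * k ^ α)) * t (j + 1) ^ ε *
            (C * t (j + 1) ^ (-1 : ℝ)) := by gcongr
        _ = C ^ α * C ^ (1 - α) * C / ε * k ^ (1 + α) * (ε * h * (t (j + 1) ^ ε *
              t (j + 1) ^ (-1 : ℝ))) := by rw [hkp]; field_simp
        _ ≤ _ := by rw [e5]; gcongr
    refine (Finset.sum_le_sum hterm).trans ?_
    rcases Nat.eq_zero_or_pos n with rfl | hn
    · simp; positivity
    have htn0 : 0 < t n := ht1.trans_le (monotone_nodes (N := n) ht hn le_rfl)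
    rw [← Finset.mul_sum, Finset.sum_Ico_sub (fun j => t j ^ ε) hn]
    have e7 : t n ^ ε - t 1 ^ ε ≤ T ^ ε := by
      have : t n ^ ε ≤ T ^ ε := by gcongr
      have : 0 ≤ t 1 ^ ε := by positivity
      linarith
    calc _ ≤ C ^ α * C ^ (1 - α) * C / ε * k ^ (1 + α) * T ^ ε := by gcongr
      _ = (C ^ α * C ^ (1 - α) * C / ε * T ^ ε) * k ^ (1 + α) := by ring
      _ ≤ _ := by
        gcongr
        exact le_max_right _ _

/-- The local interpolation rate on a graded mesh, away from the origin. -/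
theorem exists_graded_rate_le {T γ c C σ : ℝ} (m : ℕ) (hγ : 1 ≤ γ) (hc : 0 < c) (hC : 0 < C) :
    ∃ B : ℝ, 0 ≤ B ∧ ∀ x y k : ℝ, 0 < k → 0 < x → x ≤ T → x < y → y ≤ C * x →
      y - x ≤ C * k * y ^ (1 - 1 / γ) → c * k ^ γ ≤ x →
      (y - x) ^ m * x ^ (σ - m) ≤ B * k ^ min (γ * σ) m := by
  have hγ0 : 0 < γ := by linarith
  have hγ' : 0 ≤ 1 - 1 / γ := by
    have : 1 / γ ≤ 1 := by rw [div_le_one hγ0]; exact hγ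
    linarith
  refine ⟨max 0 ((C * C ^ (1 - 1 / γ)) ^ m * max (T ^ (σ - m / γ)) (c ^ (σ - m / γ))),
    le_max_left _ _, ?_⟩
  intro x y k hk hx hxT hxy hyx hstep hcx
  have e1 : y - x ≤ C * C ^ (1 - 1 / γ) * k * x ^ (1 - 1 / γ) := by
    have hy : 0 < y := hx.trans hxy
    calc y - x ≤ C * k * y ^ (1 - 1 / γ) := hstep
      _ ≤ C * k * (C * x) ^ (1 - 1 / γ) := by gcongr
      _ = _ := by rw [Real.mul_rpow hC.le hx.le]; ring
  have e2 : (x ^ (1 - 1 / γ)) ^ m * x ^ (σ - m) = x ^ (σ - m / γ) := by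
    rw [← Real.rpow_natCast, ← Real.rpow_mul hx.le, ← Real.rpow_add hx]
    congr 1; ring
  have hyx0 : 0 ≤ y - x := by linarith
  -- A nonnegative exponent is bounded through x ≤ T. A negative one is bounded through x ≥ c k^γ,
  -- which turns k^m into k^(γσ).
  have e3 : k ^ (m : ℝ) * x ^ (σ - m / γ) ≤
      max (T ^ (σ - m / γ)) (c ^ (σ - m / γ)) * k ^ min (γ * σ) m := by
    rcases le_total (m : ℝ) (γ * σ) with h | h
    · have : 0 ≤ σ - m / γ := by
        rw [sub_nonneg, div_le_iff₀ hγ0]; linarith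
      rw [min_eq_right h, mul_comm]
      gcongr
      exact le_max_of_le_left (by gcongr)
    · have hneg : σ - m / γ ≤ 0 := by
        rw [sub_nonpos, le_div_iff₀ hγ0]; linarith
      rw [min_eq_left h]
      calc k ^ (m : ℝ) * x ^ (σ - m / γ) ≤ k ^ (m : ℝ) * (c * k ^ γ) ^ (σ - m / γ) :=
            mul_le_mul_of_nonneg_left
              (Real.rpow_le_rpow_of_nonpos (by positivity) hcx hneg) (by positivity)
        _ = c ^ (σ - m / γ) * k ^ (γ * σ) := by
            rw [Real.mul_rpow hc.le (by positivity), ← Real.rpow_mul hk.le, mul_left_comm,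
              ← Real.rpow_add hk]
            congr 2
            field_simp
            ring
        _ ≤ _ := by
            gcongr
            exact le_max_right _ _
  calc (y - x) ^ m * x ^ (σ - m)
      ≤ (C * C ^ (1 - 1 / γ) * k * x ^ (1 - 1 / γ)) ^ m * x ^ (σ - m) := by gcongr
    _ = (C * C ^ (1 - 1 / γ)) ^ m * (k ^ m * ((x ^ (1 - 1 / γ)) ^ m * x ^ (σ - m))) := by ring
    _ = (C * C ^ (1 - 1 / γ)) ^ m * (k ^ (m : ℝ) * x ^ (σ - m / γ)) := by
        rw [e2, Real.rpow_natCast]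
    _ ≤ (C * C ^ (1 - 1 / γ)) ^ m * (max (T ^ (σ - m / γ)) (c ^ (σ - m / γ)) *
        k ^ min (γ * σ) m) := by gcongr
    _ = (C * C ^ (1 - 1 / γ)) ^ m * max (T ^ (σ - m / γ)) (c ^ (σ - m / γ)) *
        k ^ min (γ * σ) m := by ring
    _ ≤ _ := by
        gcongr
        exact le_max_right _ _

/-! ### Graded meshes -/

/-- A graded mesh with maximal step at most `k`, indexed from `0`. -/
structure GradedNodes (T γ c C k : ℝ) (N : ℕ) (t : ℕ → ℝ) : Prop where
  k_pos : 0 < k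
  k_le : k ≤ T
  first : t 0 = 0
  last : t N = T
  lt : ∀ n < N, t n < t (n + 1)
  step_le : ∀ n < N, t (n + 1) - t n ≤ k
  graded : ∀ n < N, 1 ≤ n → t (n + 1) - t n ≤ C * k * t (n + 1) ^ (1 - 1 / γ)
  node_le : ∀ n < N, 1 ≤ n → t (n + 1) ≤ C * t n
  le_first : c * k ^ γ ≤ t 1
  first_le : t 1 ≤ C * k ^ γ
  mono : ∀ n, n + 1 < N → t (n + 1) - t n ≤ t (n + 2) - t (n + 1)

theorem IsMesh.gradedNodes {T γ c C : ℝ} (hT : 0 < T) {N : ℕ} {t : ℕ → ℝ} (ht : IsMesh T N t)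
    (hg : IsGraded γ c C N t) (hm : ∀ n, 2 ≤ n → n ≤ N → step t (n - 1) ≤ step t n) :
    GradedNodes T γ c C (maxStep N t) N t := by
  have hN : 0 < N := by
    rcases Nat.eq_zero_or_pos N with rfl | h
    · have := ht.first.symm.trans ht.last
      linarith
    · exact h
  have : Nonempty (Fin N) := ⟨⟨0, hN⟩⟩
  have hst : ∀ n, step t (n + 1) = t (n + 1) - t n := fun n => rfl
  have hle : ∀ n < N, t (n + 1) - t n ≤ maxStep N t := fun n hn =>
    le_ciSup (f := fun i : Fin N => step t (i + 1)) (Set.finite_range _).bddAbove ⟨n, hn⟩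
  refine ⟨(sub_pos.2 (ht.lt 0 hN)).trans_le (hle 0 hN), ?_, ht.first, ht.last, ht.lt, hle, ?_, ?_,
    ?_, ?_, ?_⟩
  · refine ciSup_le fun i => ?_
    have h1 := monotone_nodes ht.lt (Nat.zero_le i) i.2.le
    have h2 := monotone_nodes ht.lt (show (i : ℕ) + 1 ≤ N from i.2) le_rfl
    rw [ht.first] at h1
    rw [ht.last] at h2
    rw [hst]
    linarith
  · exact fun n hn h => hg.step_le (n + 1) (by omega) hn
  · exact fun n hn h => hg.node_le (n + 1) (by omega) hn
  · have := hg.le_first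
    rwa [step, Nat.sub_self, ht.first, sub_zero] at this
  · have := hg.first_le
    rwa [step, Nat.sub_self, ht.first, sub_zero] at this
  · exact fun n hn => hm (n + 2) (by omega) hn

namespace GradedNodes

variable {T γ c C k : ℝ} {N : ℕ} {t : ℕ → ℝ} (hg : GradedNodes T γ c C k N t)
include hg

theorem node_nonneg {n : ℕ} (hn : n ≤ N) : 0 ≤ t n :=
  hg.first ▸ monotone_nodes hg.lt (Nat.zero_le n) hn

theorem node_pos {n : ℕ} (hn : n ≤ N) (h : 1 ≤ n) : 0 < t n := by
  have h1 := hg.lt 0 (by omega)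
  rw [hg.first] at h1
  exact h1.trans_le (monotone_nodes hg.lt h hn)

theorem node_le_last {n : ℕ} (hn : n ≤ N) : t n ≤ T := hg.last ▸ monotone_nodes hg.lt hn le_rfl

end GradedNodes

/-! ### Approximation of dual solutions on a mesh -/

/-- Projections of `z` onto polynomials of degree at most `p` on the first `n` intervals which
match the left endpoint values and have errors bounded by `ω`. -/
def HasProjections (p n : ℕ) (t : ℕ → ℝ) (z : ℝ → ℝ) (ω : ℕ → ℝ) : Prop :=
  ∀ j < n, ∃ X : ℝ[X], X.natDegree ≤ p ∧ X.eval (t j) = z (t j) ∧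
    (∀ q : ℝ[X], q.natDegree < p → ∫ s in t j..t (j + 1), (z s - X.eval s) * q.eval s = 0) ∧
    ∀ s ∈ Icc (t j) (t (j + 1)), |z s - X.eval s| ≤ ω j

theorem exists_hasProjections (p : ℕ) : ∃ K : ℝ, 0 ≤ K ∧ ∀ (n : ℕ) (t : ℕ → ℝ) (z : ℝ → ℝ)
    (δ : ℕ → ℝ), Continuous z → (∀ j < n, t j < t (j + 1)) →
    (∀ j < n, PolyApprox p (t j) (t (j + 1)) z (δ j)) →
    HasProjections p n t z fun j => K * δ j := by
  obtain ⟨K, hK, h⟩ := exists_projection p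
  refine ⟨K, hK, fun n t z δ hz ht hδ j hj => ?_⟩
  have hlt := ht j hj
  -- The endpoints are passed in reverse order, since z is to be matched on the left.
  obtain ⟨X, hX, hX1, hXo, hXb⟩ := h (t (j + 1)) (t j) z (δ j) hlt.ne' hz.continuousOn (by
    rw [min_eq_right hlt.le, max_eq_left hlt.le]
    exact hδ j hj)
  refine ⟨X, hX, hX1, fun q hq => ?_, fun s hs => hXb s ?_⟩
  · rw [intervalIntegral.integral_symm, hXo q hq, neg_zero]
  · rwa [uIcc_of_ge hlt.le]

/-- The local bounds from `polyApprox_one` telescope to at most T + 2 T^α, times one factor k. -/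
theorem exists_dual_projections_linear {α : ℝ} (h0 : 0 < α) (h1 : α < 1) {p : ℕ} (hp : 1 ≤ p)
    (T μ M₁ L : ℝ) : ∃ B : ℝ, 0 ≤ B ∧ ∀ (γ c C k : ℝ) (N : ℕ) (t : ℕ → ℝ) (a b z : ℝ → ℝ) (n : ℕ),
      GradedNodes T γ c C k N t → n ≤ N → IsDual α T μ M₁ L (t n) a b z →
      ∃ ω : ℕ → ℝ, HasProjections p n t z ω ∧ ∑ j ∈ Finset.range n, ω j ≤ B * k := by
  obtain ⟨K, hK, h⟩ := exists_hasProjections p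
  refine ⟨K * |dualG α T μ M₁ L| * (|T| + |T| ^ α + |T| ^ α), by positivity, ?_⟩
  intro γ c C k N t a b z n hg hn hz
  have hG := dualG_nonneg h0 h1 hz
  have hT : 0 ≤ T := hz.pos.le.trans hz.le
  rw [abs_of_nonneg hG, abs_of_nonneg hT]
  set G := dualG α T μ M₁ L
  have hτ := hz.pos
  refine ⟨_, h n t z (fun j => G * ((t (j + 1) - t j) + (t (j + 1) ^ α - t j ^ α) +
    ((t n - t j) ^ α - (t n - t (j + 1)) ^ α)) * k) hz.cont (fun j hj => hg.lt j (by omega))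
    (fun j hj => ?_), ?_⟩
  · have hj0 := hg.node_nonneg (n := j) (by omega)
    have hlt := hg.lt j (by omega)
    have hjn := monotone_nodes hg.lt (show j + 1 ≤ n from hj) hn
    refine (hz.polyApprox_one h0 h1 hj0 hlt hjn).mono hp
      (mul_le_mul_of_nonneg_left (hg.step_le j (by omega)) (mul_nonneg hG ?_))
    have e1 : t j ^ α ≤ t (j + 1) ^ α := Real.rpow_le_rpow hj0 hlt.le h0.le
    have e2 : (t n - t (j + 1)) ^ α ≤ (t n - t j) ^ α :=
      Real.rpow_le_rpow (by linarith) (by linarith) h0.le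
    linarith
  · rw [← Finset.mul_sum, ← Finset.sum_mul, ← Finset.mul_sum, Finset.sum_add_distrib,
      Finset.sum_add_distrib, Finset.sum_range_sub, Finset.sum_range_sub (fun j => t j ^ α),
      Finset.sum_range_sub' (fun j => (t n - t j) ^ α), hg.first, sub_self,
      Real.zero_rpow h0.ne', sub_zero, sub_zero]
    have e1 : t n ^ α ≤ T ^ α := Real.rpow_le_rpow hτ.le hz.le h0.le
    have := hz.le
    have := hg.k_pos
    calc _ ≤ K * (G * (T + T ^ α + T ^ α) * k) := by gcongr
      _ = _ := by ring

/-- Quadratic approximation is used away from the two singular points 0 and t_n. On the first and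
last intervals the linear bound already has order k^(1+α), since t^α varies by at most k^α over one
step. -/
theorem exists_dual_projections_quadratic {α : ℝ} (h0 : 0 < α) (h1 : α < 1) {p : ℕ} (hp : 2 ≤ p)
    {T μ M₁ L M₂ γ c C : ℝ} (hM₂ : 0 ≤ M₂) (hγ : 1 ≤ γ) (hc : 0 < c) (hC : 0 < C) :
    ∃ B : ℝ, 0 ≤ B ∧ ∀ (k : ℝ) (N : ℕ) (t : ℕ → ℝ) (a b z : ℝ → ℝ) (n : ℕ),
      GradedNodes T γ c C k N t → n ≤ N → IsDual α T μ M₁ L (t n) a b z →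
      (∀ x₀ x₁, 0 < x₀ → x₀ < x₁ → x₁ ≤ T →
        PolyApprox 1 x₀ x₁ a (M₂ * x₀ ^ (α - 2) * (x₁ - x₀) ^ 2)) →
      (∀ x₀ x₁, 0 < x₀ → x₀ < x₁ → x₁ ≤ T →
        PolyApprox 1 x₀ x₁ b (M₂ * x₀ ^ (α - 2) * (x₁ - x₀) ^ 2)) →
      ∃ ω : ℕ → ℝ, HasProjections p n t z ω ∧ ∑ j ∈ Finset.range n, ω j ≤ B * k ^ (1 + α) := by
  obtain ⟨K, hK, h⟩ := exists_hasProjections p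
  obtain ⟨B, hB, hini⟩ := exists_sum_weight_initial_le (T := T) h0 h1 hγ hc hC
  have h1' : 0 < 1 - α := by linarith
  obtain ⟨W, hW0, hW⟩ : ∃ W : ℝ, 0 ≤ W ∧ ∀ (τ : ℝ) (a b z : ℝ → ℝ) (x₀ x₁ : ℝ),
      IsDual α T μ M₁ L τ a b z → 0 < x₀ → x₀ < x₁ → x₁ < τ →
      PolyApprox 1 x₀ x₁ a (M₂ * x₀ ^ (α - 2) * (x₁ - x₀) ^ 2) →
      PolyApprox 1 x₀ x₁ b (M₂ * x₀ ^ (α - 2) * (x₁ - x₀) ^ 2) →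
      PolyApprox 2 x₀ x₁ z (W * ((x₁ - x₀) ^ 3 * (x₀ ^ (α - 2) + (τ - x₁) ^ (α - 2)))) := by
    refine ⟨_, le_max_right _ 0, fun τ a b z x₀ x₁ hz hx hx01 hx1 hA hB =>
      (hz.polyApprox_two h0 h1 hx hx01 hx1 hM₂ hA hB).mono le_rfl
        (mul_le_mul_of_nonneg_right (le_max_left _ _) ?_)⟩
    have := sub_pos.2 hx01
    have := sub_pos.2 hx1
    positivity
  set A := |dualG α T μ M₁ L| * (|T| ^ (1 - α) + 2) with hA
  have hA0 : 0 ≤ A := by positivity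
  refine ⟨K * (A + A + W * (B + (1 + 1 / (1 - α)))), by positivity, ?_⟩
  intro k N t a b z n hg hn hz ha hb
  have hG := dualG_nonneg h0 h1 hz
  have hT : 0 ≤ T := hz.pos.le.trans hz.le
  have hk := hg.k_pos
  rw [abs_of_nonneg hG, abs_of_nonneg hT] at hA
  have hn0 : n ≠ 0 := by
    rintro rfl
    exact hz.pos.ne' hg.first
  set w : ℕ → ℝ := fun j => (t (j + 1) - t j) ^ 3 * t j ^ (α - 2)
  set w' : ℕ → ℝ := fun j => (t (j + 1) - t j) ^ 3 * (t n - t (j + 1)) ^ (α - 2)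
  have hw0 : ∀ j < n, 0 ≤ w j := fun j hj => mul_nonneg
    (pow_nonneg (sub_nonneg.2 (hg.lt j (by omega)).le) 3)
    (Real.rpow_nonneg (hg.node_nonneg (by omega)) _)
  have hw0' : ∀ j < n, 0 ≤ w' j := fun j hj => mul_nonneg
    (pow_nonneg (sub_nonneg.2 (hg.lt j (by omega)).le) 3)
    (Real.rpow_nonneg (sub_nonneg.2 (monotone_nodes hg.lt (show j + 1 ≤ n from hj) hn)) _)
  have hAk : 0 ≤ A * k ^ (1 + α) := by positivity
  have hone : ∀ j < n, PolyApprox p (t j) (t (j + 1)) z (A * k ^ (1 + α)) := by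
    intro j hj
    have hj0 := hg.node_nonneg (n := j) (by omega)
    have hlt := hg.lt j (by omega)
    have hjn := monotone_nodes hg.lt (show j + 1 ≤ n from hj) hn
    refine (hz.polyApprox_one h0 h1 hj0 hlt hjn).mono (by omega) ?_
    have hh : 0 < t (j + 1) - t j := sub_pos.2 hlt
    have hhk := hg.step_le j (by omega)
    have e0 : t (j + 1) - t j ≤ T ^ (1 - α) * k ^ α := by
      calc t (j + 1) - t j = (t (j + 1) - t j) ^ (1 - α) * (t (j + 1) - t j) ^ α := by
            rw [← Real.rpow_add hh, sub_add_cancel, Real.rpow_one]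
        _ ≤ T ^ (1 - α) * k ^ α := by
            have := hhk.trans hg.k_le
            gcongr
    have e1 : t (j + 1) ^ α - t j ^ α ≤ k ^ α :=
      (rpow_sub_rpow_le h0 h1 hj0 hlt.le).trans (Real.rpow_le_rpow hh.le hhk h0.le)
    have e2 : (t n - t j) ^ α - (t n - t (j + 1)) ^ α ≤ k ^ α := by
      refine (rpow_sub_rpow_le h0 h1 (sub_nonneg.2 hjn) (by linarith)).trans
        (Real.rpow_le_rpow (by linarith) (by linarith) h0.le)
    calc _ ≤ dualG α T μ M₁ L * (T ^ (1 - α) * k ^ α + k ^ α + k ^ α) * k := by gcongr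
      _ = A * k ^ (1 + α) := by rw [hA, Real.rpow_add hk, Real.rpow_one]; ring
  refine ⟨_, h n t z (fun j => (if j = 0 then A * k ^ (1 + α) else 0) +
    (if j = n - 1 then A * k ^ (1 + α) else 0) + W * (w j + w' j)) hz.cont
    (fun j hj => hg.lt j (by omega)) (fun j hj => ?_), ?_⟩
  · have hww : 0 ≤ W * (w j + w' j) := mul_nonneg hW0 (add_nonneg (hw0 j hj) (hw0' j hj))
    by_cases hj0 : j = 0
    · refine (hone j hj).mono le_rfl ?_
      rw [if_pos hj0]
      split_ifs <;> linarith
    by_cases hjn : j = n - 1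
    · refine (hone j hj).mono le_rfl ?_
      rw [if_pos hjn, if_neg hj0]
      linarith
    have hjp := hg.node_pos (n := j) (by omega) (by omega)
    have hlt := hg.lt j (by omega)
    have hjT := hg.node_le_last (n := j + 1) (by omega)
    have hjn' : t (j + 1) < t n := (hg.lt (j + 1) (by omega)).trans_le
      (monotone_nodes hg.lt (show j + 1 + 1 ≤ n by omega) hn)
    refine (hW (t n) a b z _ _ hz hjp hlt hjn' (ha _ _ hjp hlt hjT) (hb _ _ hjp hlt hjT)).mono hp
      (le_of_eq ?_)
    rw [if_neg hj0, if_neg hjn]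
    simp only [w, w']
    ring
  · have s1 : ∑ j ∈ Finset.range n, w j ≤ B * k ^ (1 + α) := by
      have := hini n t k hk (hg.node_pos (by omega) le_rfl) hz.le
        (fun j hj => hg.lt j (by omega)) (fun j hj => hg.step_le j (by omega))
        (fun j hj => hg.graded j (by omega)) (fun j hj => hg.node_le j (by omega)) hg.le_first
      rw [Finset.range_eq_Ico, Finset.sum_eq_sum_Ico_succ_bot (Nat.pos_of_ne_zero hn0)]
      -- Here 0^(α-2) = 0, so the weight of the first interval drops out of the sum; for `w'` below
      -- the same holds on the last interval.
      simp only [w, hg.first, Real.zero_rpow (show α - 2 ≠ 0 by linarith), mul_zero, zero_add]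
      exact this
    have s2 : ∑ j ∈ Finset.range n, w' j ≤ (1 + 1 / (1 - α)) * k ^ (1 + α) := by
      obtain ⟨m, rfl⟩ := Nat.exists_eq_succ_of_ne_zero hn0
      have := sum_weight_final_le h0 h1 hk (n := m + 1) (fun j hj => hg.lt j (by omega))
        (fun j hj => hg.step_le j (by omega)) (fun j hj => hg.mono j (by omega))
      rw [Nat.succ_eq_add_one, Finset.sum_range_succ]
      simp only [w', sub_self, Real.zero_rpow (show α - 2 ≠ 0 by linarith), mul_zero, add_zero]
      exact this
    rw [← Finset.mul_sum, Finset.sum_add_distrib, Finset.sum_add_distrib, Finset.sum_ite_eq',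
      Finset.sum_ite_eq', if_pos (Finset.mem_range.2 (by omega)),
      if_pos (Finset.mem_range.2 (by omega)), ← Finset.mul_sum, Finset.sum_add_distrib]
    calc _ ≤ K * (A * k ^ (1 + α) + A * k ^ (1 + α) +
          W * (B * k ^ (1 + α) + (1 + 1 / (1 - α)) * k ^ (1 + α))) := by gcongr
      _ = _ := by ring

/-! ### Approximation of the solution on a mesh -/

/-- On the first interval u' is simply compared with 0: it is at most M t_1^(σ-1), and t_1 ≤ C k^γ
gives k^(γσ). Elsewhere the derivative of order p + 1 and the grading give the rate. -/
theorem exists_polyApprox_deriv {σ M T γ c C : ℝ} {p : ℕ} (hp : 1 ≤ p) (hT : 0 < T) (hσ : 1 ≤ σ)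
    (hσp : σ ≤ p + 1) (hγ : 1 ≤ γ) (hc : 0 < c) (hC : 0 < C) :
    ∃ B : ℝ, 0 ≤ B ∧ ∀ (k : ℝ) (N : ℕ) (t : ℕ → ℝ) (u : ℝ → ℝ), GradedNodes T γ c C k N t →
      HasWeightedRegularity (p + 1) σ T M u → ∀ j < N,
        PolyApprox (p - 1) (t j) (t (j + 1)) (deriv u)
          (B * k ^ min (γ * σ) ((p : ℝ) + 1) / (t (j + 1) - t j)) := by
  obtain ⟨B, hB, hrate⟩ := exists_graded_rate_le (T := T) (σ := σ) (p + 1) hγ hc hC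
  set m := min (γ * σ) ((p : ℝ) + 1) with hm
  refine ⟨|M| * (B + C ^ σ * T ^ (γ * σ - m)), by positivity, ?_⟩
  intro k N t u hg hu j hj
  have hM := hu.const_nonneg (by omega) hT
  rw [abs_of_nonneg hM]
  have hlt := hg.lt j hj
  have hh : 0 < t (j + 1) - t j := sub_pos.2 hlt
  have hk := hg.k_pos
  rcases Nat.eq_zero_or_pos j with rfl | hj0
  · refine PolyApprox.mono (m := 0) (ε := M * t 1 ^ (σ - 1)) ⟨0, by simp, fun x hx => ?_⟩
      (Nat.zero_le _) ?_
    · rw [hg.first, zero_add] at hx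
      rw [eval_zero, sub_zero]
      refine (hu.hasDerivAt (by omega) ⟨hx.1, hx.2.trans_le (hg.node_le_last hj)⟩).2.trans ?_
      exact mul_le_mul_of_nonneg_left (Real.rpow_le_rpow hx.1.le hx.2.le (by linarith)) hM
    · rw [hg.first, zero_add, sub_zero]
      have ht1 := hg.node_pos (n := 1) hj le_rfl
      rw [le_div_iff₀ ht1, mul_assoc]
      have e1 : t 1 ^ (σ - 1) * t 1 = t 1 ^ σ := by
        rw [Real.rpow_sub_one ht1.ne']; field_simp
      have e2 : t 1 ^ σ ≤ C ^ σ * T ^ (γ * σ - m) * k ^ m := by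
        calc t 1 ^ σ ≤ (C * k ^ γ) ^ σ := Real.rpow_le_rpow ht1.le hg.first_le (by linarith)
          _ = C ^ σ * (k ^ (γ * σ - m) * k ^ m) := by
            rw [Real.mul_rpow hC.le (by positivity), ← Real.rpow_mul hk.le, ← Real.rpow_add hk,
              sub_add_cancel]
          _ ≤ C ^ σ * (T ^ (γ * σ - m) * k ^ m) := by
            have := hg.k_le
            have : 0 ≤ γ * σ - m := sub_nonneg.2 (min_le_left _ _)
            gcongr
          _ = _ := by ring
      rw [e1, mul_assoc]
      refine mul_le_mul_of_nonneg_left (e2.trans ?_) hM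
      have : 0 ≤ B * k ^ m := by positivity
      linarith
  · have hx0 := hg.node_pos hj.le hj0
    have := hu.polyApprox hM (by push_cast; exact hσp) hx0 hlt (hg.node_le_last hj) (p - 1)
      (by omega)
    rw [show p + 1 - (p - 1 + 1) = 1 by omega, iteratedDeriv_one,
      show p - 1 + 1 = p by omega] at this
    refine this.mono le_rfl ?_
    rw [le_div_iff₀ hh]
    have hr := hrate (t j) (t (j + 1)) k hk hx0 (hg.node_le_last hj.le) hlt (hg.node_le j hj hj0)
      (hg.graded j hj hj0) (hg.le_first.trans (monotone_nodes hg.lt hj0 hj.le))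
    have e : k ^ min (γ * σ) ((p + 1 : ℕ) : ℝ) = k ^ m := by rw [hm]; push_cast; rfl
    rw [e] at hr
    have hCT : 0 ≤ C ^ σ * T ^ (γ * σ - m) * k ^ m := by positivity
    calc _ = M * ((t (j + 1) - t j) ^ (p + 1) * t j ^ (σ - (p + 1 : ℕ))) := by ring
      _ ≤ M * (B * k ^ m + C ^ σ * T ^ (γ * σ - m) * k ^ m) :=
        mul_le_mul_of_nonneg_left (by linarith) hM
      _ = _ := by ring

/-! ### Nodal superconvergence for the error equation -/

theorem exists_integral_err_le_of_polyApprox {α T μlow μ : ℝ} {p : ℕ} (hp : 1 ≤ p) (h0 : 0 < α)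
    (h1 : α < 1) (hT : 0 < T) (hμl : 0 < μlow) :
    ∃ C : ℝ, 0 ≤ C ∧ ∀ (γ c D k : ℝ) (N : ℕ) (t : ℕ → ℝ) (a b u u' : ℝ → ℝ) (P : ℕ → ℝ[X]) (R : ℝ),
      GradedNodes T γ c D k N t → IsErrEq α T μlow μ p N t a b u u' P → 0 < R →
      4 * T ^ α * (μ / (α * μlow)) ^ 2 * k ^ α ≤ 1 →
      (∀ j < N, PolyApprox (p - 1) (t j) (t (j + 1)) u' (R / (t (j + 1) - t j))) →
      ∫ s in (0 : ℝ)..T, |err N t u P s| ≤ C * R := by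
  obtain ⟨C, hC, h⟩ := IsErrEq.exists_integral_err_le (μ := μ) h0 h1 hT hμl
  obtain ⟨K, hK, hproj⟩ := exists_projection p
  -- K + 1 instead of K, because the stability estimate needs a positive projection error bound.
  refine ⟨C * (K + 1), by positivity, ?_⟩
  intro γ c D k N t a b u u' P R hg H hR hk hu
  have key : ∀ j, ∃ Q : ℝ[X], j < N → Q.natDegree ≤ p ∧ Q.eval (t (j + 1)) = u (t (j + 1)) ∧
      (∀ q : ℝ[X], q.natDegree < p →
        ∫ s in t j..t (j + 1), (u s - Q.eval s) * q.eval s = 0) ∧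
      ∀ s ∈ Icc (t j) (t (j + 1)), |u s - Q.eval s| ≤ (K + 1) * R := by
    intro j
    by_cases hj : j < N
    · have hlt := hg.lt j hj
      have hh : 0 < t (j + 1) - t j := sub_pos.2 hlt
      have hpu := PolyApprox.integrate hlt
        (fun s hs => H.deriv_u s (H.Ioo_subset hj hs)) (hu j hj)
      rw [div_mul_cancel₀ _ hh.ne', show p - 1 + 1 = p by omega] at hpu
      obtain ⟨Q, hQ, hQ1, hQo, hQb⟩ := hproj (t j) (t (j + 1)) u R hlt.ne H.cont_u.continuousOn (by
        rwa [min_eq_left hlt.le, max_eq_right hlt.le])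
      refine ⟨Q, fun _ => ⟨hQ, hQ1, hQo, fun s hs => (hQb s ?_).trans ?_⟩⟩
      · rwa [uIcc_of_le hlt.le]
      · nlinarith
    · exact ⟨0, fun h => absurd h hj⟩
  choose Q hQ using key
  have := h p N t a b u u' P Q ((K + 1) * R) H (by positivity) hg.mono
    (fun n hn => le_trans (by
      have := hg.step_le n hn
      have := sub_pos.2 (hg.lt n hn)
      gcongr) hk)
    (fun n hn => (hQ n hn).1) (fun n hn => (hQ n hn).2.1) (fun n hn => (hQ n hn).2.2.1)
    (fun n hn => (hQ n hn).2.2.2)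
  rwa [← mul_assoc] at this

/-- The duality bound is a product: the mean error and R are both O(R), while the summed projection
errors of z are O(k) or O(k^(1+α)). -/
theorem exists_abs_nodeErr_le {α T μlow μ M₁ M₂ γ c D : ℝ} {p : ℕ} (hp : 1 ≤ p) (h0 : 0 < α)
    (h1 : α < 1) (hT : 0 < T) (hμl : 0 < μlow) (hμ : 0 ≤ μ) (hM₂ : 0 ≤ M₂) (hγ : 1 ≤ γ)
    (hc : 0 < c) (hD : 0 < D) :
    ∃ C : ℝ, 0 ≤ C ∧ ∀ (k : ℝ) (N : ℕ) (t : ℕ → ℝ) (a b u u' : ℝ → ℝ) (P : ℕ → ℝ[X]) (R : ℝ),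
      GradedNodes T γ c D k N t → IsErrEq α T μlow μ p N t a b u u' P →
      (∀ x y, 0 ≤ x → x ≤ y → y ≤ T → |a y - a x| ≤ M₁ * (y ^ α - x ^ α)) →
      (∀ x y, 0 ≤ x → x ≤ y → y ≤ T → |b y - b x| ≤ M₁ * (y ^ α - x ^ α)) → 0 < R →
      4 * T ^ α * (μ / (α * μlow)) ^ 2 * k ^ α ≤ 1 →
      (∀ j < N, PolyApprox (p - 1) (t j) (t (j + 1)) u' (R / (t (j + 1) - t j))) →
      ∀ n, 1 ≤ n → n ≤ N → |nodeErr t u P n| ≤ C * R * k ∧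
        (2 ≤ p →
          (∀ x₀ x₁, 0 < x₀ → x₀ < x₁ → x₁ ≤ T →
            PolyApprox 1 x₀ x₁ a (M₂ * x₀ ^ (α - 2) * (x₁ - x₀) ^ 2)) →
          (∀ x₀ x₁, 0 < x₀ → x₀ < x₁ → x₁ ≤ T →
            PolyApprox 1 x₀ x₁ b (M₂ * x₀ ^ (α - 2) * (x₁ - x₀) ^ 2)) →
          |nodeErr t u P n| ≤ C * R * k ^ (1 + α)) := by
  obtain ⟨A, hA, hL1⟩ := exists_integral_err_le_of_polyApprox (μ := μ) hp h0 h1 hT hμl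
  obtain ⟨L, hL, hdual⟩ := exists_dual h0 h1 T μ hT hμ
  obtain ⟨B₁, hB₁, hlin⟩ := exists_dual_projections_linear h0 h1 hp T μ M₁ L
  obtain ⟨B₂, hB₂, hquad⟩ : ∃ B : ℝ, 0 ≤ B ∧ (2 ≤ p → ∀ (k : ℝ) (N : ℕ) (t : ℕ → ℝ)
      (a b z : ℝ → ℝ) (n : ℕ),
      GradedNodes T γ c D k N t → n ≤ N → IsDual α T μ M₁ L (t n) a b z →
      (∀ x₀ x₁, 0 < x₀ → x₀ < x₁ → x₁ ≤ T →
        PolyApprox 1 x₀ x₁ a (M₂ * x₀ ^ (α - 2) * (x₁ - x₀) ^ 2)) →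
      (∀ x₀ x₁, 0 < x₀ → x₀ < x₁ → x₁ ≤ T →
        PolyApprox 1 x₀ x₁ b (M₂ * x₀ ^ (α - 2) * (x₁ - x₀) ^ 2)) →
      ∃ ω : ℕ → ℝ, HasProjections p n t z ω ∧ ∑ j ∈ Finset.range n, ω j ≤ B * k ^ (1 + α)) := by
    by_cases h2 : 2 ≤ p
    · obtain ⟨B, hB, h⟩ := exists_dual_projections_quadratic (T := T) (μ := μ) (M₁ := M₁) (L := L)
        h0 h1 h2 hM₂ hγ hc hD
      exact ⟨B, hB, fun _ => h⟩
    · exact ⟨0, le_rfl, fun h => absurd h h2⟩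
  set S := 1 + μ * (1 + T ^ α / α) * A with hS
  have hS0 : 0 ≤ S := by positivity
  refine ⟨max B₁ B₂ * S, by positivity, ?_⟩
  intro k N t a b u u' P R hg H ha hb hR hk hu n hn1 hn
  have htn := H.node_mem hn
  have htp := hg.node_pos hn hn1
  obtain ⟨z, hzc, hz1, hzL, hzd⟩ := hdual (t n) htp htn.2 a b H.cont_a H.cont_b H.bound_a H.bound_b
  have hz : IsDual α T μ M₁ L (t n) a b z :=
    ⟨htp, htn.2, H.bound_a, H.bound_b, H.cont_a, H.cont_b, ha, hb, hzc, hz1, hzL, hzd⟩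
  have hint := hL1 γ c D k N t a b u u' P R hg H hR hk hu
  have hint0 : 0 ≤ ∫ s in (0 : ℝ)..T, |err N t u P s| :=
    intervalIntegral.integral_nonneg hT.le fun s _ => abs_nonneg _
  have hk0 := hg.k_pos
  have key : ∀ (B E : ℝ), B ≤ max B₁ B₂ → 0 ≤ E → ∀ ω, HasProjections p n t z ω →
      ∑ j ∈ Finset.range n, ω j ≤ B * E → |nodeErr t u P n| ≤ max B₁ B₂ * S * R * E := by
    intro B E hB hE ω hω hsum
    refine (H.abs_nodeErr_le hn hz hR.le hω fun j hj => hu j (hj.trans_le hn)).trans ?_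
    have hr0 : 0 ≤ R + μ * (1 + T ^ α / α) * ∫ s in (0 : ℝ)..T, |err N t u P s| := by positivity
    have hr : R + μ * (1 + T ^ α / α) * ∫ s in (0 : ℝ)..T, |err N t u P s| ≤ S * R := by
      calc _ ≤ R + μ * (1 + T ^ α / α) * (A * R) := by gcongr
        _ = S * R := by rw [hS]; ring
    have hB0 : 0 ≤ max B₁ B₂ := le_max_of_le_left hB₁
    calc _ ≤ (max B₁ B₂ * E) * (S * R) :=
          mul_le_mul (hsum.trans (mul_le_mul_of_nonneg_right hB hE)) hr hr0 (by positivity)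
      _ = _ := by ring
  refine ⟨?_, fun h2 hA hB => ?_⟩
  · obtain ⟨ω, hω, hsum⟩ := hlin γ c D k N t a b z n hg hn hz
    exact key B₁ k (le_max_left _ _) hk0.le ω hω hsum
  · obtain ⟨ω, hω, hsum⟩ := hquad h2 k N t a b z n hg hn hz hA hB
    exact key B₂ _ (le_max_right _ _) (by positivity) ω hω hsum

end DGVolterra

end

noncomputable section

namespace DGVolterra

open MeasureTheory Polynomial Filter Topology

/-! ### From the discontinuous Galerkin method to the error equation -/

/-- The extension of `v` from `[0, T]` to the real line by its endpoint values. -/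
def clamp (T : ℝ) (v : ℝ → ℝ) (s : ℝ) : ℝ := v (max 0 (min T s))

theorem clamp_of_mem {T : ℝ} {v : ℝ → ℝ} {s : ℝ} (hs : s ∈ Icc 0 T) : clamp T v s = v s := by
  rw [clamp, min_eq_right hs.2, max_eq_right hs.1]

theorem clamp_mem {T : ℝ} (hT : 0 < T) (s : ℝ) : max 0 (min T s) ∈ Icc 0 T :=
  ⟨le_max_left _ _, max_le hT.le (min_le_left _ _)⟩

theorem continuous_clamp {T : ℝ} (hT : 0 < T) {v : ℝ → ℝ} (hv : ContinuousOn v (Icc 0 T)) :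
    Continuous (clamp T v) :=
  hv.comp_continuous (by fun_prop) fun s => clamp_mem hT s

theorem bddMeas_clamp {T : ℝ} (hT : 0 < T) {v : ℝ → ℝ} (hv : ContinuousOn v (Icc 0 T)) :
    BddMeas (clamp T v) := by
  obtain ⟨C, hC⟩ := isCompact_Icc.exists_bound_of_continuousOn hv
  exact ⟨(continuous_clamp hT hv).measurable, C, fun s => hC _ (clamp_mem hT s)⟩

theorem hasDerivAt_clamp {T : ℝ} {v : ℝ → ℝ} {d s : ℝ} (hs : s ∈ Ioo 0 T)
    (hv : HasDerivAt v d s) : HasDerivAt (clamp T v) d s :=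
  hv.congr_of_eventuallyEq (mem_of_superset (Ioo_mem_nhds hs.1 hs.2) fun _ hx =>
    clamp_of_mem (Ioo_subset_Icc_self hx))

/-- Agreement of v and v' is required only almost everywhere because the values of U at the nodes
are arbitrary. -/
theorem volterra_eq_fwd_of_ae {α T : ℝ} (h0 : 0 < α) (h1 : α < 1) {b v b' v' : ℝ → ℝ}
    (hbv : BddMeas fun s => b' s * v' s) (hb : ∀ s ∈ Icc 0 T, b' s = b s)
    (hv : ∀ᵐ s, s ∈ Ioc 0 T → v' s = v s) {s : ℝ} (hs : s ∈ Icc 0 T) :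
    volterra α b v s = fwd α T (fun r => b' r * v' r) s := by
  rw [← volterra_eq_fwd h0 h1 hbv hs.1 hs.2]
  refine intervalIntegral.integral_congr_ae ?_
  filter_upwards [hv] with r hr hr'
  rw [uIoc_of_le hs.1] at hr'
  rw [hb r ⟨hr'.1.le, hr'.2.trans hs.2⟩, hr ⟨hr'.1, hr'.2.trans hs.2⟩]

theorem rightLim_eq_eval {U : ℝ → ℝ} {P : ℝ[X]} {x y : ℝ} (hxy : x < y)
    (h : ∀ s ∈ Ioo x y, U s = P.eval s) : Function.rightLim U x = P.eval x := by
  refine rightLim_eq_of_tendsto (Tendsto.congr' ?_ (P.continuous.continuousAt.mono_left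
    nhdsWithin_le_nhds))
  filter_upwards [Ioo_mem_nhdsGT hxy] with s hs using (h s hs).symm

theorem leftLim_eq_eval {U : ℝ → ℝ} {P : ℝ[X]} {x y : ℝ} (hxy : x < y)
    (h : ∀ s ∈ Ioo x y, U s = P.eval s) : Function.leftLim U y = P.eval y := by
  refine leftLim_eq_of_tendsto (Tendsto.congr' ?_ (P.continuous.continuousAt.mono_left
    nhdsWithin_le_nhds))
  filter_upwards [Ioo_mem_nhdsLT hxy] with s hs using (h s hs).symm

theorem nodeLeft_sub_eq_nodeErr {N : ℕ} {t : ℕ → ℝ} (ht : ∀ n < N, t n < t (n + 1)) {U : ℝ → ℝ}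
    {P : ℕ → ℝ[X]} (hU : ∀ n < N, ∀ s ∈ Ioo (t n) (t (n + 1)), U s = (P n).eval s) {u₀ : ℝ}
    {u : ℝ → ℝ} (hu : u (t 0) = u₀) {n : ℕ} (hn : n ≤ N) :
    nodeLeft u₀ t U n - u (t n) = nodeErr t u P n := by
  rcases Nat.eq_zero_or_pos n with rfl | h
  · simp [nodeLeft, nodeErr, hu]
  · obtain ⟨m, rfl⟩ : ∃ m, n = m + 1 := ⟨n - 1, by omega⟩
    rw [nodeLeft, nodeErr, if_neg (by omega), if_neg (by omega), leftLim_eq_eval (ht m hn) (hU m hn),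
      Nat.add_sub_cancel]

/-- Inserting the exact equation into the scheme removes f. The bound B on u' makes it integrable up
to the endpoints. -/
theorem exists_isErrEq {α T μlow μ : ℝ} {p N : ℕ} {t : ℕ → ℝ} {a b f u U : ℝ → ℝ} {u₀ B : ℝ}
    (h0 : 0 < α) (h1 : α < 1) (hT : 0 < T) (hp : 1 ≤ p) (hμ : 0 < μlow)
    (ha : ContinuousOn a (Icc 0 T)) (hb : ContinuousOn b (Icc 0 T))
    (hab : ∀ t ∈ Icc 0 T, μlow ≤ a t ∧ a t ≤ μ ∧ |b t| ≤ μ)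
    (hf : ContinuousOn f (Icc 0 T)) (hu : IsSolution α T a b f u₀ u)
    (hB : ∀ s ∈ Ioo 0 T, |deriv u s| ≤ B) (ht : IsMesh T N t)
    (hU : IsDGSolution α p a b f u₀ N t U) :
    ∃ P : ℕ → ℝ[X],
      IsErrEq α T μlow μ p N t (clamp T a) (clamp T b) (clamp T u) (deriv u) P ∧
      ∀ n ≤ N, nodeLeft u₀ t U n - u (t n) = nodeErr t (clamp T u) P n := by
  have key : ∀ n, ∃ P : ℝ[X], n < N → P.natDegree ≤ p ∧
      ∀ s ∈ Ioo (t n) (t (n + 1)), U s = P.eval s := by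
    intro n
    by_cases hn : n < N
    · obtain ⟨P, hP, hPU⟩ := hU.mem (n + 1) (by omega) hn
      exact ⟨P, fun _ => ⟨hP, hPU⟩⟩
    · exact ⟨0, fun h => absurd h hn⟩
  choose P hP using key
  have hnode : ∀ n ≤ N, t n ∈ Icc 0 T := fun n hn =>
    ⟨ht.first ▸ monotone_nodes ht.lt (Nat.zero_le n) hn, ht.last ▸ monotone_nodes ht.lt hn le_rfl⟩
  have hsub : ∀ n < N, Ioo (t n) (t (n + 1)) ⊆ Ioo 0 T := fun n hn =>
    Ioo_subset_Ioo (hnode n hn.le).1 (hnode (n + 1) hn).2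
  have hnl : ∀ n ≤ N, nodeLeft u₀ t U n - u (t n) = nodeErr t (clamp T u) P n := by
    intro n hn
    rw [← nodeLeft_sub_eq_nodeErr (u := clamp T u) (u₀ := u₀) ht.lt (fun n hn => (hP n hn).2) ?_ hn,
      clamp_of_mem (hnode n hn)]
    rw [clamp_of_mem (hnode 0 (Nat.zero_le N)), ht.first, hu.initial]
  have hderiv : ∀ s ∈ Ioo 0 T, HasDerivAt u (deriv u s) s := fun s hs =>
    (hu.equation s hs).differentiableAt.hasDerivAt
  have hpw : ∀ᵐ s, s ∈ Ioc 0 T → piecewise N t P s = U s := by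
    have hne : ∀ᵐ s : ℝ, ∀ n : ℕ, s ≠ t n := ae_all_iff.2 fun n => by simp [ae_iff]
    filter_upwards [hne] with s hs hs'
    obtain ⟨n, hn, hsn⟩ := exists_mem_Ioc (N := N) (t := t) (by rw [ht.first]; exact hs'.1)
      (by rw [ht.last]; exact hs'.2)
    rw [piecewise_eq ht.lt P hn hsn]
    exact ((hP n hn).2 s ⟨hsn.1, lt_of_le_of_ne hsn.2 (hs _)⟩).symm
  have hbb := bddMeas_clamp hT hb
  have hbu := bddMeas_clamp hT hu.continuousOn
  have hba := bddMeas_clamp hT ha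
  have hbp := bddMeas_piecewise N t P
  have hbe : BddMeas (err N t (clamp T u) P) := hbp.sub hbu
  refine ⟨P, ⟨h0, h1, hT, hμ, hp, ht.first, ht.last, ht.lt, fun x => (hab _ (clamp_mem hT x)).1,
    fun x => ?_, fun x => (hab _ (clamp_mem hT x)).2.2, continuous_clamp hT ha,
    continuous_clamp hT hb, continuous_clamp hT hu.continuousOn, hbu,
    fun s hs => hasDerivAt_clamp hs (hderiv s hs), ?_, fun n hn => (hP n hn).1, ?_⟩, hnl⟩
  · have := hab _ (clamp_mem hT x)
    exact abs_le.2 ⟨(show -μ ≤ 0 by linarith).trans (hμ.le.trans this.1), this.2.1⟩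
  · rw [intervalIntegrable_iff_integrableOn_Ioo_of_le hT.le]
    exact Measure.integrableOn_of_bounded (by simp) (measurable_deriv u).aestronglyMeasurable
      (ae_restrict_of_forall_mem measurableSet_Ioo hB)
  · intro n hn X hX
    have hlt := ht.lt n hn
    have hsch := hU.scheme (n + 1) (by omega) hn X hX
    rw [Nat.add_sub_cancel, nodeRight, rightLim_eq_eval hlt (hP n hn).2] at hsch
    have hnl' := hnl n hn.le
    rw [clamp_of_mem (hnode n hn.le), ← hnl']
    set G : ℝ → ℝ := fun s => ((derivative (P n)).eval s - deriv u s +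
      clamp T a s * err N t (clamp T u) P s +
        fwd α T (fun r => clamp T b r * err N t (clamp T u) P r) s) * X.eval s with hG
    have hGf : ∀ s ∈ Ioo (t n) (t (n + 1)),
        (deriv U s + a s * U s + volterra α b U s) * X.eval s = G s + f s * X.eval s := by
      intro s hs
      have hs0 := hsub n hn hs
      have hsT := Ioo_subset_Icc_self hs0
      have e1 : deriv U s = (derivative (P n)).eval s := by
        have : U =ᶠ[𝓝 s] fun x => (P n).eval x :=
          mem_of_superset (Ioo_mem_nhds hs.1 hs.2) fun x hx => (hP n hn).2 x hx
        rw [this.deriv_eq, Polynomial.deriv]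
      have e2 : volterra α b U s = fwd α T (fun r => clamp T b r * piecewise N t P r) s :=
        volterra_eq_fwd_of_ae h0 h1 (hbb.mul hbp) (fun r hr => clamp_of_mem hr) hpw hsT
      have e3 : volterra α b u s = fwd α T (fun r => clamp T b r * clamp T u r) s :=
        volterra_eq_fwd_of_ae h0 h1 (hbb.mul hbu) (fun r hr => clamp_of_mem hr)
          (Eventually.of_forall fun r hr => clamp_of_mem ⟨hr.1.le, hr.2⟩) hsT
      have e4 : fwd α T (fun r => clamp T b r * err N t (clamp T u) P r) s =
          volterra α b U s - volterra α b u s := by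
        rw [e2, e3, ← fwd_sub h0 h1 (hbb.mul hbp) (hbb.mul hbu)]
        simp only [err, mul_sub]
      have e5 := (hderiv s hs0).unique (hu.equation s hs0)
      have e6 : err N t (clamp T u) P s = U s - u s := by
        rw [err, piecewise_eq ht.lt P hn ⟨hs.1, hs.2.le⟩, (hP n hn).2 s hs, clamp_of_mem hsT]
      simp only [hG]
      rw [e1, e4, e6, e5, clamp_of_mem hsT]
      ring
    have hIcc : uIcc (t n) (t (n + 1)) ⊆ uIcc 0 T := by
      rw [uIcc_of_le hlt.le, uIcc_of_le hT.le]
      exact Icc_subset_Icc (hnode n hn.le).1 (hnode (n + 1) hn).2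
    have hfi : IntervalIntegrable (fun s => f s * X.eval s) volume (t n) (t (n + 1)) := by
      refine ContinuousOn.intervalIntegrable ?_
      exact (hf.mono (by rwa [uIcc_of_le hT.le] at hIcc)).mul X.continuous.continuousOn
    have hGi : IntervalIntegrable G volume (t n) (t (n + 1)) := by
      refine IntervalIntegrable.mul_continuousOn ?_ X.continuous.continuousOn
      refine ((IntervalIntegrable.sub ?_ ?_).add ?_).add ?_
      · exact (derivative (P n)).continuous.intervalIntegrable _ _
      · refine IntervalIntegrable.mono_set (a := 0) (b := T) ?_ hIcc
        rw [intervalIntegrable_iff_integrableOn_Ioo_of_le hT.le]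
        exact Measure.integrableOn_of_bounded (by simp) (measurable_deriv u).aestronglyMeasurable
          (ae_restrict_of_forall_mem measurableSet_Ioo hB)
      · exact (hba.mul hbe).intervalIntegrable _ _
      · refine IntervalIntegrable.mono_set (a := 0) (b := T) ?_ hIcc
        simpa using fwd_mul_intervalIntegrable h0 h1 hT.le (hbb.mul hbe) (BddMeas.const 1)
    have hcong : ∫ s in t n..t (n + 1), (deriv U s + a s * U s + volterra α b U s) * X.eval s =
        ∫ s in t n..t (n + 1), (G s + f s * X.eval s) := by
      rw [intervalIntegral.integral_of_le hlt.le, intervalIntegral.integral_of_le hlt.le,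
        integral_Ioc_eq_integral_Ioo, integral_Ioc_eq_integral_Ioo]
      exact setIntegral_congr_fun measurableSet_Ioo hGf
    rw [hcong, intervalIntegral.integral_add hGi hfi] at hsch
    linear_combination hsch

end DGVolterra

end

/-! ### The nodal estimate for the method, and the three rates -/

noncomputable section

namespace DGVolterra

open Polynomial

theorem HasWeightedRegularity.clamp_sub_le {m : ℕ} {α T M : ℝ} {v : ℝ → ℝ} (h0 : 0 < α)
    (h : HasWeightedRegularity m α T M v) (hm : 1 ≤ m) (hc : ContinuousOn v (Icc 0 T)) {x y : ℝ}
    (hx : 0 ≤ x) (hxy : x ≤ y) (hy : y ≤ T) :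
    |clamp T v y - clamp T v x| ≤ M / α * (y ^ α - x ^ α) := by
  rw [clamp_of_mem ⟨hx.trans hxy, hy⟩, clamp_of_mem ⟨hx, hxy.trans hy⟩]
  exact h.abs_sub_le h0 hm hc hx hxy hy

theorem HasWeightedRegularity.clamp_polyApprox {α T M : ℝ} {v : ℝ → ℝ} (h1 : α < 1)
    (h : HasWeightedRegularity 2 α T M v) (hM : 0 ≤ M) {x₀ x₁ : ℝ} (hx0 : 0 < x₀) (hx : x₀ < x₁)
    (hx1 : x₁ ≤ T) :
    PolyApprox 1 x₀ x₁ (clamp T v) (M * x₀ ^ (α - 2) * (x₁ - x₀) ^ 2) := by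
  have := h.polyApprox hM (by push_cast; linarith) hx0 hx hx1 1 (by norm_num)
  norm_num at this
  exact this.congr fun s hs => (clamp_of_mem ⟨(hx0.trans hs.1).le, hs.2.le.trans hx1⟩).symm

/-- The basic nodal error estimate: the rate of approximation of `u` times a power of `k`. -/
theorem exists_abs_nodeLeft_sub_le {α : ℝ} (hα : α ∈ Ioo (0 : ℝ) 1) {p : ℕ} (hp : 1 ≤ p)
    {T : ℝ} (hT : 0 < T) {a b : ℝ → ℝ} (ha : ContinuousOn a (Icc 0 T))
    (hb : ContinuousOn b (Icc 0 T)) {M₀ : ℝ} (ha' : HasWeightedRegularity (min p 2) α T M₀ a)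
    (hb' : HasWeightedRegularity (min p 2) α T M₀ b) {μlow μup : ℝ} (hμ : 0 < μlow)
    (hab : ∀ t ∈ Icc 0 T, μlow ≤ a t ∧ a t ≤ μup ∧ |b t| ≤ μup) {σ : ℝ} (hσ : 1 ≤ σ)
    (hσα : σ ≤ α + 1) (M : ℝ) {γ : ℝ} (hγ : 1 ≤ γ) {cγ Cγ : ℝ} (hcγ : 0 < cγ) (hCγ : 0 < Cγ) :
    ∃ C : ℝ, 0 ≤ C ∧ ∀ (f : ℝ → ℝ) (u₀ : ℝ) (u : ℝ → ℝ), ContinuousOn f (Icc 0 T) →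
      IsSolution α T a b f u₀ u → HasWeightedRegularity (p + 1) σ T M u →
      ∀ (N : ℕ) (t : ℕ → ℝ), IsMesh T N t → IsGraded γ cγ Cγ N t →
        (∀ n, 2 ≤ n → n ≤ N → step t (n - 1) ≤ step t n) →
        4 * T ^ α * (μup / (α * μlow)) ^ 2 * maxStep N t ^ α < 1 →
        ∀ U : ℝ → ℝ, IsDGSolution α p a b f u₀ N t U → ∀ n, 1 ≤ n → n ≤ N →
          |nodeLeft u₀ t U n - u (t n)| ≤
            C * maxStep N t ^ min (γ * σ) ((p : ℝ) + 1) * maxStep N t ∧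
          (2 ≤ p → |nodeLeft u₀ t U n - u (t n)| ≤
            C * maxStep N t ^ min (γ * σ) ((p : ℝ) + 1) * maxStep N t ^ (1 + α)) := by
  obtain ⟨h0, h1⟩ := hα
  have hm : 1 ≤ min p 2 := by omega
  have hM₀ := ha'.const_nonneg hm hT
  have hμup : 0 ≤ μup := (abs_nonneg _).trans (hab 0 ⟨le_rfl, hT.le⟩).2.2
  -- M₀ / α arises from integrating the first derivative bound M₀ t^(α-1) of the coefficients, M₀
  -- from their second derivative bound.
  obtain ⟨A, hA, hnode⟩ := exists_abs_nodeErr_le (M₁ := M₀ / α) (M₂ := M₀) hp h0 h1 hT hμ hμup hM₀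
    hγ hcγ hCγ
  have hpR : (1 : ℝ) ≤ p := by exact_mod_cast hp
  obtain ⟨B, hB, hrate⟩ := exists_polyApprox_deriv (M := M) hp hT hσ (by linarith) hγ hcγ hCγ
  refine ⟨A * (B + 1), by positivity, ?_⟩
  intro f u₀ u hf hu hu' N t ht hg hmono hk U hU n hn1 hn
  have hg' := ht.gradedNodes hT hg hmono
  have hk0 := hg'.k_pos
  have hM := hu'.const_nonneg (by omega) hT
  obtain ⟨P, H, hP⟩ := exists_isErrEq (B := M * T ^ (σ - 1)) h0 h1 hT hp hμ ha hb hab hf hu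
    (fun s hs => (hu'.hasDerivAt (by omega) hs).2.trans (mul_le_mul_of_nonneg_left
      (Real.rpow_le_rpow hs.1.le hs.2.le (by linarith)) hM)) ht hU
  set R := maxStep N t ^ min (γ * σ) ((p : ℝ) + 1)
  have hR : 0 < R := by positivity
  have := hnode _ N t _ _ _ _ P ((B + 1) * R) hg' H
    (fun x y hx hxy hy => ha'.clamp_sub_le h0 hm ha hx hxy hy)
    (fun x y hx hxy hy => hb'.clamp_sub_le h0 hm hb hx hxy hy) (by positivity) hk.le
    (fun j hj => (hrate _ N t u hg' hu' j hj).mono le_rfl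
      (div_le_div_of_nonneg_right (by nlinarith) (sub_pos.2 (hg'.lt j hj)).le)) n hn1 hn
  rw [hP n hn, mul_assoc A]
  refine ⟨this.1, fun h2 => this.2 h2 (fun x₀ x₁ hx0 hx hx1 => ?_) fun x₀ x₁ hx0 hx hx1 => ?_⟩
  · rw [min_eq_right h2] at ha'
    exact ha'.clamp_polyApprox h1 hM₀ hx0 hx hx1
  · rw [min_eq_right h2] at hb'
    exact hb'.clamp_polyApprox h1 hM₀ hx0 hx hx1

end DGVolterra

end

theorem mainTheorem1 (α : ℝ) (hα : α ∈ Set.Ioo (0 : ℝ) 1) (p : ℕ) (hp : 1 ≤ p)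
    (T : ℝ) (hT : 0 < T)
    -- the coefficients
    (a b : ℝ → ℝ) (ha : ContinuousOn a (Set.Icc 0 T)) (hb : ContinuousOn b (Set.Icc 0 T))
    (M₀ : ℝ) (ha' : DGVolterra.HasWeightedRegularity (min p 2) α T M₀ a)
    (hb' : DGVolterra.HasWeightedRegularity (min p 2) α T M₀ b)
    (μlow μup : ℝ) (hμ : 0 < μlow)
    (hab : ∀ t ∈ Set.Icc 0 T, μlow ≤ a t ∧ a t ≤ μup ∧ |b t| ≤ μup)
    -- the regularity and grading parameters
    (σ : ℝ) (hσ : 1 ≤ σ) (hσα : σ ≤ α + 1) (M : ℝ)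
    (γ : ℝ) (hγ : 1 ≤ γ) (cγ Cγ : ℝ) (hcγ : 0 < cγ) (hCγ : 0 < Cγ) :
    ∃ C : ℝ, ∀ (f : ℝ → ℝ) (u₀ : ℝ) (u : ℝ → ℝ),
      ContinuousOn f (Set.Icc 0 T) →
      DGVolterra.IsSolution α T a b f u₀ u →
      DGVolterra.HasWeightedRegularity (p + 1) σ T M u →
      ∀ (N : ℕ) (t : ℕ → ℝ), DGVolterra.IsMesh T N t →
        DGVolterra.IsGraded γ cγ Cγ N t →
        (∀ n, 2 ≤ n → n ≤ N → DGVolterra.step t (n - 1) ≤ DGVolterra.step t n) →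
        4 * T ^ α * (μup / (α * μlow)) ^ 2 * DGVolterra.maxStep N t ^ α < 1 →
        ∀ U : ℝ → ℝ, DGVolterra.IsDGSolution α p a b f u₀ N t U →
        ∀ n, 1 ≤ n → n ≤ N →
          (p = 1 →
            |DGVolterra.nodeLeft u₀ t U n - u (t n)|
              ≤ C * DGVolterra.maxStep N t * DGVolterra.maxStep N t ^ min (γ * σ) 2) ∧
          (2 ≤ p →
            |DGVolterra.nodeLeft u₀ t U n - u (t n)|
              ≤ C * max 1 (Real.log n) * DGVolterra.maxStep N t ^ (α + 1)
                * DGVolterra.maxStep N t ^ min (γ * σ) ((p : ℝ) + 1)) ∧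
          (((p : ℝ) + 1) / σ < γ →
            |DGVolterra.nodeLeft u₀ t U n - u (t n)|
              ≤ C * DGVolterra.maxStep N t ^ ((p : ℝ) + 1 + min (p : ℝ) (α + 1))) := by
  obtain ⟨C, hC, h⟩ := DGVolterra.exists_abs_nodeLeft_sub_le hα hp hT ha hb ha' hb' hμ hab hσ hσα M
    hγ hcγ hCγ
  refine ⟨C, ?_⟩
  intro f u₀ u hf hu hu' N t ht hg hmono hk U hU n hn1 hn
  obtain ⟨e1, e2⟩ := h f u₀ u hf hu hu' N t ht hg hmono hk U hU n hn1 hn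
  have hk0 := (ht.gradedNodes hT hg hmono).k_pos
  set k := DGVolterra.maxStep N t
  refine ⟨fun hp1 => ?_, fun hp2 => ?_, fun hγσ => ?_⟩
  · subst hp1
    rw [Nat.cast_one, one_add_one_eq_two] at e1
    exact e1.trans (le_of_eq (by ring))
  -- The estimate holds without the logarithm; it suffices that max{1, log n} ≥ 1.
  · refine (e2 hp2).trans ?_
    rw [add_comm 1 α]
    calc _ = C * 1 * k ^ (α + 1) * k ^ min (γ * σ) ((p : ℝ) + 1) := by ring
      _ ≤ _ := by
        gcongr
        exact le_max_left _ _
  · have hmin : min (γ * σ) ((p : ℝ) + 1) = p + 1 :=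
      min_eq_right ((div_lt_iff₀ (by linarith)).1 hγσ).le
    rw [hmin] at e1 e2
    rw [Real.rpow_add hk0, ← mul_assoc]
    -- Since 1 < α + 1 < 2, the minimum of p and α + 1 is p for p = 1 and α + 1 for p ≥ 2, matching
    -- the two available estimates.
    rcases hp.eq_or_lt with rfl | hp2
    · rw [Nat.cast_one, min_eq_left (by linarith [hα.1]), Real.rpow_one]
      exact_mod_cast e1
    · have : (2 : ℝ) ≤ p := by exact_mod_cast hp2
      rw [min_eq_right (by linarith [hα.2]), add_comm α 1]
      exact e2 hp2
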